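/- \textbf{Setting.} Let $T$ be an ordinal tree with $n\ge 1$ nodes, identified with their preorder ranks $1,\dots,n$; let $B>H\ge 3$ be integers and let $o\in\{1,\dots,H\}$. The \emph{s-nodes} are the nodes whose depth is one of $o,\,o+H,\,o+2H,\dots$, and for $i\ge 0$ the \emph{$i$th slab} is $S_i=\{v : (i-1)H+o\le \mathrm{depth}(v)\le iH+o\}$. So an s-node lies in two consecutive slabs: on the last level of $S_i$ (its \emph{promoted} copy) and on the first level of $S_{i+1}$ (its \emph{original} copy). Every nonempty slab $S_i$ is regarded as a single ordinal tree: for $i\ge 1$ a \emph{dummy root} is added, whose children are the nodes on the first level of $S_i$ in left-to-right order ($S_0$ is already a tree). Parents, children and edges below are those of these slab trees; copies of a node in different slabs are regarded as different. \textbf{Theorem (Tree Slabbing).} There are an absolute constant $C$ and a word-RAM algorithm such that for all integers $B>H\ge 3$ and every ordinal tree $T$ with $n$ nodes, the algorithm, given $n$, $H$, $B$ and the array of the parents of the nodes $1,\dots,n$, computes in at most $Cn$ steps (on words of any number $w$ of bits with $B<2^w$ and $Cn\le 2^w$) a list of subtrees with the following properties, where $o\in\{1,\dots,H\}$ is a value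 that minimizes the number of s-nodes. \begin{enumerate} \item Each subtree is a connected rooted subtree of one slab tree, and every node of every slab tree, including the dummy roots, is in a subtree. Subtrees of the same slab are pairwise disjoint except for (potentially) sharing a common root. \item Each subtree has at most $2B$ nodes, including a dummy root, and height at most $H$, where a dummy root is not counted: the depths in $T$ of any two of its nodes other than the dummy root differ by at most $H$. \item Each subtree is either \emph{pure} (a connected induced subgraph of $T$) or \emph{glued} (a dummy root, whose children are the roots of connected induced subgraphs of $T$). \item Each subtree is either \emph{skinny} (an entire slab $S_i$ with $|S_i|\le B$, together with its dummy root if $i\ge 1$) or \emph{fat} (a subtree of a slab $S_i$ with $|S_i|>B$). \item The number of subtrees is at most $C(n/H+1)$, and at most $Cn/B$ of them are fat. \item Say that two different subtrees are connected if they belong to the same slab and share a node or are joined by an edge of the slab tree, or if they belong to different slabs and contain copies of the same node. Each connection between two subtrees is, for one of the two ways of calling them $\mu$ and $\mu'$, of one of the following types. \begin{enumerate} \item[1.] $\mu$ and $\mu'$ share a common root. Each subtree that shares its root contains at most two blocks of consecutive children of that root. \item[2.] The root of $\mu'$ is a child of the root of $\mu$. \item[3.] The root of $\mu'$ is a child of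 another node in $\mu$. At most one edge leads from a node of $\mu$ other than its root to a node outside $\mu$. \item[4.] $\mu'$ contains the original copy of a promoted s-node in $\mu$. The total number of these connections (triples of $\mu$, $\mu'$ and the s-node) is at most $Cn/H$. \end{enumerate} \end{enumerate} -/

import Mathlib

/-! ### The word RAM

Memory cells and registers hold words of `w` bits, represented as natural numbers below `2 ^ w`.
Addresses are words. A program is a finite structured program; every literal, register access,
memory access, arithmetic/logic operation, assignment, store and test costs one time unit. -/

namespace WordRAM

/-- The word operations. -/
inductive BinOp
  | add | sub | mul | div | mod | and | or | xor | shl | shr | lt | eq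

/-- The operations on `w`-bit words (comparisons return `1` or `0`). -/
def BinOp.eval (w : ℕ) : BinOp → ℕ → ℕ → ℕ
  | .add, a, b => (a + b) % 2 ^ w
  | .sub, a, b => (a + (2 ^ w - b)) % 2 ^ w
  | .mul, a, b => (a * b) % 2 ^ w
  | .div, a, b => (a / b) % 2 ^ w
  | .mod, a, b => (a % b) % 2 ^ w
  | .and, a, b => (a &&& b) % 2 ^ w
  | .or, a, b => (a ||| b) % 2 ^ w
  | .xor, a, b => (a ^^^ b) % 2 ^ w
  | .shl, a, b => (a <<< b) % 2 ^ w
  | .shr, a, b => (a >>> b) % 2 ^ w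
  | .lt, a, b => (if a < b then 1 else 0) % 2 ^ w
  | .eq, a, b => (if a = b then 1 else 0) % 2 ^ w

/-- Expressions: literals, registers, the memory cell at a computed address, operations. -/
inductive Expr
  | lit (k : ℕ)
  | reg (r : ℕ)
  | load (addr : Expr)
  | bin (op : BinOp) (a b : Expr)

/-- A machine state: the contents of the registers and of the memory. -/
structure State where
  reg : ℕ → ℕ
  mem : ℕ → ℕ

/-- The value of an expression. -/
def Expr.eval (w : ℕ) (σ : State) : Expr → ℕ
  | .lit k => k % 2 ^ w
  | .reg r => σ.reg r
  | .load e => σ.mem (e.eval w σ)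
  | .bin op a b => op.eval w (a.eval w σ) (b.eval w σ)

/-- The time needed to evaluate an expression: its number of constituents. -/
def Expr.cost : Expr → ℕ
  | .lit _ => 1
  | .reg _ => 1
  | .load e => e.cost + 1
  | .bin _ a b => a.cost + b.cost + 1

/-- Programs. A test succeeds when its value is not `0`. -/
inductive Program
  | skip
  | assign (r : ℕ) (e : Expr)
  | store (addr e : Expr)
  | seq (p q : Program)
  | branch (test : Expr) (p q : Program)
  | loop (test : Expr) (p : Program)

/-- `p.Exec w σ τ t`: on a machine with `w`-bit words, `p` started in state `σ` halts in
state `τ` after exactly `t` time units. -/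
inductive Program.Exec (w : ℕ) : Program → State → State → ℕ → Prop
  | skip (σ : State) : Program.Exec w .skip σ σ 1
  | assign (σ : State) (r : ℕ) (e : Expr) :
      Program.Exec w (.assign r e) σ
        { σ with reg := Function.update σ.reg r (e.eval w σ) } (e.cost + 1)
  | store (σ : State) (a e : Expr) :
      Program.Exec w (.store a e) σ
        { σ with mem := Function.update σ.mem (a.eval w σ) (e.eval w σ) } (a.cost + e.cost + 1)
  | seq {p q : Program} {σ₁ σ₂ σ₃ : State} {s t : ℕ} :
      Program.Exec w p σ₁ σ₂ s → Program.Exec w q σ₂ σ₃ t →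
        Program.Exec w (.seq p q) σ₁ σ₃ (s + t)
  | branch_true {b : Expr} {p q : Program} {σ τ : State} {t : ℕ} :
      b.eval w σ ≠ 0 → Program.Exec w p σ τ t →
        Program.Exec w (.branch b p q) σ τ (b.cost + 1 + t)
  | branch_false {b : Expr} {p q : Program} {σ τ : State} {t : ℕ} :
      b.eval w σ = 0 → Program.Exec w q σ τ t →
        Program.Exec w (.branch b p q) σ τ (b.cost + 1 + t)
  | loop_true {b : Expr} {p : Program} {σ₁ σ₂ σ₃ : State} {s t : ℕ} :
      b.eval w σ₁ ≠ 0 → Program.Exec w p σ₁ σ₂ s → Program.Exec w (.loop b p) σ₂ σ₃ t →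
        Program.Exec w (.loop b p) σ₁ σ₃ (b.cost + 1 + s + t)
  | loop_false {b : Expr} {p : Program} {σ : State} :
      b.eval w σ = 0 → Program.Exec w (.loop b p) σ σ (b.cost + 1)

end WordRAM

noncomputable section

/-- An ordinal tree with `n ≥ 1` nodes. The nodes are identified with their ranks `1, …, n` in a
preorder traversal, so `1` is the root and siblings are ordered by their ranks; `parent 1 = 0`
stands for "no parent". The numbers `1, …, n` are preorder ranks exactly when the parent of
`v + 1` is `v` itself or a proper ancestor of `v`. -/
structure OrdinalTree (n : ℕ) where
  parent : ℕ → ℕ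
  pos : 1 ≤ n
  parent_zero : parent 0 = 0
  parent_one : parent 1 = 0
  preorder : ∀ v, 1 ≤ v → v < n → parent (v + 1) ≠ 0 ∧ ∃ k, parent^[k] v = parent (v + 1)

/-- A subtree occurring in a decomposition: the index of the slab it belongs to, its root and its
set of nodes (with the root). The number `0` stands for the dummy root of the slab. -/
@[ext]
structure SlabSubtree where
  slab : ℕ
  root : ℕ
  nodes : Finset ℕ

namespace OrdinalTree

variable {n : ℕ} (T : OrdinalTree n)

/-- The number of edges between the root and `v`. -/
def depth (v : ℕ) : ℕ := sInf {k | T.parent^[k] v = 1}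

/-- `a` is an ancestor of `v` or `v` itself. -/
def IsAncestor (a v : ℕ) : Prop := ∃ k, T.parent^[k] v = a

/-- The tree as an undirected graph (numbers that are not nodes are isolated). -/
def graph : SimpleGraph ℕ :=
  SimpleGraph.fromRel fun u v => u ∈ Finset.Icc 1 n ∧ v ∈ Finset.Icc 1 n ∧ T.parent v = u

/-- The s-nodes: the nodes on the levels `o, o + H, o + 2 H, …`. -/
def sNodes (H o : ℕ) : Finset ℕ :=
  (Finset.Icc 1 n).filter fun v => o ≤ T.depth v ∧ H ∣ T.depth v - o

/-- The `i`-th slab: the nodes whose depth lies in `[(i - 1) H + o .. i H + o]`. -/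
def slab (H o i : ℕ) : Finset ℕ :=
  (Finset.Icc 1 n).filter fun v => i * H + o ≤ T.depth v + H ∧ T.depth v ≤ i * H + o

/-- The nodes of the `i`-th slab, with the dummy root `0` added if `i ≥ 1`. (Slab `0` is a single
tree with root `1` and needs no dummy root.) -/
def slabNodes (H o i : ℕ) : Finset ℕ :=
  if T.slab H o i = ∅ then ∅ else if i = 0 then T.slab H o i else insert 0 (T.slab H o i)

/-- In the `i`-th slab, turned into one tree by the dummy root, `v` is a child of `u`: the nodes on
the first level of a slab `i ≥ 1` are the children of the dummy root, and all other parents are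
those of `T`. -/
def IsSlabChild (H o i u v : ℕ) : Prop :=
  v ∈ T.slab H o i ∧ u ∈ T.slabNodes H o i ∧
    u = if T.depth v + H = i * H + o then 0 else T.parent v

/-- `μ` is a connected (rooted) subtree of its slab: every node other than the root has its
parent in `μ`. -/
def IsSubtree (H o : ℕ) (μ : SlabSubtree) : Prop :=
  μ.nodes ⊆ T.slabNodes H o μ.slab ∧ μ.root ∈ μ.nodes ∧
    ∀ v ∈ μ.nodes, v ≠ μ.root → ∃ u ∈ μ.nodes, T.IsSlabChild H o μ.slab u v

/-- `μ` is pure: a connected induced subgraph of `T`. -/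
def IsPure (μ : SlabSubtree) : Prop :=
  0 ∉ μ.nodes ∧ (T.graph.induce {v | v ∈ μ.nodes}).Connected

/-- `μ` is glued: a dummy root, whose children are the roots of connected induced subgraphs of `T`
that make up the rest of `μ`. -/
def IsGlued (H o : ℕ) (μ : SlabSubtree) : Prop :=
  μ.root = 0 ∧
    (∀ v ∈ μ.nodes, v ≠ 0 →
      ∃ c ∈ μ.nodes, T.IsSlabChild H o μ.slab 0 c ∧ T.IsAncestor c v) ∧
    ∀ c ∈ μ.nodes, T.IsSlabChild H o μ.slab 0 c →
      (T.graph.induce {v | v ∈ μ.nodes ∧ T.IsAncestor c v}).Connected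

/-- `μ` is skinny: an entire slab (with its dummy root) of at most `B` nodes. -/
def IsSkinny (H B o : ℕ) (μ : SlabSubtree) : Prop :=
  (T.slab H o μ.slab).card ≤ B ∧ μ.nodes = T.slabNodes H o μ.slab

/-- `μ` is fat: a subtree of a slab of more than `B` nodes. -/
def IsFat (H B o : ℕ) (μ : SlabSubtree) : Prop := B < (T.slab H o μ.slab).card

instance (H B o : ℕ) : DecidablePred (T.IsFat H B o) :=
  fun μ => inferInstanceAs (Decidable (B < (T.slab H o μ.slab).card))

/-- There is a connection between `μ` and `μ'`: inside one slab, a common node or an edge of the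
slab (with its dummy root) from a node of `μ` to a node of `μ'`; between different slabs, a common
node of `T`. -/
def IsConnection (H o : ℕ) (μ μ' : SlabSubtree) : Prop :=
  (μ.slab = μ'.slab ∧ ∃ v, v ∈ μ.nodes ∧ v ∈ μ'.nodes) ∨
  (μ.slab = μ'.slab ∧ ∃ u ∈ μ.nodes, ∃ v ∈ μ'.nodes, T.IsSlabChild H o μ.slab u v) ∨
  (μ.slab ≠ μ'.slab ∧ ∃ v, v ≠ 0 ∧ v ∈ μ.nodes ∧ v ∈ μ'.nodes)

/-- Type 1: `μ` and `μ'` share a common root. -/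
def SharesRoot (μ μ' : SlabSubtree) : Prop := μ.slab = μ'.slab ∧ μ.root = μ'.root

/-- Type 2: the root of `μ'` is a child of the root of `μ`. -/
def RootBelowRoot (H o : ℕ) (μ μ' : SlabSubtree) : Prop :=
  μ.slab = μ'.slab ∧ T.IsSlabChild H o μ.slab μ.root μ'.root

/-- Type 3: the root of `μ'` is a child of another node in `μ`. -/
def RootBelowOther (H o : ℕ) (μ μ' : SlabSubtree) : Prop :=
  μ.slab = μ'.slab ∧ ∃ u ∈ μ.nodes, u ≠ μ.root ∧ T.IsSlabChild H o μ.slab u μ'.root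

/-- Type 4, through `v`: `v` is a promoted s-node in `μ` (it lies on the last level of the slab of
`μ`), and its original copy, which belongs to the next slab, is in `μ'`. -/
def ThroughPromoted (H o : ℕ) (μ μ' : SlabSubtree) (v : ℕ) : Prop :=
  μ'.slab = μ.slab + 1 ∧ v ∈ T.sNodes H o ∧ T.depth v = μ.slab * H + o ∧
    v ∈ μ.nodes ∧ v ∈ μ'.nodes

instance (H o : ℕ) (μ μ' : SlabSubtree) (v : ℕ) : Decidable (T.ThroughPromoted H o μ μ' v) :=
  inferInstanceAs (Decidable (_ ∧ _ ∧ _ ∧ _ ∧ _))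

/-- The children of the root of `μ` that are in `μ` form at most two blocks of consecutive
children. -/
def AtMostTwoBlocks (H o : ℕ) (μ : SlabSubtree) : Prop :=
  ∃ a b c d : ℕ, ∀ v, T.IsSlabChild H o μ.slab μ.root v →
    (v ∈ μ.nodes ↔ (a ≤ v ∧ v ≤ b) ∨ (c ≤ v ∧ v ≤ d))

/-- The connections of type 4 in `D`, each with the s-node that it goes through. -/
def promotedConnections (H o : ℕ) (D : Finset SlabSubtree) :
    Finset ((SlabSubtree × SlabSubtree) × ℕ) :=
  ((D ×ˢ D) ×ˢ Finset.Icc 1 n).filter fun x => T.ThroughPromoted H o x.1.1 x.1.2 x.2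

/-- `D` is a decomposition of `T` into subtrees, for slabs of height `H` cut at offset `o` and for
block size `B`, with all properties of tree slabbing apart from the bounds on the numbers of
subtrees and connections. -/
structure IsTreeSlabbing (H B o : ℕ) (D : Finset SlabSubtree) : Prop where
  /-- The offset lies in `[1 .. H]` and minimizes the number of s-nodes. -/
  offset_mem : 1 ≤ o ∧ o ≤ H
  offset_min : ∀ o', 1 ≤ o' → o' ≤ H → (T.sNodes H o).card ≤ (T.sNodes H o').card
  subtree : ∀ μ ∈ D, T.IsSubtree H o μ
  cover : ∀ i, ∀ v ∈ T.slabNodes H o i, ∃ μ ∈ D, μ.slab = i ∧ v ∈ μ.nodes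
  /-- Subtrees of one slab are disjoint except for a common root. (Different slabs overlap in the
  two copies of the s-nodes only.) -/
  disjoint : ∀ μ ∈ D, ∀ μ' ∈ D, μ ≠ μ' → μ.slab = μ'.slab →
    ∀ v, v ∈ μ.nodes → v ∈ μ'.nodes → v = μ.root ∧ v = μ'.root
  size_le : ∀ μ ∈ D, μ.nodes.card ≤ 2 * B
  /-- The height, with a dummy root not counted, is at most `H`. -/
  height_le : ∀ μ ∈ D, ∀ u ∈ μ.nodes, ∀ v ∈ μ.nodes, u ≠ 0 → v ≠ 0 →
    T.depth v ≤ T.depth u + H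
  pure_or_glued : ∀ μ ∈ D, T.IsPure μ ∨ T.IsGlued H o μ
  skinny_or_fat : ∀ μ ∈ D, T.IsSkinny H B o μ ∨ T.IsFat H B o μ
  connection : ∀ μ ∈ D, ∀ μ' ∈ D, μ ≠ μ' →
    (T.IsConnection H o μ μ' ∨ T.IsConnection H o μ' μ) →
      SharesRoot μ μ' ∨
      (T.RootBelowRoot H o μ μ' ∨ T.RootBelowRoot H o μ' μ) ∨
      (T.RootBelowOther H o μ μ' ∨ T.RootBelowOther H o μ' μ) ∨
      ((∃ v, T.ThroughPromoted H o μ μ' v) ∨ ∃ v, T.ThroughPromoted H o μ' μ v)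
  two_blocks : ∀ μ ∈ D, ∀ μ' ∈ D, μ ≠ μ' → SharesRoot μ μ' → T.AtMostTwoBlocks H o μ
  /-- At most one edge leads from a node of `μ` other than the root out of `μ`. -/
  external_edge : ∀ μ ∈ D, ∀ u u' v v', u ∈ μ.nodes → u' ∈ μ.nodes →
    u ≠ μ.root → u' ≠ μ.root → v ∉ μ.nodes → v' ∉ μ.nodes →
    T.IsSlabChild H o μ.slab u v → T.IsSlabChild H o μ.slab u' v' → u = u' ∧ v = v'

/-- The initial state of the machine: `n`, `H`, `B` in the registers `0`, `1`, `2`, the parents of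
the nodes `1, …, n` in the memory cells `1, …, n`, and `0` everywhere else. -/
def input (H B : ℕ) : WordRAM.State where
  reg r := if r = 0 then n else if r = 1 then H else if r = 2 then B else 0
  mem v := if v ∈ Finset.Icc 1 n then T.parent v else 0

end OrdinalTree

/-- The words that describe a list of subtrees: their number, followed for each subtree by the
index of its slab, its root, its number of nodes, and its nodes in increasing order. -/
def SlabSubtree.encodeList (L : List SlabSubtree) : List ℕ :=
  L.length :: L.flatMap fun μ => μ.slab :: μ.root :: μ.nodes.card :: μ.nodes.sort (· ≤ ·)

/-- In the state `σ` of a machine with `w`-bit words, the family `D` is written, in some order and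
without repetition, in consecutive memory cells that start at the address in register `0`. -/
def WordRAM.State.Outputs (w : ℕ) (σ : WordRAM.State) (D : Finset SlabSubtree) : Prop :=
  ∃ L : List SlabSubtree, L.Nodup ∧ (∀ μ, μ ∈ L ↔ μ ∈ D) ∧
    σ.reg 0 + (SlabSubtree.encodeList L).length ≤ 2 ^ w ∧
    ∀ (j : ℕ) (hj : j < (SlabSubtree.encodeList L).length),
      σ.mem (σ.reg 0 + j) = (SlabSubtree.encodeList L)[j]

end

/-! Offset. The sets of s-nodes for the offsets in [1 .. H] are pairwise disjoint, so the smallest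
has at most n/H elements (`mul_card_sNodes_le`). Every nonempty slab after the first has an s-node
on its first level, so there are at most n/H + 1 slab trees. They are stored in one array of at most
3n indices (per node a promoted copy, an original copy and possibly a new dummy root), parents
before children. Dummy roots weigh 0 and other copies 1, so the size of a slab tree is the size of
its slab. An index is heavy if its subtree weighs more than B, and light otherwise.

Decomposition. A slab tree with a light root is one skinny subtree. In the other slab trees the
heavy indices form a subtree at the top. The own size of a heavy index is its weight plus the sizes
of its light children. A heavy index is split if it is a root, if its number of heavy children is
not 1, or if its own size exceeds B. The subtrees of the light children of a split index are packed
greedily from left to right into groups of size at most 2B that share the split index as root; a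
heavy child interrupts the current group, so each group takes a single block of consecutive
children. The remaining heavy indices form downward chains with one heavy child and own size at most
B each. Consecutive chain indices, with their light subtrees, are again packed greedily into groups
of size at most 2B. Light subtrees are never cut, so only the lowest chain index of a group has an
edge to a node below the group (`heavy_child_le`, `external_edge`).

Counting. The own sizes of the heavy indices add up to at most the total weight, so O(n/B) of them
have own size above B. Every other split index has two heavy children, or is a root with a heavy
child; counting the edges between heavy indices shows that these are no more numerous than the
former (`card_split_le`). A new group with a heavy root is due to a split index, to a heavy child of
a split index (one chain begins, one packing is interrupted), or to the overflow of an earlier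
group. An overflowing group is larger than B, because at most B was to be added, and such groups
have disjoint members. This gives O(n/B) fat subtrees (`mul_card_heavy_le`). A connection of type 4
is determined by its s-node, or by a fat subtree that has the s-node as root
(`card_promotedConnections_le`).

Computation. The decomposition is found by eight passes with loop-free bodies. They are written in a
small language of bounded arrays, whose compilation to the word RAM is verified once
(`exec_compilePhases`); each pass is then verified by a loop invariant. As H and B may be much
larger than n, the program works with min H n and min B n, which changes nothing. -/

/-! ### Bounded array programs and their simulation on the word RAM -/

namespace WordRAM

/-- The arrays that the tree slabbing program works with. Scalars are arrays of which only the cell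
`0` is used. -/
inductive Arr
  | par | nn | hh | bb | res | cnt | off | tot | fp | lab | fs | idx | pos | dum
  | sz | own | hv | memb | cur | acc | rt | num | csz | cpos | out | ptr
  deriving DecidableEq

/-- The rank of an array in the memory layout. -/
def Arr.rank : Arr → ℕ
  | par => 0 | nn => 1 | hh => 2 | bb => 3 | res => 4 | cnt => 5 | off => 6 | tot => 7 | fp => 8
  | lab => 9 | fs => 10 | idx => 11 | pos => 12 | dum => 13 | sz => 14 | own => 15 | hv => 16
  | memb => 17 | cur => 18 | acc => 19 | rt => 20 | num => 21 | csz => 22 | cpos => 23 | out => 24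
  | ptr => 25

theorem Arr.rank_injective : Function.Injective Arr.rank := by
  intro a b h
  cases a <;> cases b <;> first | rfl | (exact absurd h (by decide))

theorem Arr.rank_le (a : Arr) : a.rank ≤ 25 := by cases a <;> decide

/-- The contents of all arrays. -/
abbrev Arrays := Arr → ℕ → ℕ

/-- Expressions over arrays. -/
inductive HExpr
  | zero
  | one
  | ctr
  | get (a : Arr) (i : HExpr)
  | add (x y : HExpr)
  | sub (x y : HExpr)
  | lt (x y : HExpr)
  | eq (x y : HExpr)

/-- Addition that returns `0` instead of a value above `K`. -/
def capAdd (K x y : ℕ) : ℕ := if x + y ≤ K then x + y else 0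

theorem capAdd_eq {K x y : ℕ} (h : x + y ≤ K) : capAdd K x y = x + y := if_pos h

theorem capAdd_le (K x y : ℕ) : capAdd K x y ≤ K := by
  unfold capAdd; split_ifs <;> omega

/-- The value of an expression, when the loop counter is `k`. -/
def HExpr.eval (K k : ℕ) (A : Arrays) : HExpr → ℕ
  | zero => 0
  | one => 1
  | ctr => k
  | get a i => A a (i.eval K k A)
  | add x y => capAdd K (x.eval K k A) (y.eval K k A)
  | sub x y => x.eval K k A - y.eval K k A
  | lt x y => if x.eval K k A < y.eval K k A then 1 else 0
  | eq x y => if x.eval K k A = y.eval K k A then 1 else 0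

/-- The value of a scalar. -/
abbrev HExpr.var (a : Arr) : HExpr := .get a .zero

/-- Loop-free programs over arrays. -/
inductive HProg
  | skip
  | put (a : Arr) (i e : HExpr)
  | seq (p q : HProg)
  | ite (test : HExpr) (p q : HProg)

/-- The arrays with one cell changed. -/
def Arrays.set (A : Arrays) (a : Arr) (i v : ℕ) : Arrays :=
  Function.update A a (Function.update (A a) i v)

theorem Arrays.set_same (A : Arrays) (a : Arr) (i v : ℕ) :
    A.set a i v a = Function.update (A a) i v := by simp [Arrays.set]

theorem Arrays.set_of_ne (A : Arrays) {a b : Arr} (h : b ≠ a) (i v : ℕ) : A.set a i v b = A b := by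
  simp [Arrays.set, h]

/-- The effect of a loop-free program. -/
def HProg.run (K k : ℕ) : HProg → Arrays → Arrays
  | skip, A => A
  | put a i e, A => A.set a (i.eval K k A) (e.eval K k A)
  | seq p q, A => q.run K k (p.run K k A)
  | ite t p q, A => if t.eval K k A ≠ 0 then p.run K k A else q.run K k A

theorem HExpr.eval_zero {K k : ℕ} {A : Arrays} : zero.eval K k A = 0 := by rw [HExpr.eval]

theorem HExpr.eval_one {K k : ℕ} {A : Arrays} : one.eval K k A = 1 := by rw [HExpr.eval]

theorem HExpr.eval_ctr {K k : ℕ} {A : Arrays} : ctr.eval K k A = k := by rw [HExpr.eval]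

theorem HExpr.eval_get {K k : ℕ} {A : Arrays} (a : Arr) (i : HExpr) :
    (get a i).eval K k A = A a (i.eval K k A) := by rw [HExpr.eval]

theorem HExpr.eval_add {K k : ℕ} {A : Arrays} (x y : HExpr) :
    (add x y).eval K k A = capAdd K (x.eval K k A) (y.eval K k A) := by rw [HExpr.eval]

theorem HExpr.eval_sub {K k : ℕ} {A : Arrays} (x y : HExpr) :
    (sub x y).eval K k A = x.eval K k A - y.eval K k A := by rw [HExpr.eval]

theorem HProg.run_skip {K k : ℕ} (A : Arrays) : skip.run K k A = A := rfl

theorem HProg.run_put {K k : ℕ} (a : Arr) (i e : HExpr) (A : Arrays) :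
    (put a i e).run K k A = A.set a (i.eval K k A) (e.eval K k A) := rfl

theorem HProg.run_seq {K k : ℕ} (p q : HProg) (A : Arrays) :
    (seq p q).run K k A = q.run K k (p.run K k A) := rfl

theorem HProg.run_ite_eq {K k : ℕ} (x y : HExpr) (p q : HProg) (A : Arrays) :
    (ite (.eq x y) p q).run K k A =
      if x.eval K k A = y.eval K k A then p.run K k A else q.run K k A := by
  by_cases h : x.eval K k A = y.eval K k A <;> simp [HProg.run, HExpr.eval, h]

theorem HProg.run_ite_lt {K k : ℕ} (x y : HExpr) (p q : HProg) (A : Arrays) :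
    (ite (.lt x y) p q).run K k A =
      if x.eval K k A < y.eval K k A then p.run K k A else q.run K k A := by
  by_cases h : x.eval K k A < y.eval K k A <;> simp [HProg.run, HExpr.eval, h]

/-- Whether a program may change an array. -/
def HProg.writes (b : Arr) : HProg → Bool
  | skip => false
  | put a _ _ => decide (b = a)
  | seq p q => p.writes b || q.writes b
  | ite _ p q => p.writes b || q.writes b

theorem HProg.run_of_not_writes {K k : ℕ} {b : Arr} (p : HProg) :
    ∀ A, p.writes b = false → p.run K k A b = A b := by
  induction p with
  | skip => intro A _; rfl
  | put a i e =>
    intro A h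
    exact Arrays.set_of_ne A (by simpa [HProg.writes] using h) _ _
  | seq p q hp hq =>
    intro A h
    simp only [HProg.writes, Bool.or_eq_false_iff] at h
    simp only [HProg.run, hq _ h.2, hp _ h.1]
  | ite t p q hp hq =>
    intro A h
    simp only [HProg.writes, Bool.or_eq_false_iff] at h
    simp only [HProg.run]
    split_ifs
    · exact hp _ h.1
    · exact hq _ h.2

/-- All values stored are at most `K`. -/
def Arrays.Bounded (K : ℕ) (A : Arrays) : Prop := ∀ a x, A a x ≤ K

/-- The cap in `capAdd` keeps all values at most `K` whatever a program does, so addresses stay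
inside their arrays. That the cap never acts is shown separately for each phase, with `capAdd_eq`.
-/
theorem HExpr.eval_le {K k : ℕ} {A : Arrays} (hK : 1 ≤ K) (hk : k ≤ K) (hA : A.Bounded K)
    (e : HExpr) : e.eval K k A ≤ K := by
  induction e with
  | zero => exact Nat.zero_le _
  | one => exact hK
  | ctr => exact hk
  | get a i _ => exact hA _ _
  | add x y _ _ => exact capAdd_le _ _ _
  | sub x y hx _ => exact (Nat.sub_le _ _).trans hx
  | lt x y _ _ => simp only [HExpr.eval]; split_ifs <;> omega
  | eq x y _ _ => simp only [HExpr.eval]; split_ifs <;> omega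

theorem Arrays.Bounded.set {K : ℕ} {A : Arrays} (hA : A.Bounded K) (a : Arr) (i : ℕ) {v : ℕ}
    (hv : v ≤ K) : (A.set a i v).Bounded K := by
  intro b x
  by_cases hb : b = a
  · subst hb
    rw [Arrays.set_same]
    by_cases hx : x = i
    · subst hx; simpa using hv
    · rw [Function.update_of_ne hx]; exact hA _ _
  · rw [Arrays.set_of_ne A hb]; exact hA _ _

/-- The address of a cell; register `3` holds the stride. -/
def Arr.addr (a : Arr) (e : Expr) : Expr := .bin .add (.bin .mul (.lit a.rank) (.reg 3)) e

/-- Translation of expressions; register `4` is the loop counter. -/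
def HExpr.compile : HExpr → Expr
  | zero => .lit 0
  | one => .lit 1
  | ctr => .reg 4
  | get a i => .load (a.addr i.compile)
  | add x y =>
    .bin .mul (.bin .lt (.bin .add x.compile y.compile) (.reg 3)) (.bin .add x.compile y.compile)
  | sub x y => .bin .mul (.bin .lt y.compile x.compile) (.bin .sub x.compile y.compile)
  | lt x y => .bin .lt x.compile y.compile
  | eq x y => .bin .eq x.compile y.compile

/-- Translation of loop-free programs. -/
def HProg.compile : HProg → Program
  | skip => .skip
  | put a i e => .store (a.addr i.compile) e.compile
  | seq p q => .seq p.compile q.compile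
  | ite t p q => .branch t.compile p.compile q.compile

/-- A bound on the running time of a loop-free program. -/
def HProg.cost : HProg → ℕ
  | skip => 1
  | put a i e => (a.addr i.compile).cost + e.compile.cost + 1
  | seq p q => p.cost + q.cost
  | ite t p q => t.compile.cost + 1 + p.cost + q.cost

/-- The machine state `σ` stores the arrays `A`. -/
structure Rep (w K : ℕ) (σ : State) (A : Arrays) : Prop where
  one_le : 1 ≤ K
  room : 26 * (K + 1) ≤ 2 ^ w
  stride : σ.reg 3 = K + 1
  bounded : A.Bounded K
  mem_eq : ∀ a x, x ≤ K → σ.mem (Arr.rank a * (K + 1) + x) = A a x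

theorem Arr.addr_lt {K x : ℕ} (a : Arr) (hx : x ≤ K) :
    a.rank * (K + 1) + x < 26 * (K + 1) := by
  have h := Nat.mul_le_mul_right (K + 1) a.rank_le
  omega

theorem Rep.eval_addr {w K : ℕ} {σ : State} {A : Arrays} (h : Rep w K σ A) (a : Arr) {e : Expr}
    {x : ℕ} (he : e.eval w σ = x) (hx : x ≤ K) :
    (a.addr e).eval w σ = a.rank * (K + 1) + x := by
  have h1 := a.addr_lt hx
  have h2 := h.room
  have h3 := a.rank_le
  simp only [Arr.addr, Expr.eval, BinOp.eval, he, h.stride]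
  rw [Nat.mod_eq_of_lt (a := a.rank) (by omega), Nat.mod_eq_of_lt (a := a.rank * (K + 1)) (by omega),
    Nat.mod_eq_of_lt (by omega)]

/-- Operands are at most `K` and `26 * (K + 1) ≤ 2 ^ w`, so sums are exact. Multiplication by a
comparison bit realizes the cap, and it turns the wrapped difference of a truncated subtraction into
`0`. -/
theorem Rep.eval_compile {w K k : ℕ} {σ : State} {A : Arrays} (h : Rep w K σ A) (hk : k ≤ K)
    (hctr : σ.reg 4 = k) (e : HExpr) : e.compile.eval w σ = e.eval K k A := by
  have hr := h.room
  have h1 := h.one_le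
  induction e with
  | zero => simp [HExpr.compile, Expr.eval, HExpr.eval]
  | one =>
    simp only [HExpr.compile, Expr.eval, HExpr.eval]
    exact Nat.mod_eq_of_lt (by omega)
  | ctr => simpa [HExpr.compile, Expr.eval, HExpr.eval] using hctr
  | get a i ih =>
    have hi := HExpr.eval_le h1 hk h.bounded i
    simp only [HExpr.compile, Expr.eval, HExpr.eval, h.eval_addr a ih hi, h.mem_eq a _ hi]
  | add x y hx hy =>
    have ix := HExpr.eval_le h1 hk h.bounded x
    have iy := HExpr.eval_le h1 hk h.bounded y
    simp only [HExpr.compile, Expr.eval, HExpr.eval, BinOp.eval, hx, hy, h.stride, capAdd]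
    rw [Nat.mod_eq_of_lt (a := x.eval K k A + y.eval K k A) (by omega)]
    by_cases hc : x.eval K k A + y.eval K k A ≤ K
    · rw [if_pos (Nat.lt_succ_of_le hc), if_pos hc, Nat.mod_eq_of_lt (a := 1) (by omega), one_mul,
        Nat.mod_eq_of_lt (by omega)]
    · rw [if_neg (by omega), if_neg hc]; simp
  | sub x y hx hy =>
    have ix := HExpr.eval_le h1 hk h.bounded x
    have iy := HExpr.eval_le h1 hk h.bounded y
    simp only [HExpr.compile, Expr.eval, HExpr.eval, BinOp.eval, hx, hy]
    by_cases hc : y.eval K k A < x.eval K k A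
    · rw [if_pos hc, Nat.mod_eq_of_lt (a := 1) (by omega), one_mul,
        show x.eval K k A + (2 ^ w - y.eval K k A) = (x.eval K k A - y.eval K k A) + 2 ^ w by omega,
        Nat.add_mod_right, Nat.mod_mod, Nat.mod_eq_of_lt (by omega)]
    · rw [if_neg hc]; simp; omega
  | lt x y hx hy =>
    simp only [HExpr.compile, Expr.eval, HExpr.eval, BinOp.eval, hx, hy]
    exact Nat.mod_eq_of_lt (by split_ifs <;> omega)
  | eq x y hx hy =>
    simp only [HExpr.compile, Expr.eval, HExpr.eval, BinOp.eval, hx, hy]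
    exact Nat.mod_eq_of_lt (by split_ifs <;> omega)

theorem Rep.store {w K : ℕ} {σ : State} {A : Arrays} (h : Rep w K σ A) (a : Arr) {i v : ℕ}
    (hi : i ≤ K) (hv : v ≤ K) :
    Rep w K { σ with mem := Function.update σ.mem (a.rank * (K + 1) + i) v } (A.set a i v) where
  one_le := h.one_le
  room := h.room
  stride := h.stride
  bounded := h.bounded.set a i hv
  mem_eq b x hx := by
    by_cases hb : b = a
    · subst hb
      rw [Arrays.set_same]
      by_cases hxi : x = i
      · subst hxi; simp
      · rw [Function.update_of_ne hxi, ← h.mem_eq b x hx]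
        exact Function.update_of_ne (by omega) _ _
    · rw [Arrays.set_of_ne A hb, ← h.mem_eq b x hx]
      refine Function.update_of_ne (fun he => hb (Arr.rank_injective ?_)) _ _
      -- Division by the stride recovers the rank, so cells of different arrays have different
      -- addresses.
      have e1 : (b.rank * (K + 1) + x) / (K + 1) = b.rank := by
        rw [mul_comm, Nat.mul_add_div (by omega), Nat.div_eq_of_lt (by omega), add_zero]
      have e2 : (a.rank * (K + 1) + i) / (K + 1) = a.rank := by
        rw [mul_comm, Nat.mul_add_div (by omega), Nat.div_eq_of_lt (by omega), add_zero]
      rw [← e1, ← e2, he]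

theorem HProg.exec_compile {w K k : ℕ} (hk : k ≤ K) (p : HProg) :
    ∀ {σ : State} {A : Arrays}, Rep w K σ A → σ.reg 4 = k →
      ∃ τ t, p.compile.Exec w σ τ t ∧ t ≤ p.cost ∧ Rep w K τ (p.run K k A) ∧ τ.reg = σ.reg := by
  induction p with
  | skip => intro σ A h _; exact ⟨σ, 1, .skip σ, le_rfl, h, rfl⟩
  | put a i e =>
    intro σ A h hc
    have hi := HExpr.eval_le h.one_le hk h.bounded i
    have he := HExpr.eval_le h.one_le hk h.bounded e
    refine ⟨_, _, .store σ _ _, le_rfl, ?_, rfl⟩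
    rw [h.eval_addr a (h.eval_compile hk hc i) hi, h.eval_compile hk hc e]
    exact h.store a hi he
  | seq p q hp hq =>
    intro σ A h hc
    obtain ⟨τ, t, h1, h2, h3, h4⟩ := hp h hc
    obtain ⟨τ', t', g1, g2, g3, g4⟩ := hq h3 (by rw [h4, hc])
    exact ⟨τ', t + t', .seq h1 g1, Nat.add_le_add h2 g2, g3, g4.trans h4⟩
  | ite b p q hp hq =>
    intro σ A h hc
    have hb := h.eval_compile hk hc b
    simp only [HProg.run, HProg.cost, HProg.compile]
    by_cases h0 : b.eval K k A ≠ 0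
    · rw [if_pos h0]
      obtain ⟨τ, t, h1, h2, h3, h4⟩ := hp h hc
      exact ⟨τ, _, .branch_true (by rwa [hb]) h1, by omega, h3, h4⟩
    · rw [if_neg h0]
      obtain ⟨τ, t, h1, h2, h3, h4⟩ := hq h hc
      exact ⟨τ, _, .branch_false (by rw [hb]; exact not_not.1 h0) h1, by omega, h3, h4⟩

/-- A loop `for ctr = 1, …, lim do body`. -/
structure Phase where
  lim : Arr
  body : HProg

/-- The effect of `m` iterations. -/
def HProg.iterate (K : ℕ) (body : HProg) (A : Arrays) : ℕ → Arrays
  | 0 => A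
  | m + 1 => body.run K (m + 1) (body.iterate K A m)

/-- The effect of a phase. -/
def Phase.run (K : ℕ) (ph : Phase) (A : Arrays) : Arrays := ph.body.iterate K A (A ph.lim 0)

/-- Translation of a phase; register `5` holds the limit. -/
def Phase.compile (ph : Phase) : Program :=
  .seq (.assign 5 (.bin .add (.load (ph.lim.addr (.lit 0))) (.lit 1)))
    (.seq (.assign 4 (.lit 1))
      (.loop (.bin .lt (.reg 4) (.reg 5))
        (.seq ph.body.compile (.assign 4 (.bin .add (.reg 4) (.lit 1))))))

theorem Rep.congr_reg {w K : ℕ} {σ : State} {A : Arrays} (h : Rep w K σ A) {r : ℕ → ℕ}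
    (hr : r 3 = σ.reg 3) : Rep w K { σ with reg := r } A :=
  ⟨h.one_le, h.room, hr.trans h.stride, h.bounded, h.mem_eq⟩

/-- Induction on the number `d` of iterations left. Besides the body, an iteration pays 4 for the
test and 4 for the increment; the failing test at the end costs another 4. -/
theorem Phase.exec_loop {w K m : ℕ} (hm : m ≤ K) (body : HProg) (A : Arrays) :
    ∀ (d k : ℕ) {σ : State}, k + d = m → Rep w K σ (body.iterate K A k) → σ.reg 4 = k + 1 →
      σ.reg 5 = m + 1 →
      ∃ τ t, (Program.loop (.bin .lt (.reg 4) (.reg 5))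
        (.seq body.compile (.assign 4 (.bin .add (.reg 4) (.lit 1))))).Exec w σ τ t ∧
        t ≤ (body.cost + 8) * d + 4 ∧ Rep w K τ (body.iterate K A m) := by
  intro d
  induction d with
  | zero =>
    intro k σ hd h h4 h5
    obtain rfl : k = m := by omega
    have hr := h.room
    refine ⟨σ, _, .loop_false ?_, by simp [Expr.cost], h⟩
    simp [Expr.eval, BinOp.eval, h4, h5]
  | succ d ih =>
    intro k σ hd h h4 h5
    have hr := h.room
    have h1 := h.one_le
    obtain ⟨τ, t, e1, e2, e3, e4⟩ := HProg.exec_compile (k := k + 1) (by omega) body h h4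
    have hctr : (Expr.bin .add (.reg 4) (.lit 1)).eval w τ = k + 2 := by
      simp only [Expr.eval, BinOp.eval, e4, h4]
      rw [Nat.mod_eq_of_lt (a := 1) (by omega), Nat.mod_eq_of_lt (by omega)]
    obtain ⟨τ', t', g1, g2, g3⟩ := ih (k + 1)
      (σ := { τ with reg := Function.update τ.reg 4 (k + 2) }) (by omega)
      (e3.congr_reg (by simp)) (by simp) (by simp [e4, h5])
    refine ⟨τ', _, .loop_true ?_ (.seq e1 (.assign τ 4 _)) (by rw [hctr]; exact g1), ?_, g3⟩
    · simp only [Expr.eval, BinOp.eval, h4, h5]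
      rw [if_pos (by omega), Nat.mod_eq_of_lt (by omega)]
      exact one_ne_zero
    · simp only [Expr.cost]
      have : (body.cost + 8) * (d + 1) = (body.cost + 8) * d + body.cost + 8 := by ring
      omega

/-- A bound on the running time of a phase, per cell of an array. -/
def Phase.cost (ph : Phase) : ℕ := ph.body.cost + 28

theorem Phase.exec_compile {w K : ℕ} (ph : Phase) {σ : State} {A : Arrays} (h : Rep w K σ A) :
    ∃ τ t, ph.compile.Exec w σ τ t ∧ t ≤ ph.cost * K ∧ Rep w K τ (ph.run K A) := by
  have hr := h.room
  have h1 := h.one_le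
  have hm := h.bounded ph.lim 0
  have hlim : (Expr.bin .add (.load (ph.lim.addr (.lit 0))) (.lit 1)).eval w σ
      = A ph.lim 0 + 1 := by
    have ha := h.eval_addr ph.lim (e := .lit 0) (x := 0) (by simp [Expr.eval]) (Nat.zero_le _)
    have hb := h.mem_eq ph.lim 0 (Nat.zero_le _)
    simp only [Expr.eval, BinOp.eval, ha, hb]
    rw [Nat.mod_eq_of_lt (a := 1) (by omega), Nat.mod_eq_of_lt (by omega)]
  have hone : ∀ σ' : State, (Expr.lit 1).eval w σ' = 1 := fun σ' =>
    Nat.mod_eq_of_lt (by omega)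
  obtain ⟨τ, t, g1, g2, g3⟩ := Phase.exec_loop (w := w) hm ph.body A (A ph.lim 0) 0
    (σ := { σ with reg := Function.update (Function.update σ.reg 5 (A ph.lim 0 + 1)) 4 1 })
    (by omega) (h.congr_reg (by simp)) (by simp) (by simp)
  refine ⟨τ, _, .seq (.assign σ 5 _) (.seq (.assign _ 4 _) (t := t) ?_), ?_, g3⟩
  · rw [hlim, hone]; exact g1
  -- Reading the limit, initializing the counter and the last test take 15 time units, which `20 *
  -- K` covers.
  · simp only [Expr.cost, Arr.addr, Phase.cost]
    have h2 : (ph.body.cost + 8) * A ph.lim 0 ≤ (ph.body.cost + 8) * K := Nat.mul_le_mul_left _ hm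
    have h3 : (ph.body.cost + 28) * K = (ph.body.cost + 8) * K + 20 * K := by ring
    omega

/-- The effect of a list of phases. -/
def runPhases (K : ℕ) : List Phase → Arrays → Arrays
  | [], A => A
  | ph :: l, A => runPhases K l (ph.run K A)

/-- Translation of a list of phases. -/
def compilePhases : List Phase → Program
  | [] => .skip
  | ph :: l => .seq ph.compile (compilePhases l)

/-- A bound on the running time of a list of phases, per cell of an array. -/
def phasesCost : List Phase → ℕ
  | [] => 1
  | ph :: l => ph.cost + phasesCost l

theorem exec_compilePhases {w K : ℕ} (l : List Phase) :
    ∀ {σ : State} {A : Arrays}, Rep w K σ A →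
      ∃ τ t, (compilePhases l).Exec w σ τ t ∧ t ≤ phasesCost l * K ∧
        Rep w K τ (runPhases K l A) := by
  induction l with
  | nil => intro σ A h; exact ⟨σ, 1, .skip σ, by simpa [phasesCost] using h.one_le, h⟩
  | cons ph l ih =>
    intro σ A h
    obtain ⟨τ, t, h1, h2, h3⟩ := ph.exec_compile h
    obtain ⟨τ', t', g1, g2, g3⟩ := ih h3
    exact ⟨τ', t + t', .seq h1 g1, by simp only [phasesCost]; rw [Nat.add_mul]; omega, g3⟩

/-- Induction over the iterations of a phase. Arrays that the body does not write are constant. -/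
theorem Phase.run_induction {K m : ℕ} (ph : Phase) {A : Arrays} (I : ℕ → Arrays → Prop)
    (hm : A ph.lim 0 = m) (h0 : I 0 A)
    (hs : ∀ k A', k < m → (∀ a, ph.body.writes a = false → A' a = A a) → I k A' →
      I (k + 1) (ph.body.run K (k + 1) A')) :
    I m (ph.run K A) ∧ ∀ a, ph.body.writes a = false → ph.run K A a = A a := by
  have key : ∀ k, k ≤ m → I k (ph.body.iterate K A k) ∧
      ∀ a, ph.body.writes a = false → ph.body.iterate K A k a = A a := by
    intro k
    induction k with
    | zero => intro _; exact ⟨h0, fun _ _ => rfl⟩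
    | succ k ih =>
      intro hk
      obtain ⟨i1, i2⟩ := ih (by omega)
      exact ⟨hs k _ (by omega) i2 i1,
        fun a ha => (HProg.run_of_not_writes _ _ ha).trans (i2 a ha)⟩
  rw [Phase.run, hm]
  exact key m le_rfl

end WordRAM

/-! ### Levels modulo the slab height -/

/-- The position of a level in the period of length `H`: `0` for level `0`, and otherwise the
number in `[1 .. H]` that is congruent to the level. -/
def levelRes (H d : ℕ) : ℕ := if d = 0 then 0 else (d - 1) % H + 1

theorem levelRes_succ {H d : ℕ} (hH : 2 ≤ H) :
    levelRes H (d + 1) = if levelRes H d = H then 1 else levelRes H d + 1 := by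
  unfold levelRes
  rcases Nat.eq_zero_or_pos d with rfl | hd
  · simp
  · obtain ⟨e, rfl⟩ : ∃ e, d = e + 1 := ⟨d - 1, by omega⟩
    have h := Nat.mod_lt e (show 0 < H by omega)
    simp only [Nat.add_sub_cancel, Nat.succ_ne_zero, if_false]
    rw [Nat.add_mod, Nat.mod_eq_of_lt (a := 1) (by omega)]
    split_ifs with h1
    · rw [h1, Nat.mod_self]
    · rw [Nat.mod_eq_of_lt (by omega)]

theorem levelRes_le_self {H d : ℕ} : levelRes H d ≤ d := by
  unfold levelRes
  split_ifs
  · omega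
  · have := Nat.mod_le (d - 1) H; omega

/-- This allows the program to use `min H n`, which fits into a cell: if `H` exceeds `n`, every
level up to `n` is its own residue for both periods. -/
theorem levelRes_min {H n d : ℕ} (hd : d ≤ n) : levelRes (min H n) d = levelRes H d := by
  unfold levelRes
  split_ifs with h
  · rfl
  · rcases le_total H n with h1 | h1
    · rw [min_eq_left h1]
    · rw [min_eq_right h1, Nat.mod_eq_of_lt (by omega), Nat.mod_eq_of_lt (by omega)]

theorem levelRes_eq_iff {H o d : ℕ} (h1 : 1 ≤ o) (h2 : o ≤ H) :
    levelRes H d = o ↔ o ≤ d ∧ H ∣ d - o := by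
  unfold levelRes
  constructor
  · intro h
    split_ifs at h with h0
    · omega
    · have h3 := Nat.mod_add_div (d - 1) H
      exact ⟨by omega, (d - 1) / H, by omega⟩
  · rintro ⟨h3, j, hj⟩
    rw [if_neg (by omega), show d - 1 = (o - 1) + H * j by omega, Nat.add_mul_mod_self_left,
      Nat.mod_eq_of_lt (by omega)]
    omega

/-- Levels with residue `o` are `H` apart, and a window of `H` levels that ends with one of them
contains no other. -/
theorem levelRes_eq_iff_of_window {H o d i : ℕ} (h1 : 1 ≤ o) (h2 : o ≤ H)
    (hd : i * H + o < d + H) (hd' : d ≤ i * H + o) : levelRes H d = o ↔ d = i * H + o := by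
  rw [levelRes_eq_iff h1 h2]
  constructor
  · rintro ⟨h3, j, hj⟩
    have hj' : d = j * H + o := by rw [mul_comm]; omega
    subst hj'
    rcases lt_trichotomy i j with h | h | h
    · have := Nat.mul_le_mul_right H (Nat.succ_le_of_lt h); rw [Nat.succ_mul] at this; omega
    · rw [h]
    · have := Nat.mul_le_mul_right H (Nat.succ_le_of_lt h); rw [Nat.succ_mul] at this; omega
  · rintro rfl
    exact ⟨by omega, i, by rw [mul_comm]; omega⟩

/-! ### Preorder trees, slabs and subtrees of slabs -/

namespace OrdinalTree

variable {n : ℕ} (T : OrdinalTree n)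

/-- Strong induction: the parent of `u + 1` is nonzero and is reached from `u` by parent steps,
which by the induction hypothesis never increase a number up to `u`. -/
theorem parent_bounds {v : ℕ} (h1 : 1 ≤ v) (hn : v ≤ n) :
    T.parent v < v ∧ (2 ≤ v → 1 ≤ T.parent v) := by
  induction v using Nat.strong_induction_on with
  | _ v ih =>
    rcases Nat.lt_or_ge v 2 with h | h
    · obtain rfl : v = 1 := by omega
      exact ⟨by rw [T.parent_one]; omega, fun h => absurd h (by omega)⟩
    · obtain ⟨u, rfl⟩ : ∃ u, v = u + 1 := ⟨v - 1, by omega⟩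
      obtain ⟨h3, k, hk⟩ := T.preorder u (by omega) (by omega)
      have key : ∀ k, T.parent^[k] u ≤ u := by
        intro k
        induction k with
        | zero => exact le_rfl
        | succ k ihk =>
          rw [Function.iterate_succ_apply']
          rcases Nat.eq_zero_or_pos (T.parent^[k] u) with h0 | h0
          · rw [h0, T.parent_zero]; omega
          · exact (ih _ (by omega) h0 (by omega)).1.le.trans ihk
      have := key k
      omega

theorem parent_lt {v : ℕ} (h1 : 1 ≤ v) (hn : v ≤ n) : T.parent v < v := (T.parent_bounds h1 hn).1

theorem one_le_parent {v : ℕ} (h1 : 2 ≤ v) (hn : v ≤ n) : 1 ≤ T.parent v :=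
  (T.parent_bounds (by omega) hn).2 h1

theorem depth_one : T.depth 1 = 0 := Nat.sInf_eq_zero.2 (Or.inl rfl)

theorem exists_iterate_eq_one {v : ℕ} (h1 : 1 ≤ v) (hn : v ≤ n) : ∃ k, T.parent^[k] v = 1 := by
  induction v using Nat.strong_induction_on with
  | _ v ih =>
    rcases Nat.lt_or_ge v 2 with h | h
    · exact ⟨0, by simp; omega⟩
    · have := T.parent_lt h1 hn
      obtain ⟨k, hk⟩ := ih _ this (T.one_le_parent h hn) (by omega)
      exact ⟨k + 1, hk⟩

theorem depth_eq {v : ℕ} (h1 : 2 ≤ v) (hn : v ≤ n) : T.depth v = T.depth (T.parent v) + 1 := by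
  have hp := T.parent_lt (by omega) hn
  have m1 : T.parent^[T.depth v] v = 1 := Nat.sInf_mem (T.exists_iterate_eq_one (by omega) hn)
  have m2 : T.parent^[T.depth (T.parent v)] (T.parent v) = 1 :=
    Nat.sInf_mem (T.exists_iterate_eq_one (T.one_le_parent h1 hn) (by omega))
  apply le_antisymm
  · exact Nat.sInf_le m2
  · obtain ⟨d, hd⟩ : ∃ d, T.depth v = d + 1 := by
      refine ⟨T.depth v - 1, ?_⟩
      have : T.depth v ≠ 0 := by
        intro h0; rw [h0] at m1; simp at m1; omega
      omega
    rw [hd] at m1 ⊢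
    exact Nat.succ_le_succ (Nat.sInf_le m1)

theorem depth_lt {v : ℕ} (h1 : 1 ≤ v) (hn : v ≤ n) : T.depth v < v := by
  induction v using Nat.strong_induction_on with
  | _ v ih =>
    rcases Nat.lt_or_ge v 2 with h | h
    · obtain rfl : v = 1 := by omega
      rw [T.depth_one]; omega
    · have := T.parent_lt h1 hn
      have h2 := ih _ this (T.one_le_parent h hn) (by omega)
      rw [T.depth_eq h hn]; omega

theorem mem_slab {H o i v : ℕ} : v ∈ T.slab H o i ↔
    (1 ≤ v ∧ v ≤ n) ∧ i * H + o ≤ T.depth v + H ∧ T.depth v ≤ i * H + o := by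
  simp [slab]

theorem zero_notMem_slab {H o i : ℕ} : 0 ∉ T.slab H o i := by simp [mem_slab]

theorem mem_slabNodes {H o i v : ℕ} : v ∈ T.slabNodes H o i ↔
    v ∈ T.slab H o i ∨ (v = 0 ∧ i ≠ 0 ∧ T.slab H o i ≠ ∅) := by
  unfold slabNodes
  split_ifs with h1 h2
  · simp [h1]
  · simp [h2]
  · simp [h1, h2, or_comm]

theorem card_slabNodes_le {H o i : ℕ} : (T.slabNodes H o i).card ≤ (T.slab H o i).card + 1 := by
  unfold slabNodes
  split_ifs with h1 h2
  · simp
  · omega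
  · exact Finset.card_insert_le _ _

theorem mem_sNodes_iff {H o v : ℕ} (h1 : 1 ≤ o) (h2 : o ≤ H) :
    v ∈ T.sNodes H o ↔ (1 ≤ v ∧ v ≤ n) ∧ levelRes H (T.depth v) = o := by
  simp [sNodes, levelRes_eq_iff h1 h2]

/-- Averaging: the `H` offsets have disjoint sets of s-nodes among the `n` nodes. -/
theorem mul_card_sNodes_le {H o : ℕ}
    (hmin : ∀ o', 1 ≤ o' → o' ≤ H → (T.sNodes H o).card ≤ (T.sNodes H o').card) :
    H * (T.sNodes H o).card ≤ n := by
  have hd : (Finset.Icc 1 H : Set ℕ).PairwiseDisjoint (fun o' => T.sNodes H o') := by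
    intro a ha b hb hab
    rw [Function.onFun, Finset.disjoint_left]
    intro v hva hvb
    simp only [Finset.coe_Icc, Set.mem_Icc] at ha hb
    exact hab (((T.mem_sNodes_iff ha.1 ha.2).1 hva).2.symm.trans
      ((T.mem_sNodes_iff hb.1 hb.2).1 hvb).2)
  have h1 := Finset.card_biUnion hd
  have h2 : ((Finset.Icc 1 H).biUnion fun o' => T.sNodes H o').card ≤ n := by
    calc _ ≤ (Finset.Icc 1 n).card := Finset.card_le_card (by
            intro v hv
            obtain ⟨o', -, h⟩ := Finset.mem_biUnion.1 hv
            exact (Finset.mem_filter.1 h).1)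
      _ = n := by simp
  have h3 : H * (T.sNodes H o).card ≤ ∑ o' ∈ Finset.Icc 1 H, (T.sNodes H o').card := by
    calc H * (T.sNodes H o).card = ∑ _o' ∈ Finset.Icc 1 H, (T.sNodes H o).card := by simp
      _ ≤ _ := Finset.sum_le_sum fun o' ho' => by
        rw [Finset.mem_Icc] at ho'; exact hmin o' ho'.1 ho'.2
  omega

variable {T}

theorem IsSlabChild.unique {H o i u u' v : ℕ} (h : T.IsSlabChild H o i u v)
    (h' : T.IsSlabChild H o i u' v) : u = u' := h.2.2.trans h'.2.2.symm

theorem IsSlabChild.lt {H o i u v : ℕ} (h : T.IsSlabChild H o i u v) : u < v := by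
  have hv := T.mem_slab.1 h.1
  rw [h.2.2]
  split_ifs
  · omega
  · exact T.parent_lt hv.1.1 hv.1.2

theorem IsSlabChild.eq_parent {H o i u v : ℕ} (h : T.IsSlabChild H o i u v) (hu : u ≠ 0) :
    u = T.parent v := by
  have h1 := h.2.2
  split_ifs at h1
  · exact absurd h1 hu
  · exact h1

theorem IsSlabChild.two_le {H o i u v : ℕ} (h : T.IsSlabChild H o i u v) (hu : u ≠ 0) : 2 ≤ v := by
  have hv := T.mem_slab.1 h.1
  by_contra hc
  obtain rfl : v = 1 := by omega
  exact hu (by rw [h.eq_parent hu, T.parent_one])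

theorem IsSlabChild.adj {H o i u v : ℕ} (h : T.IsSlabChild H o i u v) (hu : u ≠ 0) :
    T.graph.Adj u v := by
  have hv := T.mem_slab.1 h.1
  have h1 := h.lt
  rw [graph, SimpleGraph.fromRel_adj]
  refine ⟨h1.ne, Or.inl ⟨?_, ?_, (h.eq_parent hu).symm⟩⟩
  · rw [Finset.mem_Icc]; omega
  · rw [Finset.mem_Icc]; omega

/-- Adjacency to a smaller vertex of `s` allows a descent from every vertex to `r`. -/
theorem connected_induce_of_parent {s : Set ℕ} {r : ℕ} (hr : r ∈ s)
    (h : ∀ v ∈ s, v ≠ r → ∃ u ∈ s, u < v ∧ T.graph.Adj u v) : (T.graph.induce s).Connected := by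
  have key : ∀ v (hv : v ∈ s), (T.graph.induce s).Reachable ⟨r, hr⟩ ⟨v, hv⟩ := by
    intro v
    induction v using Nat.strong_induction_on with
    | _ v ih =>
      intro hv
      by_cases hvr : v = r
      · subst hvr; exact SimpleGraph.Reachable.refl _
      · obtain ⟨u, hu, huv, hadj⟩ := h v hv hvr
        refine (ih u huv hu).trans (SimpleGraph.Adj.reachable ?_)
        simpa using hadj
  have : Nonempty s := ⟨⟨r, hr⟩⟩
  exact SimpleGraph.Connected.mk fun a b => (key a.1 a.2).symm.trans (key b.1 b.2)

theorem IsSubtree.root_eq_zero {H o : ℕ} {μ : SlabSubtree} (h : T.IsSubtree H o μ)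
    (h0 : 0 ∈ μ.nodes) : μ.root = 0 := by
  by_contra hc
  obtain ⟨u, -, hu⟩ := h.2.2 0 h0 (Ne.symm hc)
  exact T.zero_notMem_slab hu.1

theorem IsSubtree.isPure {H o : ℕ} {μ : SlabSubtree} (h : T.IsSubtree H o μ)
    (h0 : 0 ∉ μ.nodes) : T.IsPure μ := by
  refine ⟨h0, connected_induce_of_parent (r := μ.root) h.2.1 fun v hv hvr => ?_⟩
  obtain ⟨u, hu, huv⟩ := h.2.2 v hv hvr
  exact ⟨u, hu, huv.lt, huv.adj (fun hc => h0 (hc ▸ hu))⟩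

theorem IsSubtree.isGlued {H o : ℕ} {μ : SlabSubtree} (h : T.IsSubtree H o μ)
    (h0 : 0 ∈ μ.nodes) : T.IsGlued H o μ := by
  have hr := h.root_eq_zero h0
  refine ⟨hr, ?_, ?_⟩
  · intro v
    induction v using Nat.strong_induction_on with
    | _ v ih =>
      intro hv hv0
      obtain ⟨u, hu, huv⟩ := h.2.2 v hv (by rwa [hr])
      by_cases hu0 : u = 0
      · subst hu0; exact ⟨v, hv, huv, 0, rfl⟩
      · obtain ⟨c, hc, hc1, k, hk⟩ := ih u huv.lt hu hu0
        exact ⟨c, hc, hc1, k + 1, by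
          rw [Function.iterate_succ_apply, ← huv.eq_parent hu0, hk]⟩
  · intro c hc hc1
    refine connected_induce_of_parent (r := c) ⟨hc, 0, rfl⟩ ?_
    rintro v ⟨hv, k, hk⟩ hvc
    have hc0 : 1 ≤ c := (T.mem_slab.1 hc1.1).1.1
    have hv0 : v ≠ 0 := by
      rintro rfl
      have : T.parent^[k] 0 = 0 := Function.iterate_fixed T.parent_zero k
      omega
    obtain ⟨k, rfl⟩ : ∃ j, k = j + 1 := by
      refine ⟨k - 1, ?_⟩
      have : k ≠ 0 := by rintro rfl; exact hvc hk
      omega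
    rw [Function.iterate_succ_apply] at hk
    obtain ⟨u, hu, huv⟩ := h.2.2 v hv (by rwa [hr])
    -- If the slab parent of `v` were `0`, then `v` would have no parent in `T` or lie on the first
    -- level of the slab, as `c` does. But `c` is an ancestor of the parent of `v`, hence strictly
    -- less deep than `v`.
    have hu0 : u ≠ 0 := by
      rintro rfl
      have e1 := hc1.2.2
      have e2 := huv.2.2
      have hvs := T.mem_slab.1 huv.1
      have hcs := T.mem_slab.1 hc1.1
      have hd : ∀ (j x : ℕ), 1 ≤ x → x ≤ n → T.parent^[j] x = c → T.depth c ≤ T.depth x := by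
        intro j
        induction j with
        | zero => intro x _ _ hx; rw [← hx]; exact le_rfl
        | succ j ihj =>
          intro x hx1 hxn hx
          rcases Nat.lt_or_ge x 2 with h2 | h2
          · obtain rfl : x = 1 := by omega
            rw [Function.iterate_succ_apply, T.parent_one,
              Function.iterate_fixed T.parent_zero] at hx
            omega
          · have := ihj (T.parent x) (T.one_le_parent h2 hxn)
              (by have := T.parent_lt hx1 hxn; omega) hx
            rw [T.depth_eq h2 hxn]; omega
      have e2' : T.depth v + H = μ.slab * H + o ∨ T.parent v = 0 := by
        by_contra hcon
        rw [not_or] at hcon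
        rw [if_neg hcon.1] at e2
        exact hcon.2 e2.symm
      rcases Nat.lt_or_ge v 2 with h2 | h2
      · obtain rfl : v = 1 := by omega
        rw [T.parent_one, Function.iterate_fixed T.parent_zero] at hk
        omega
      · have hp := T.one_le_parent h2 hvs.1.2
        have h3 := hd k (T.parent v) hp (by have := T.parent_lt hvs.1.1 hvs.1.2; omega) hk
        have h4 := T.depth_eq h2 hvs.1.2
        omega
    refine ⟨u, ⟨hu, k, ?_⟩, huv.lt, huv.adj hu0⟩
    rwa [huv.eq_parent hu0]

theorem IsSubtree.pure_or_glued {H o : ℕ} {μ : SlabSubtree} (h : T.IsSubtree H o μ) :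
    T.IsPure μ ∨ T.IsGlued H o μ := by
  by_cases h0 : 0 ∈ μ.nodes
  · exact Or.inr (h.isGlued h0)
  · exact Or.inl (h.isPure h0)

theorem IsSubtree.mem_slab {H o v : ℕ} {μ : SlabSubtree} (h : T.IsSubtree H o μ)
    (hv : v ∈ μ.nodes) (h0 : v ≠ 0) : v ∈ T.slab H o μ.slab := by
  rcases T.mem_slabNodes.1 (h.1 hv) with h1 | h1
  · exact h1
  · exact absurd h1.1 h0

theorem IsSubtree.height_le {H o : ℕ} {μ : SlabSubtree} (h : T.IsSubtree H o μ) :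
    ∀ u ∈ μ.nodes, ∀ v ∈ μ.nodes, u ≠ 0 → v ≠ 0 → T.depth v ≤ T.depth u + H := by
  intro u hu v hv hu0 hv0
  have h1 := T.mem_slab.1 (h.mem_slab hu hu0)
  have h2 := T.mem_slab.1 (h.mem_slab hv hv0)
  omega

/-- A slab spans `H + 1` levels and the next one begins `H` levels further down, so only consecutive
slabs meet, in a single level. -/
theorem slab_overlap {H o i j v : ℕ} (h1 : 1 ≤ o) (h2 : o ≤ H) (hi : v ∈ T.slab H o i)
    (hj : v ∈ T.slab H o j) (hij : i < j) :
    j = i + 1 ∧ v ∈ T.sNodes H o ∧ T.depth v = i * H + o := by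
  rw [T.mem_slab] at hi hj
  have e : j = i + 1 := by
    by_contra hc
    have := Nat.mul_le_mul_right H (show i + 2 ≤ j by omega)
    rw [Nat.add_mul] at this
    omega
  subst e
  have e2 : T.depth v = i * H + o := by rw [Nat.add_mul] at hj; omega
  refine ⟨rfl, ?_, e2⟩
  rw [T.mem_sNodes_iff h1 h2, levelRes_eq_iff h1 h2]
  exact ⟨hi.1, by omega, i, by rw [mul_comm]; omega⟩

/-- The delicate case is an edge whose lower end is not the root of `μ'`: then its upper end, as the
unique slab parent, also lies in `μ'`, and this shared node must be a common root. -/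
theorem connection_cases {H o : ℕ} (h1 : 1 ≤ o) (h2 : o ≤ H) {μ μ' : SlabSubtree}
    (h : T.IsSubtree H o μ) (h' : T.IsSubtree H o μ')
    (hdis : μ.slab = μ'.slab → ∀ v, v ∈ μ.nodes → v ∈ μ'.nodes → v = μ.root ∧ v = μ'.root)
    (hc : T.IsConnection H o μ μ') :
    SharesRoot μ μ' ∨ T.RootBelowRoot H o μ μ' ∨ T.RootBelowOther H o μ μ' ∨
      ((∃ v, T.ThroughPromoted H o μ μ' v) ∨ ∃ v, T.ThroughPromoted H o μ' μ v) := by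
  rcases hc with ⟨hs, v, hv, hv'⟩ | ⟨hs, u, hu, v, hv, huv⟩ | ⟨hs, v, h0, hv, hv'⟩
  · obtain ⟨e1, e2⟩ := hdis hs v hv hv'
    exact Or.inl ⟨hs, e1.symm.trans e2⟩
  · by_cases hvr : v = μ'.root
    · subst hvr
      by_cases hur : u = μ.root
      · subst hur
        exact Or.inr (Or.inl ⟨hs, huv⟩)
      · exact Or.inr (Or.inr (Or.inl ⟨hs, u, hu, hur, huv⟩))
    · obtain ⟨u', hu', hu'v⟩ := h'.2.2 v hv hvr
      rw [← hs] at hu'v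
      obtain rfl := huv.unique hu'v
      obtain ⟨e1, e2⟩ := hdis hs u hu hu'
      exact Or.inl ⟨hs, e1.symm.trans e2⟩
  · have m := h.mem_slab hv h0
    have m' := h'.mem_slab hv' h0
    refine Or.inr (Or.inr (Or.inr ?_))
    rcases Nat.lt_or_gt_of_ne hs with hlt | hlt
    · obtain ⟨e1, e2, e3⟩ := slab_overlap h1 h2 m m' hlt
      exact Or.inl ⟨v, e1, e2, e3, hv, hv'⟩
    · obtain ⟨e1, e2, e3⟩ := slab_overlap h1 h2 m' m hlt
      exact Or.inr ⟨v, e1, e2, e3, hv', hv⟩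

end OrdinalTree

/-! ### Computing the best offset -/

namespace WordRAM

open HExpr HProg

set_option linter.unusedSimpArgs false

/-- Computes `levelRes` of the depth of each node and counts the nodes with each value. -/
def levelPhase : Phase where
  lim := .nn
  body :=
    .seq
      (.ite (.eq (get .par ctr) zero) (put .res ctr zero)
        (.ite (.eq (get .res (get .par ctr)) (var .hh)) (put .res ctr one)
          (put .res ctr (add (get .res (get .par ctr)) one))))
      (put .cnt (get .res ctr) (add (get .cnt (get .res ctr)) one))

/-- Preorder puts parents before children, so the residue of the parent is known. The condition on
`H` is restricted to `2 ≤ n` because the capped height is `1` when `n = 1`; then only the root is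
treated. -/
theorem levelPhase_spec {n K H : ℕ} (T : OrdinalTree n) {A : Arrays} (hK : n ≤ K)
    (hnn : A .nn 0 = n) (hhh : A .hh 0 = H) (hH : 2 ≤ n → 2 ≤ H)
    (hpar : ∀ v, 1 ≤ v → v ≤ n → A .par v = T.parent v) (hcnt : ∀ r, A .cnt r = 0) :
    (∀ v, 1 ≤ v → v ≤ n → levelPhase.run K A .res v = levelRes H (T.depth v)) ∧
      ∀ r, levelPhase.run K A .cnt r =
        ((Finset.Icc 1 n).filter fun v => levelRes H (T.depth v) = r).card := by
  refine (levelPhase.run_induction (fun k A' =>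
    (∀ v, 1 ≤ v → v ≤ k → A' .res v = levelRes H (T.depth v)) ∧
      ∀ r, A' .cnt r = ((Finset.Icc 1 k).filter fun v => levelRes H (T.depth v) = r).card)
    hnn ⟨fun v h1 h2 => by omega, fun r => by simp [hcnt]⟩ ?_).1
  rintro k A' hk hfr ⟨h1, h2⟩
  have f1 : A' .par (k + 1) = T.parent (k + 1) := by rw [hfr .par rfl, hpar _ (by omega) (by omega)]
  have f2 : A' .hh 0 = H := by rw [hfr .hh rfl, hhh]
  have hres : ∀ v, 1 ≤ v → v ≤ k + 1 →
      levelPhase.body.run K (k + 1) A' .res v = levelRes H (T.depth v) := by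
    intro v hv1 hv2
    rcases Nat.lt_or_ge v (k + 1) with hv | hv
    · rw [← h1 v hv1 (by omega)]
      simp only [levelPhase, run_seq, run_ite_eq, run_put, eval_zero, eval_one, eval_ctr, eval_get, eval_add, eval_sub]
      split_ifs <;> simp [Arrays.set, show v ≠ k + 1 by omega]
    · obtain rfl : v = k + 1 := by omega
      rcases Nat.eq_zero_or_pos k with rfl | hk0
      · have hp : A' .par 1 = 0 := by rw [f1, T.parent_one]
        simp [levelPhase, run_seq, run_ite_eq, run_put, eval_zero, eval_one, eval_ctr, eval_get, eval_add, eval_sub, hp, Arrays.set, T.depth_one, levelRes]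
      · have g1 := T.parent_lt (v := k + 1) (by omega) (by omega)
        have g2 := T.one_le_parent (v := k + 1) (by omega) (by omega)
        have g3 := h1 _ g2 (by omega)
        have g4 := T.depth_lt g2 (by omega)
        have g5 := levelRes_le_self (H := H) (d := T.depth (T.parent (k + 1)))
        rw [T.depth_eq (by omega) (by omega), levelRes_succ (hH (by omega))]
        simp only [levelPhase, run_seq, run_ite_eq, run_put, eval_zero, eval_one, eval_ctr, eval_get, eval_add, eval_sub, f1, f2, g3]
        rw [capAdd_eq (by omega), if_neg (by omega)]
        by_cases hc : levelRes H (T.depth (T.parent (k + 1))) = H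
        · simp [Arrays.set, hc]
        · simp [Arrays.set, hc]
  refine ⟨hres, fun r => ?_⟩
  have hcb : ∀ r, A' .cnt r ≤ k := by
    intro r
    rw [h2 r]
    exact (Finset.card_filter_le _ _).trans (by simp)
  have hcur := hres (k + 1) (by omega) le_rfl
  have hset : ∀ A'' : Arrays, A'' .cnt = A' .cnt → A'' .res (k + 1) = levelRes H (T.depth (k + 1)) →
      (put .cnt (get .res ctr) (add (get .cnt (get .res ctr)) one)).run K (k + 1) A'' .cnt r =
        ((Finset.Icc 1 (k + 1)).filter fun v => levelRes H (T.depth v) = r).card := by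
    intro A'' e1 e2
    simp only [run_put, eval_zero, eval_one, eval_ctr, eval_get, eval_add, eval_sub, e1, e2, Arrays.set_same]
    have := hcb (levelRes H (T.depth (k + 1)))
    rw [capAdd_eq (by omega), ← Finset.insert_Icc_right_eq_Icc_add_one (by omega : 1 ≤ k + 1),
      Finset.filter_insert]
    split_ifs with hr
    · subst hr
      rw [Function.update_self, h2, Finset.card_insert_of_notMem (by simp)]
    · rw [Function.update_of_ne (Ne.symm hr), h2]
  have hw := hset (HProg.run K (k + 1)
    (.ite (.eq (get .par ctr) zero) (put .res ctr zero)
        (.ite (.eq (get .res (get .par ctr)) (var .hh)) (put .res ctr one)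
          (put .res ctr (add (get .res (get .par ctr)) one)))) A')
    (HProg.run_of_not_writes _ _ rfl) (by
      rw [← hcur]
      exact (HProg.run_of_not_writes (b := .res) (put .cnt (get .res ctr) (add (get .cnt (get .res ctr)) one)) _ rfl).symm ▸ rfl)
  exact hw

/-- Finds an index with the smallest count. -/
def offsetPhase : Phase where
  lim := .hh
  body :=
    .ite (.eq (var .off) zero) (put .off zero ctr)
      (.ite (.lt (get .cnt ctr) (get .cnt (var .off))) (put .off zero ctr) skip)

/-- The value `0` of `off` means that no offset has been chosen yet, so the count of residue `0`,
the level of the root, never competes. -/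
theorem offsetPhase_spec {K H : ℕ} {A : Arrays} (hhh : A .hh 0 = H) (hH : 1 ≤ H)
    (hoff : A .off 0 = 0) :
    (1 ≤ offsetPhase.run K A .off 0 ∧ offsetPhase.run K A .off 0 ≤ H) ∧
      ∀ r, 1 ≤ r → r ≤ H → A .cnt (offsetPhase.run K A .off 0) ≤ A .cnt r := by
  have h := (offsetPhase.run_induction (K := K) (fun k A' =>
    (k = 0 → A' .off 0 = 0) ∧ (1 ≤ k → (1 ≤ A' .off 0 ∧ A' .off 0 ≤ k) ∧
      ∀ r, 1 ≤ r → r ≤ k → A .cnt (A' .off 0) ≤ A .cnt r)) hhh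
    ⟨fun _ => hoff, fun h => by omega⟩ ?_).1
  · exact h.2 hH
  rintro k A' hk hfr ⟨h1, h2⟩
  have f1 : A' .cnt = A .cnt := hfr .cnt rfl
  refine ⟨fun h => by omega, fun _ => ?_⟩
  simp only [offsetPhase, run_ite_eq, run_ite_lt, run_put, run_skip, eval_zero, eval_one, eval_ctr, eval_get, eval_add, eval_sub, f1]
  rcases Nat.eq_zero_or_pos k with rfl | hk0
  · simp only [h1 rfl, Arrays.set]
    simp
    intro r h1 h2
    obtain rfl : r = 1 := by omega
    rfl
  · obtain ⟨⟨g1, g2⟩, g3⟩ := h2 hk0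
    rw [if_neg (by omega)]
    by_cases hc : A .cnt (k + 1) < A .cnt (A' .off 0)
    · rw [if_pos hc]
      simp only [Arrays.set_same, Function.update_self]
      refine ⟨by omega, fun r hr1 hr2 => ?_⟩
      rcases Nat.lt_or_ge r (k + 1) with h | h
      · exact hc.le.trans (g3 r hr1 (by omega))
      · obtain rfl : r = k + 1 := by omega
        exact le_rfl
    · rw [if_neg hc]
      refine ⟨by omega, fun r hr1 hr2 => ?_⟩
      rcases Nat.lt_or_ge r (k + 1) with h | h
      · exact g3 r hr1 (by omega)
      · obtain rfl : r = k + 1 := by omega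
        exact not_lt.1 hc

end WordRAM

/-! ### The layout of the slab trees -/

/-- The slab trees, laid out in one array `1, …, N` with parents before children and with the nodes
of each slab in increasing order: `fp` are the parents (`0` for a root), `lab` the nodes of `T`
(`0` for a dummy root) and `fs` the slabs. -/
structure SlabForest {n : ℕ} (T : OrdinalTree n) (H o N : ℕ) (fp lab fs : ℕ → ℕ) : Prop where
  card_le : N ≤ 3 * n
  parent_lt : ∀ k, 1 ≤ k → k ≤ N → fp k < k
  parent_slab : ∀ k, 1 ≤ k → k ≤ N → fp k ≠ 0 → fs (fp k) = fs k
  label_mem : ∀ k, 1 ≤ k → k ≤ N → lab k ∈ T.slabNodes H o (fs k)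
  exists_index : ∀ i, ∀ x ∈ T.slabNodes H o i, ∃ k, 1 ≤ k ∧ k ≤ N ∧ fs k = i ∧ lab k = x
  label_lt : ∀ k k', 1 ≤ k → k < k' → k' ≤ N → fs k = fs k' → lab k < lab k'
  child : ∀ k, 1 ≤ k → k ≤ N → fp k ≠ 0 → T.IsSlabChild H o (fs k) (lab (fp k)) (lab k)
  root : ∀ k, 1 ≤ k → k ≤ N → fp k = 0 → lab k = 0 ∨ (fs k = 0 ∧ lab k = 1)
  dummy : ∀ k, 1 ≤ k → k ≤ N → lab k = 0 → fp k = 0 ∧ fs k ≠ 0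

/-- The part of the slab trees laid out so far, where the labels are at most `v`, and `dum` are the
indices of the dummy roots. -/
structure PartialForest {n : ℕ} (T : OrdinalTree n) (H o v N : ℕ) (fp lab fs dum : ℕ → ℕ) :
    Prop where
  lab_zero : lab 0 = 0
  parent_lt : ∀ k, 1 ≤ k → k ≤ N → fp k < k
  parent_slab : ∀ k, 1 ≤ k → k ≤ N → fp k ≠ 0 → fs (fp k) = fs k
  label_le : ∀ k, 1 ≤ k → k ≤ N → lab k ≤ v
  of_zero : ∀ k, 1 ≤ k → k ≤ N → lab k = 0 → fp k = 0 ∧ fs k ≠ 0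
  mem_slab : ∀ k, 1 ≤ k → k ≤ N → lab k ≠ 0 → lab k ∈ T.slab H o (fs k)
  label_lt : ∀ k k', 1 ≤ k → k < k' → k' ≤ N → fs k = fs k' → lab k < lab k'
  parent_label : ∀ k, 1 ≤ k → k ≤ N → lab k ≠ 0 →
    lab (fp k) = if T.depth (lab k) + H = fs k * H + o then 0 else T.parent (lab k)
  root_iff : ∀ k, 1 ≤ k → k ≤ N → lab k ≠ 0 → (fp k = 0 ↔ lab k = 1)
  dummy : ∀ i, dum i ≠ 0 → dum i ≤ N ∧ lab (dum i) = 0 ∧ fs (dum i) = i ∧ i ≠ 0 ∧ T.slab H o i ≠ ∅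
  slab_dummy : ∀ k, 1 ≤ k → k ≤ N → fs k ≠ 0 → dum (fs k) ≠ 0

namespace PartialForest

variable {n : ℕ} {T : OrdinalTree n} {H o v N : ℕ} {fp lab fs dum : ℕ → ℕ}

theorem mono (h : PartialForest T H o v N fp lab fs dum) {v' : ℕ} (hv : v ≤ v') :
    PartialForest T H o v' N fp lab fs dum :=
  { h with label_le := fun k h1 h2 => (h.label_le k h1 h2).trans hv }

theorem emit_node (h : PartialForest T H o v N fp lab fs dum) {f x s : ℕ} (hx0 : x ≠ 0)
    (hxv : x ≤ v) (hx : x ∈ T.slab H o s) (hlt : ∀ k, 1 ≤ k → k ≤ N → fs k = s → lab k < x)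
    (hf : f ≤ N) (hfs : f ≠ 0 → fs f = s)
    (hlab : lab f = if T.depth x + H = s * H + o then 0 else T.parent x)
    (hroot : f = 0 ↔ x = 1) (hdum : s ≠ 0 → dum s ≠ 0) :
    PartialForest T H o v (N + 1) (Function.update fp (N + 1) f) (Function.update lab (N + 1) x)
      (Function.update fs (N + 1) s) dum := by
  obtain ⟨a1, a2, a3, a4, a5, a6, a7, a8, a9, a10, a11⟩ := h
  have hN : ∀ {g : ℕ → ℕ} {c k : ℕ}, k ≤ N → Function.update g (N + 1) c k = g k := fun hk =>
    Function.update_of_ne (by omega) _ _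
  have hcase : ∀ k, k ≤ N + 1 → k ≤ N ∨ k = N + 1 := fun k hk => by omega
  refine ⟨by rw [hN (Nat.zero_le _)]; exact a1, ?_, ?_, ?_, ?_, ?_, ?_, ?_, ?_, ?_, ?_⟩
  · intro k h1 h2
    rcases hcase k h2 with hk | rfl
    · rw [hN hk]; exact a2 k h1 hk
    · simp; omega
  · intro k h1 h2
    rcases hcase k h2 with hk | rfl
    · rw [hN hk, hN hk, hN (by have := a2 k h1 hk; omega)]; exact a3 k h1 hk
    · simp only [Function.update_self]; rw [hN hf]; exact hfs
  · intro k h1 h2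
    rcases hcase k h2 with hk | rfl
    · rw [hN hk]; exact a4 k h1 hk
    · simpa using hxv
  · intro k h1 h2
    rcases hcase k h2 with hk | rfl
    · rw [hN hk, hN hk, hN hk]; exact a5 k h1 hk
    · simp [hx0]
  · intro k h1 h2
    rcases hcase k h2 with hk | rfl
    · rw [hN hk, hN hk]; exact a6 k h1 hk
    · simpa using fun _ => hx
  · intro k k' h1 h2 h3
    rw [hN (k := k) (by omega), hN (k := k) (by omega)]
    rcases hcase k' h3 with hk | rfl
    · rw [hN hk, hN hk]; exact a7 k k' h1 h2 hk
    · simpa using hlt k h1 (by omega)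
  · intro k h1 h2
    rcases hcase k h2 with hk | rfl
    · rw [hN hk, hN hk, hN hk, hN (by have := a2 k h1 hk; omega)]; exact a8 k h1 hk
    · simp only [Function.update_self]; rw [hN hf]; exact fun _ => hlab
  · intro k h1 h2
    rcases hcase k h2 with hk | rfl
    · rw [hN hk, hN hk]; exact a9 k h1 hk
    · simpa using fun _ => hroot
  · intro i hi
    obtain ⟨b1, b2, b3, b4⟩ := a10 i hi
    rw [hN b1, hN b1]
    exact ⟨by omega, b2, b3, b4⟩
  · intro k h1 h2
    rcases hcase k h2 with hk | rfl
    · rw [hN hk]; exact a11 k h1 hk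
    · simpa using hdum

/-- Since `dum s = 0`, no index of slab `s` exists yet (`slab_dummy`); so the label `0` comes first
in its slab, as the order of the labels demands. -/
theorem emit_dummy (h : PartialForest T H o v N fp lab fs dum) {s : ℕ} (hs : s ≠ 0)
    (hne : T.slab H o s ≠ ∅) (hd : dum s = 0) :
    PartialForest T H o v (N + 1) (Function.update fp (N + 1) 0) (Function.update lab (N + 1) 0)
      (Function.update fs (N + 1) s) (Function.update dum s (N + 1)) := by
  obtain ⟨a1, a2, a3, a4, a5, a6, a7, a8, a9, a10, a11⟩ := h
  have hN : ∀ {g : ℕ → ℕ} {c k : ℕ}, k ≤ N → Function.update g (N + 1) c k = g k := fun hk =>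
    Function.update_of_ne (by omega) _ _
  have hcase : ∀ k, k ≤ N + 1 → k ≤ N ∨ k = N + 1 := fun k hk => by omega
  refine ⟨by rw [hN (Nat.zero_le _)]; exact a1, ?_, ?_, ?_, ?_, ?_, ?_, ?_, ?_, ?_, ?_⟩
  · intro k h1 h2
    rcases hcase k h2 with hk | rfl
    · rw [hN hk]; exact a2 k h1 hk
    · simp
  · intro k h1 h2
    rcases hcase k h2 with hk | rfl
    · rw [hN hk, hN hk, hN (by have := a2 k h1 hk; omega)]; exact a3 k h1 hk
    · simp
  · intro k h1 h2
    rcases hcase k h2 with hk | rfl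
    · rw [hN hk]; exact a4 k h1 hk
    · simp
  · intro k h1 h2
    rcases hcase k h2 with hk | rfl
    · rw [hN hk, hN hk, hN hk]; exact a5 k h1 hk
    · simpa using hs
  · intro k h1 h2
    rcases hcase k h2 with hk | rfl
    · rw [hN hk, hN hk]; exact a6 k h1 hk
    · simp
  · intro k k' h1 h2 h3
    rw [hN (k := k) (by omega), hN (k := k) (by omega)]
    rcases hcase k' h3 with hk | rfl
    · rw [hN hk, hN hk]; exact a7 k k' h1 h2 hk
    · simp only [Function.update_self]
      intro he
      exact absurd hd (he ▸ a11 k h1 (by omega) (he ▸ hs))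
  · intro k h1 h2
    rcases hcase k h2 with hk | rfl
    · rw [hN hk, hN hk, hN hk, hN (by have := a2 k h1 hk; omega)]; exact a8 k h1 hk
    · simp
  · intro k h1 h2
    rcases hcase k h2 with hk | rfl
    · rw [hN hk, hN hk]; exact a9 k h1 hk
    · simp
  · intro i hi
    by_cases his : i = s
    · subst his; simpa using ⟨hs, hne⟩
    · rw [Function.update_of_ne his] at hi ⊢
      obtain ⟨b1, b2, b3, b4⟩ := a10 i hi
      rw [hN b1, hN b1]
      exact ⟨by omega, b2, b3, b4⟩
  · intro k h1 h2
    rcases hcase k h2 with hk | rfl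
    · rw [hN hk]
      intro h0
      by_cases his : fs k = s
      · rw [his]; simp
      · rw [Function.update_of_ne his]; exact a11 k h1 hk h0
    · simp

end PartialForest

/-- The main copies of the nodes `1, …, v`: `idx` are their slabs and `pos` their indices. -/
structure MainCopies {n : ℕ} (T : OrdinalTree n) (H o v N : ℕ) (lab fs idx pos : ℕ → ℕ) :
    Prop where
  idx_zero : idx 0 = 0
  pos_zero : pos 0 = 0
  pos_mem : ∀ x, 1 ≤ x → x ≤ v → 1 ≤ pos x ∧ pos x ≤ N
  lab_pos : ∀ x, 1 ≤ x → x ≤ v → lab (pos x) = x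
  fs_pos : ∀ x, 1 ≤ x → x ≤ v → fs (pos x) = idx x
  window : ∀ x, 1 ≤ x → x ≤ v →
    idx x * H + o ≤ T.depth x + H ∧ T.depth x < idx x * H + o ∧ idx x ≤ T.depth x
  promoted : ∀ x, 1 ≤ x → x ≤ v → ∀ i, T.depth x = i * H + o →
    ∃ k, 1 ≤ k ∧ k ≤ N ∧ fs k = i ∧ lab k = x

namespace MainCopies

variable {n : ℕ} {T : OrdinalTree n} {H o v N : ℕ} {fp lab fs dum idx pos : ℕ → ℕ}

/-- The main copy of `x` lies in the slab in which `x` is not on the last level. The only other slab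
that can contain `x` is the preceding one, with `x` on its last level, and there is the promoted
copy. -/
theorem exists_copy (h : MainCopies T H o v N lab fs idx pos) {x i : ℕ} (h1 : 1 ≤ x) (h2 : x ≤ v)
    (hx : x ∈ T.slab H o i) : ∃ k, 1 ≤ k ∧ k ≤ N ∧ fs k = i ∧ lab k = x := by
  rw [T.mem_slab] at hx
  obtain ⟨w1, w2, -⟩ := h.window x h1 h2
  rcases lt_trichotomy (idx x) i with hi | hi | hi
  · have := Nat.mul_le_mul_right H (Nat.succ_le_of_lt hi); rw [Nat.succ_mul] at this; omega
  · exact ⟨pos x, (h.pos_mem x h1 h2).1, (h.pos_mem x h1 h2).2, (h.fs_pos x h1 h2).trans hi,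
      h.lab_pos x h1 h2⟩
  · have := Nat.mul_le_mul_right H (Nat.succ_le_of_lt hi); rw [Nat.succ_mul] at this
    exact h.promoted x h1 h2 i (by omega)

theorem slabForest (h : MainCopies T H o n N lab fs idx pos)
    (hF : PartialForest T H o n N fp lab fs dum) (ho : 1 ≤ o) (hN : N ≤ 3 * n) :
    SlabForest T H o N fp lab fs := by
  have hmem : ∀ k, 1 ≤ k → k ≤ N → lab k ∈ T.slabNodes H o (fs k) := by
    intro k h1 h2
    rw [T.mem_slabNodes]
    by_cases h0 : lab k = 0
    · right
      have hs := (hF.of_zero k h1 h2 h0).2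
      exact ⟨h0, hs, (hF.dummy _ (hF.slab_dummy k h1 h2 hs)).2.2.2.2⟩
    · exact Or.inl (hF.mem_slab k h1 h2 h0)
  refine ⟨hN, hF.parent_lt, hF.parent_slab, hmem, ?_, hF.label_lt, ?_, ?_, hF.of_zero⟩
  · intro i x hx
    rcases T.mem_slabNodes.1 hx with hx | ⟨rfl, hi, hne⟩
    · have := T.mem_slab.1 hx
      exact h.exists_copy this.1.1 this.1.2 hx
    -- Any node of the slab has a copy in it, and `slab_dummy` leads from this copy to the dummy
    -- root.
    · obtain ⟨y, hy⟩ := Finset.nonempty_iff_ne_empty.2 hne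
      have := T.mem_slab.1 hy
      obtain ⟨k, k1, k2, rfl, -⟩ := h.exists_copy this.1.1 this.1.2 hy
      have hd := hF.slab_dummy k k1 k2 hi
      obtain ⟨d1, d2, d3, -, -⟩ := hF.dummy _ hd
      exact ⟨_, Nat.one_le_iff_ne_zero.2 hd, d1, d3, d2⟩
  · intro k h1 h2 h0
    have hl : lab k ≠ 0 := fun hc => h0 (hF.of_zero k h1 h2 hc).1
    have hlt := hF.parent_lt k h1 h2
    refine ⟨hF.mem_slab k h1 h2 hl, ?_, hF.parent_label k h1 h2 hl⟩
    have := hmem (fp k) (by omega) (by omega)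
    rwa [hF.parent_slab k h1 h2 h0] at this
  · intro k h1 h2 h0
    by_cases hl : lab k = 0
    · exact Or.inl hl
    · have e := (hF.root_iff k h1 h2 hl).1 h0
      have hm := T.mem_slab.1 (hF.mem_slab k h1 h2 hl)
      rw [e, T.depth_one] at hm
      refine Or.inr ⟨?_, e⟩
      by_contra hc
      have := Nat.mul_le_mul_right H (Nat.one_le_iff_ne_zero.2 hc)
      omega

/-- The facts about the parent of the next node. -/
structure ParentFacts (T : OrdinalTree n) (H o k N : ℕ) (lab fs idx pos : ℕ → ℕ) : Prop where
  low : idx (T.parent (k + 1)) * H + o ≤ T.depth (k + 1) + H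
  low_lt : k ≠ 0 → idx (T.parent (k + 1)) * H + o < T.depth (k + 1) + H
  high : T.depth (k + 1) ≤ idx (T.parent (k + 1)) * H + o
  idx_le : idx (T.parent (k + 1)) ≤ T.depth (k + 1)
  idx_lt : k ≠ 0 → idx (T.parent (k + 1)) < T.depth (k + 1)
  pos_le : pos (T.parent (k + 1)) ≤ N
  fs_pos : pos (T.parent (k + 1)) ≠ 0 → fs (pos (T.parent (k + 1))) = idx (T.parent (k + 1))
  lab_pos : lab (pos (T.parent (k + 1))) = T.parent (k + 1)
  pos_eq_zero : pos (T.parent (k + 1)) = 0 ↔ k + 1 = 1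
  idx_ne_zero : idx (T.parent (k + 1)) ≠ 0 → pos (T.parent (k + 1)) ≠ 0

/-- For `k = 0` the next node is the root of `T`. Its parent is `0`, and the zero cells `idx 0` and
`pos 0` act as a virtual parent in slab `0`; the strict inequalities need a genuine parent. -/
theorem parentFacts {k : ℕ} (h : MainCopies T H o k N lab fs idx pos) (hl : lab 0 = 0)
    (hoH : o ≤ H) (hk : k < n) : ParentFacts T H o k N lab fs idx pos := by
  rcases Nat.eq_zero_or_pos k with rfl | hk0
  · have hp : T.parent (0 + 1) = 0 := T.parent_one
    have hd : T.depth (0 + 1) = 0 := T.depth_one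
    refine ⟨?_, by omega, ?_, ?_, by omega, ?_, ?_, ?_, ?_, ?_⟩ <;>
      rw [hp] <;> simp [h.idx_zero, h.pos_zero, hl, hd, hoH]
  · have h1 := T.parent_lt (v := k + 1) (by omega) (by omega)
    have h2 := T.one_le_parent (v := k + 1) (by omega) (by omega)
    have h3 := T.depth_eq (v := k + 1) (by omega) (by omega)
    obtain ⟨w1, w2, w3⟩ := h.window _ h2 (by omega)
    obtain ⟨p1, p2⟩ := h.pos_mem _ h2 (by omega)
    exact ⟨by omega, by omega, by omega, by omega, by omega, p2, fun _ => h.fs_pos _ h2 (by omega),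
      h.lab_pos _ h2 (by omega), by omega, by omega⟩

theorem step {k N' I P : ℕ} {lab' fs' : ℕ → ℕ} (h : MainCopies T H o k N lab fs idx pos)
    (hN : N ≤ N') (hlab : ∀ j, j ≤ N → lab' j = lab j) (hfs : ∀ j, j ≤ N → fs' j = fs j)
    (hP : 1 ≤ P) (hPN : P ≤ N') (hPl : lab' P = k + 1) (hPf : fs' P = I)
    (hw : I * H + o ≤ T.depth (k + 1) + H ∧ T.depth (k + 1) < I * H + o ∧ I ≤ T.depth (k + 1))
    (hp : ∀ i, T.depth (k + 1) = i * H + o → ∃ j, 1 ≤ j ∧ j ≤ N' ∧ fs' j = i ∧ lab' j = k + 1) :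
    MainCopies T H o (k + 1) N' lab' fs' (Function.update idx (k + 1) I)
      (Function.update pos (k + 1) P) := by
  have hcase : ∀ x, x ≤ k + 1 → x ≤ k ∨ x = k + 1 := fun x hx => by omega
  have hu : ∀ {g : ℕ → ℕ} {c x : ℕ}, x ≤ k → Function.update g (k + 1) c x = g x := fun hk =>
    Function.update_of_ne (by omega) _ _
  refine ⟨by rw [hu (Nat.zero_le _)]; exact h.idx_zero, by rw [hu (Nat.zero_le _)]; exact h.pos_zero,
    ?_, ?_, ?_, ?_, ?_⟩
  · intro x h1 h2
    rcases hcase x h2 with hx | rfl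
    · rw [hu hx]; have := h.pos_mem x h1 hx; omega
    · simpa using ⟨hP, hPN⟩
  · intro x h1 h2
    rcases hcase x h2 with hx | rfl
    · rw [hu hx, hlab _ (h.pos_mem x h1 hx).2]; exact h.lab_pos x h1 hx
    · simpa using hPl
  · intro x h1 h2
    rcases hcase x h2 with hx | rfl
    · rw [hu hx, hu hx, hfs _ (h.pos_mem x h1 hx).2]; exact h.fs_pos x h1 hx
    · simpa using hPf
  · intro x h1 h2
    rcases hcase x h2 with hx | rfl
    · rw [hu hx]; exact h.window x h1 hx
    · simpa using hw
  · intro x h1 h2 i hi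
    rcases hcase x h2 with hx | rfl
    · obtain ⟨j, j1, j2, j3, j4⟩ := h.promoted x h1 hx i hi
      exact ⟨j, j1, by omega, by rw [hfs j j2, j3], by rw [hlab j j2, j4]⟩
    · exact hp i hi

variable {k : ℕ}

/-- This is the copy in the slab of the parent's main copy: the only copy of an ordinary node, and
the promoted copy of an s-node. -/
theorem ParentFacts.emit (hf : ParentFacts T H o k N lab fs idx pos)
    (hF : PartialForest T H o k N fp lab fs dum) (hk : k < n) :
    PartialForest T H o (k + 1) (N + 1) (Function.update fp (N + 1) (pos (T.parent (k + 1))))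
      (Function.update lab (N + 1) (k + 1)) (Function.update fs (N + 1) (idx (T.parent (k + 1))))
      dum := by
  refine (hF.mono (Nat.le_succ k)).emit_node (by omega) le_rfl ?_ ?_ hf.pos_le hf.fs_pos ?_
    hf.pos_eq_zero ?_
  · rw [T.mem_slab]
    have := hf.low; have := hf.high
    omega
  · intro j h1 h2 _
    have := hF.label_le j h1 h2
    omega
  · rw [hf.lab_pos]
    split_ifs with h
    · by_cases hk0 : k = 0
      · subst hk0; exact T.parent_one
      · have := hf.low_lt hk0; omega
    · rfl
  · intro hs
    have h0 := hf.idx_ne_zero hs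
    have := hF.slab_dummy _ (Nat.one_le_iff_ne_zero.2 h0) hf.pos_le
    rw [hf.fs_pos h0] at this
    exact this hs

theorem ParentFacts.emit_main (hf : ParentFacts T H o k N lab fs idx pos)
    (hF : PartialForest T H o k N fp lab fs dum) (hM : MainCopies T H o k N lab fs idx pos)
    (hk : k < n) (hs : T.depth (k + 1) ≠ idx (T.parent (k + 1)) * H + o) (ho : 1 ≤ o)
    (hoH : o ≤ H) :
    PartialForest T H o (k + 1) (N + 1) (Function.update fp (N + 1) (pos (T.parent (k + 1))))
      (Function.update lab (N + 1) (k + 1)) (Function.update fs (N + 1) (idx (T.parent (k + 1))))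
      dum ∧
    MainCopies T H o (k + 1) (N + 1) (Function.update lab (N + 1) (k + 1))
      (Function.update fs (N + 1) (idx (T.parent (k + 1))))
      (Function.update idx (k + 1) (idx (T.parent (k + 1)))) (Function.update pos (k + 1) (N + 1)) := by
  have hlow := hf.low
  have hhigh := hf.high
  refine ⟨hf.emit hF hk, hM.step (by omega) (fun j hj => Function.update_of_ne (by omega) _ _)
    (fun j hj => Function.update_of_ne (by omega) _ _) (by omega) le_rfl (by simp) (by simp)
    ⟨hlow, by omega, hf.idx_le⟩ ?_⟩
  intro i hi
  -- Among the levels in the window of the parent's slab, only the last is an s-level, and `hs`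
  -- excludes it; the root lies above all s-levels.
  exfalso
  rcases lt_trichotomy (idx (T.parent (k + 1))) i with h | h | h
  · have := Nat.mul_le_mul_right H (Nat.succ_le_of_lt h); rw [Nat.succ_mul] at this
    by_cases hk0 : k = 0
    · subst hk0
      have hd : T.depth (0 + 1) = 0 := T.depth_one
      omega
    · omega
  · subst h; exact hs hi
  · have := Nat.mul_le_mul_right H (Nat.succ_le_of_lt h); rw [Nat.succ_mul] at this
    by_cases hk0 : k = 0
    · subst hk0
      have hd : T.depth (0 + 1) = 0 := T.depth_one
      omega
    · have := hf.low_lt hk0; omega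

/-- The data with subscript `₁` include the promoted copy, at index `N + 1`, and a new dummy root if
one was missing. The original copy is appended below the dummy root and becomes the main copy. -/
theorem ParentFacts.emit_snode {N₁ : ℕ} {fp₁ lab₁ fs₁ dum₁ : ℕ → ℕ}
    (hf : ParentFacts T H o k N lab fs idx pos)
    (hF : PartialForest T H o k N fp lab fs dum)
    (hM : MainCopies T H o k N lab fs idx pos) (hk : k < n)
    (hs : T.depth (k + 1) = idx (T.parent (k + 1)) * H + o) (ho : 1 ≤ o) (hoH : o ≤ H)
    (h₁ : PartialForest T H o (k + 1) N₁ fp₁ lab₁ fs₁ dum₁) (hN₁ : N + 1 ≤ N₁)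
    (hlab : ∀ j, j ≤ N → lab₁ j = lab j) (hfs : ∀ j, j ≤ N → fs₁ j = fs j)
    (hlab' : lab₁ (N + 1) = k + 1) (hfs' : fs₁ (N + 1) = idx (T.parent (k + 1)))
    (hnew : ∀ j, N + 1 < j → j ≤ N₁ → lab₁ j = 0)
    (hdum : dum₁ (idx (T.parent (k + 1)) + 1) ≠ 0) :
    PartialForest T H o (k + 1) (N₁ + 1)
      (Function.update fp₁ (N₁ + 1) (dum₁ (idx (T.parent (k + 1)) + 1)))
      (Function.update lab₁ (N₁ + 1) (k + 1))
      (Function.update fs₁ (N₁ + 1) (idx (T.parent (k + 1)) + 1)) dum₁ ∧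
    MainCopies T H o (k + 1) (N₁ + 1) (Function.update lab₁ (N₁ + 1) (k + 1))
      (Function.update fs₁ (N₁ + 1) (idx (T.parent (k + 1)) + 1))
      (Function.update idx (k + 1) (idx (T.parent (k + 1)) + 1))
      (Function.update pos (k + 1) (N₁ + 1)) := by
  obtain ⟨d1, d2, d3, -, -⟩ := h₁.dummy _ hdum
  have hk0 : k ≠ 0 := by
    rintro rfl
    have hd : T.depth (0 + 1) = 0 := T.depth_one
    omega
  have hmul : (idx (T.parent (k + 1)) + 1) * H = idx (T.parent (k + 1)) * H + H := by ring
  constructor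
  · refine h₁.emit_node (by omega) le_rfl ?_ ?_ d1 (fun _ => d3) ?_ ?_ (fun _ => hdum)
    · rw [T.mem_slab]; omega
    · intro j j1 j2 j3
      rcases Nat.lt_trichotomy j (N + 1) with h | h | h
      · rw [hlab j (by omega)]
        have := hF.label_le j j1 (by omega); omega
      · subst h; omega
      · rw [hnew j h j2]; omega
    · rw [d2, if_pos (by omega)]
    · omega
  · refine hM.step (by omega) (fun j hj => ?_) (fun j hj => ?_) (by omega) le_rfl (by simp) (by simp)
      ⟨by omega, by omega, ?_⟩ ?_
    · rw [Function.update_of_ne (by omega)]; exact hlab j hj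
    · rw [Function.update_of_ne (by omega)]; exact hfs j hj
    · exact hf.idx_lt hk0
    · intro i hi
      have hii : idx (T.parent (k + 1)) = i := by
        have : idx (T.parent (k + 1)) * H = i * H := by omega
        exact Nat.eq_of_mul_eq_mul_right (by omega) this
      refine ⟨N + 1, by omega, by omega, ?_, ?_⟩
      · rw [Function.update_of_ne (by omega), hfs', hii]
      · rw [Function.update_of_ne (by omega), hlab']

end MainCopies

/-! ### The pass that lays out the slab trees -/

namespace WordRAM

open HExpr HProg

set_option linter.unusedSimpArgs false

/-- Appends a node to the slab trees. -/
def emit (f l s : HExpr) : HProg :=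
  .seq (put .tot zero (add (var .tot) one))
    (.seq (put .fp (var .tot) f) (.seq (put .lab (var .tot) l) (put .fs (var .tot) s)))

/-- Lays out the slab trees. -/
def forestPhase : Phase where
  lim := .nn
  body :=
    .ite (.eq (get .res ctr) (var .off))
      (.seq (emit (get .pos (get .par ctr)) ctr (get .idx (get .par ctr)))
        (.seq (put .idx ctr (add (get .idx (get .par ctr)) one))
          (.seq
            (.ite (.eq (get .dum (get .idx ctr)) zero)
              (.seq (emit zero zero (get .idx ctr)) (put .dum (get .idx ctr) (var .tot))) skip)
            (.seq (emit (get .dum (get .idx ctr)) ctr (get .idx ctr)) (put .pos ctr (var .tot))))))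
      (.seq (put .idx ctr (get .idx (get .par ctr)))
        (.seq (emit (get .pos (get .par ctr)) ctr (get .idx ctr)) (put .pos ctr (var .tot))))

/-- A node adds at most three indices: a promoted copy, a dummy root and an original copy. -/
theorem forestPhase_step {n K H o k : ℕ} (T : OrdinalTree n) {A : Arrays} (ho : 1 ≤ o) (hoH : o ≤ H)
    (hK : 20 * n ≤ K) (hk : k < n) (hpar : A .par (k + 1) = T.parent (k + 1))
    (hres : A .res (k + 1) = levelRes H (T.depth (k + 1))) (hoff : A .off 0 = o)
    (hF : PartialForest T H o k (A .tot 0) (A .fp) (A .lab) (A .fs) (A .dum))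
    (hM : MainCopies T H o k (A .tot 0) (A .lab) (A .fs) (A .idx) (A .pos))
    (hN : A .tot 0 ≤ 3 * k) {A' : Arrays} (hA' : A' = forestPhase.body.run K (k + 1) A) :
    PartialForest T H o (k + 1) (A' .tot 0) (A' .fp) (A' .lab) (A' .fs) (A' .dum) ∧
      MainCopies T H o (k + 1) (A' .tot 0) (A' .lab) (A' .fs) (A' .idx) (A' .pos) ∧
      A' .tot 0 ≤ 3 * (k + 1) := by
  have hf := hM.parentFacts hF.lab_zero hoH hk
  -- The program compares residues only. Within the window of the parent's slab this detects the
  -- last level; the root has residue `0`, which is not `o`.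
  have hw : levelRes H (T.depth (k + 1)) = o ↔
      T.depth (k + 1) = A .idx (T.parent (k + 1)) * H + o := by
    by_cases hk0 : k = 0
    · subst hk0
      have hd : T.depth (0 + 1) = 0 := T.depth_one
      rw [hd, show levelRes H 0 = 0 from rfl]
      omega
    · exact levelRes_eq_iff_of_window ho hoH (hf.low_lt hk0) hf.high
  have hd := T.depth_lt (v := k + 1) (by omega) (by omega)
  have hi := hf.idx_le
  have c1 : capAdd K (A .tot 0) 1 = A .tot 0 + 1 := capAdd_eq (by omega)
  have c2 : capAdd K (A .idx (T.parent (k + 1))) 1 = A .idx (T.parent (k + 1)) + 1 :=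
    capAdd_eq (by omega)
  have c3 : capAdd K (A .tot 0 + 1) 1 = A .tot 0 + 1 + 1 := capAdd_eq (by omega)
  have c4 : capAdd K (A .tot 0 + 1 + 1) 1 = A .tot 0 + 1 + 1 + 1 := capAdd_eq (by omega)
  by_cases hs : levelRes H (T.depth (k + 1)) = o
  · have h₁ := hf.emit hF hk
    by_cases hd : A .dum (A .idx (T.parent (k + 1)) + 1) = 0
    · simp only [forestPhase, emit, run_seq, run_ite_eq, run_put, run_skip, eval_zero, eval_one,
        eval_ctr, eval_get, eval_add, hpar, hres, hoff, hs, if_true, Arrays.set, Function.update_self,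
        ne_eq, reduceCtorEq, not_false_eq_true, Function.update_of_ne, c1, c2, c3, hd, c4] at hA'
      subst hA'
      simp only [ne_eq, reduceCtorEq, not_false_eq_true, Function.update_of_ne,
        Function.update_self]
      have h₂ := h₁.emit_dummy (s := A .idx (T.parent (k + 1)) + 1) (by omega) (by
        rw [← Finset.nonempty_iff_ne_empty]
        refine ⟨k + 1, ?_⟩
        have hmul : (A .idx (T.parent (k + 1)) + 1) * H = A .idx (T.parent (k + 1)) * H + H := by
          ring
        rw [T.mem_slab]; have := hw.1 hs; omega) hd
      have h₃ := hf.emit_snode hF hM hk (hw.1 hs) ho hoH h₂ (by omega)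
        (fun j hj => by rw [Function.update_of_ne (by omega), Function.update_of_ne (by omega)])
        (fun j hj => by rw [Function.update_of_ne (by omega), Function.update_of_ne (by omega)])
        (by rw [Function.update_of_ne (by omega)]; simp)
        (by rw [Function.update_of_ne (by omega)]; simp)
        (fun j j1 j2 => by
          obtain rfl : j = A .tot 0 + 1 + 1 := by omega
          simp)
        (by simp)
      rw [Function.update_self] at h₃
      exact ⟨h₃.1, h₃.2, by omega⟩
    · simp only [forestPhase, emit, run_seq, run_ite_eq, run_put, run_skip, eval_zero, eval_one,
        eval_ctr, eval_get, eval_add, hpar, hres, hoff, hs, if_true, Arrays.set, Function.update_self,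
        ne_eq, reduceCtorEq, not_false_eq_true, Function.update_of_ne, c1, c2, c3, hd, if_false] at hA'
      subst hA'
      simp only [ne_eq, reduceCtorEq, not_false_eq_true, Function.update_of_ne,
        Function.update_self]
      have h₃ := hf.emit_snode hF hM hk (hw.1 hs) ho hoH h₁ le_rfl
        (fun j hj => by rw [Function.update_of_ne (by omega)])
        (fun j hj => by rw [Function.update_of_ne (by omega)])
        (by simp) (by simp) (fun j j1 j2 => by omega) hd
      exact ⟨h₃.1, h₃.2, by omega⟩
  · simp only [forestPhase, emit, run_seq, run_ite_eq, run_put, run_skip, eval_zero, eval_one,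
        eval_ctr, eval_get, eval_add, hpar, hres, hoff, hs, if_false, Arrays.set, Function.update_self,
        ne_eq, reduceCtorEq, not_false_eq_true, Function.update_of_ne, c1] at hA'
    subst hA'
    simp only [ne_eq, reduceCtorEq, not_false_eq_true, Function.update_of_ne,
      Function.update_self]
    have h := hf.emit_main hF hM hk (fun hc => hs (hw.2 hc)) ho hoH
    exact ⟨h.1, h.2, by omega⟩

theorem forestPhase_spec {n K H o : ℕ} (T : OrdinalTree n) {A : Arrays} (ho : 1 ≤ o) (hoH : o ≤ H)
    (hK : 20 * n ≤ K) (hnn : A .nn 0 = n) (hpar : ∀ v, 1 ≤ v → v ≤ n → A .par v = T.parent v)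
    (hres : ∀ v, 1 ≤ v → v ≤ n → A .res v = levelRes H (T.depth v)) (hoff : A .off 0 = o)
    (htot : A .tot 0 = 0) (hlab : A .lab 0 = 0) (hidx : A .idx 0 = 0) (hpos : A .pos 0 = 0)
    (hdum : ∀ i, A .dum i = 0) :
    SlabForest T H o (forestPhase.run K A .tot 0) (forestPhase.run K A .fp)
      (forestPhase.run K A .lab) (forestPhase.run K A .fs) := by
  have h := (forestPhase.run_induction (K := K) (fun k A =>
    PartialForest T H o k (A .tot 0) (A .fp) (A .lab) (A .fs) (A .dum) ∧
      MainCopies T H o k (A .tot 0) (A .lab) (A .fs) (A .idx) (A .pos) ∧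
      A .tot 0 ≤ 3 * k) hnn ?_ ?_).1
  · exact h.2.1.slabForest h.1 ho h.2.2
  · rw [htot]
    refine ⟨⟨hlab, ?_, ?_, ?_, ?_, ?_, ?_, ?_, ?_, ?_, ?_⟩, ⟨hidx, hpos, ?_, ?_, ?_, ?_, ?_⟩, le_rfl⟩
    all_goals try (intros; omega)
    intro i hi
    exact absurd (hdum i) hi
  · rintro k A' hk hfr ⟨h1, h2, h3⟩
    exact forestPhase_step T ho hoH hK hk (by rw [hfr .par rfl]; exact hpar _ (by omega) (by omega))
      (by rw [hfr .res rfl]; exact hres _ (by omega) (by omega)) (by rw [hfr .off rfl]; exact hoff)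
      h1 h2 h3 rfl

end WordRAM

/-! ### Subtree sizes, light and heavy indices -/

open Finset in
/-- The sizes of the subtrees of a forest `fp` with weights `wt` on the indices in `(m .. N]`; an
index is *light* when its size is at most `B` and *heavy* otherwise; `own` is the size without the
subtrees of the heavy children, and `hv` is the number of heavy children. -/
structure PartialWeights (B N m : ℕ) (fp wt sz own hv : ℕ → ℕ) : Prop where
  sz_eq : ∀ x, sz x = (if m < x ∧ x ≤ N then wt x else 0) +
    ∑ j ∈ (Ioc m N).filter (fun j => fp j = x), sz j
  own_eq : ∀ x, own x = (if m < x ∧ x ≤ N then wt x else 0) +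
    ∑ j ∈ (Ioc m N).filter (fun j => fp j = x ∧ sz j ≤ B), sz j
  hv_eq : ∀ x, hv x = ((Ioc m N).filter (fun j => fp j = x ∧ B < sz j)).card

namespace PartialWeights

open Finset

variable {B N m : ℕ} {fp wt sz own hv : ℕ → ℕ}

/-- Weight is conserved: a processed index passes its size on to its parent, so the cells `0, …, m`
together hold the weight processed so far. This bounds the values during the downward loop. -/
theorem sum_sz (h : PartialWeights B N m fp wt sz own hv) (hm : m ≤ N)
    (hfp : ∀ k, 1 ≤ k → k ≤ N → fp k < k) :
    ∑ x ∈ range (m + 1), sz x = ∑ x ∈ Ioc m N, wt x := by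
  have h1 : ∑ x ∈ range (N + 1), sz x = ∑ x ∈ Ioc m N, wt x + ∑ j ∈ Ioc m N, sz j := by
    have h2 : ∀ x ∈ range (N + 1), sz x = (if m < x ∧ x ≤ N then wt x else 0) +
      ∑ j ∈ (Ioc m N).filter (fun j => fp j = x), sz j := fun x _ => h.sz_eq x
    rw [sum_congr rfl h2, sum_add_distrib]
    congr 1
    · rw [← sum_filter]
      congr 1
      ext x
      simp only [mem_filter, mem_range, mem_Ioc]; omega
    · rw [sum_fiberwise_of_maps_to]
      intro j hj
      rw [mem_Ioc] at hj
      have := hfp j (by omega) hj.2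
      simp; omega
  have h3 : range (N + 1) = range (m + 1) ∪ Ioc m N := by
    ext x; simp; omega
  rw [h3, sum_union] at h1
  · omega
  · rw [disjoint_left]; intro x; simp; omega

theorem sz_le (h : PartialWeights B N m fp wt sz own hv) (hm : m ≤ N)
    (hfp : ∀ k, 1 ≤ k → k ≤ N → fp k < k) (hwt : ∀ x, wt x ≤ 1) {x : ℕ} (hx : x ≤ m) :
    sz x ≤ N := by
  calc sz x ≤ ∑ x ∈ range (m + 1), sz x :=
        single_le_sum (f := sz) (fun _ _ => Nat.zero_le _) (by simp; omega)
    _ = ∑ x ∈ Ioc m N, wt x := h.sum_sz hm hfp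
    _ ≤ ∑ x ∈ Ioc m N, 1 := sum_le_sum fun x _ => hwt x
    _ ≤ N := by simp

theorem own_le (h : PartialWeights B N m fp wt sz own hv) (x : ℕ) : own x ≤ sz x := by
  rw [h.own_eq x, h.sz_eq x]
  refine Nat.add_le_add_left (sum_le_sum_of_subset ?_) _
  intro j
  simp +contextual

theorem hv_le (h : PartialWeights B N m fp wt sz own hv) (x : ℕ) : hv x ≤ N := by
  rw [h.hv_eq x]
  exact (card_filter_le _ _).trans (by simp)

/-- Children have larger indices than their parents. So when index `m + 1` is reached, its size
lacks only its own weight; the completed size decides whether it is heavy and is passed to the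
parent. -/
theorem step (h : PartialWeights B N (m + 1) fp wt sz own hv) (hm : m + 1 ≤ N)
    (hfp : fp (m + 1) < m + 1) {sz' own' hv' : ℕ → ℕ}
    (hsz : ∀ x, sz' x = sz x + (if x = m + 1 then wt x else 0) +
      if x = fp (m + 1) then sz (m + 1) + wt (m + 1) else 0)
    (hown : ∀ x, own' x = own x + (if x = m + 1 then wt x else 0) +
      if x = fp (m + 1) ∧ sz (m + 1) + wt (m + 1) ≤ B then sz (m + 1) + wt (m + 1) else 0)
    (hhv : ∀ x, hv' x = hv x + if x = fp (m + 1) ∧ B < sz (m + 1) + wt (m + 1) then 1 else 0) :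
    PartialWeights B N m fp wt sz' own' hv' := by
  have hI : Ioc m N = insert (m + 1) (Ioc (m + 1) N) := by ext x; simp; omega
  have e1 : sz' (m + 1) = sz (m + 1) + wt (m + 1) := by
    rw [hsz]; simp only [if_true]; rw [if_neg (by omega)]; rfl
  have e2 : ∀ j ∈ Ioc (m + 1) N, sz' j = sz j := by
    intro j hj
    rw [mem_Ioc] at hj
    rw [hsz, if_neg (by omega), if_neg (by omega)]; rfl
  have e3 : m + 1 ∉ Ioc (m + 1) N := by simp
  have e4 : ∀ x, (if m < x ∧ x ≤ N then wt x else 0) =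
      (if m + 1 < x ∧ x ≤ N then wt x else 0) + if x = m + 1 then wt x else 0 := by
    intro x
    by_cases hx : x = m + 1
    · subst hx; simp [hm]
    · rw [if_neg hx]
      congr 1
      exact propext ⟨fun h => ⟨by omega, h.2⟩, fun h => ⟨by omega, h.2⟩⟩
  refine ⟨fun x => ?_, fun x => ?_, fun x => ?_⟩
  · rw [hsz, h.sz_eq x, e4 x, hI, filter_insert]
    have e5 : ∑ j ∈ (Ioc (m + 1) N).filter (fun j => fp j = x), sz' j =
        ∑ j ∈ (Ioc (m + 1) N).filter (fun j => fp j = x), sz j :=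
      sum_congr rfl fun j hj => e2 j (mem_filter.1 hj).1
    by_cases hx : fp (m + 1) = x
    · rw [if_pos hx, if_pos hx.symm, sum_insert (fun hc => e3 (mem_filter.1 hc).1), e5, e1]
      ring
    · rw [if_neg hx, if_neg (Ne.symm hx), e5]; ring
  · rw [hown, h.own_eq x, e4 x, hI, filter_insert]
    have e6 : (Ioc (m + 1) N).filter (fun j => fp j = x ∧ sz' j ≤ B) =
        (Ioc (m + 1) N).filter (fun j => fp j = x ∧ sz j ≤ B) :=
      filter_congr fun j hj => by rw [e2 j hj]
    have e5 : ∑ j ∈ (Ioc (m + 1) N).filter (fun j => fp j = x ∧ sz j ≤ B), sz' j =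
        ∑ j ∈ (Ioc (m + 1) N).filter (fun j => fp j = x ∧ sz j ≤ B), sz j :=
      sum_congr rfl fun j hj => e2 j (mem_filter.1 hj).1
    rw [e6, e1]
    by_cases hx : fp (m + 1) = x ∧ sz (m + 1) + wt (m + 1) ≤ B
    · rw [if_pos hx, if_pos (show x = fp (m + 1) ∧ sz (m + 1) + wt (m + 1) ≤ B from ⟨hx.1.symm, hx.2⟩),
        sum_insert (fun hc => e3 (mem_filter.1 hc).1), e5, e1]
      ring
    · rw [if_neg hx, if_neg (show ¬(x = fp (m + 1) ∧ sz (m + 1) + wt (m + 1) ≤ B) from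
        fun hc => hx ⟨hc.1.symm, hc.2⟩), e5]; ring
  · rw [hhv, h.hv_eq x, hI, filter_insert]
    have e6 : (Ioc (m + 1) N).filter (fun j => fp j = x ∧ B < sz' j) =
        (Ioc (m + 1) N).filter (fun j => fp j = x ∧ B < sz j) :=
      filter_congr fun j hj => by rw [e2 j hj]
    rw [e6, e1]
    by_cases hx : fp (m + 1) = x ∧ B < sz (m + 1) + wt (m + 1)
    · rw [if_pos hx, if_pos ⟨hx.1.symm, hx.2⟩,
        card_insert_of_notMem (fun hc => e3 (mem_filter.1 hc).1)]
    · rw [if_neg hx, if_neg (fun hc => hx ⟨hc.1.symm, hc.2⟩)]; rfl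

end PartialWeights

namespace WordRAM

open HExpr HProg

set_option linter.unusedSimpArgs false

/-- The index that is processed by a downward loop. -/
def downIndex : HExpr := sub (add (var .tot) one) ctr

/-- Computes the sizes of the subtrees. -/
def sizePhase : Phase where
  lim := .tot
  body :=
    .seq
      (.ite (.eq (get .lab downIndex) zero) skip
        (.seq (put .sz downIndex (add (get .sz downIndex) one))
          (put .own downIndex (add (get .own downIndex) one))))
      (.seq (put .sz (get .fp downIndex) (add (get .sz (get .fp downIndex)) (get .sz downIndex)))
        (.ite (.lt (var .bb) (get .sz downIndex))
          (put .hv (get .fp downIndex) (add (get .hv (get .fp downIndex)) one))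
          (put .own (get .fp downIndex)
            (add (get .own (get .fp downIndex)) (get .sz downIndex)))))

theorem sizePhase_spec {K B N : ℕ} {A : Arrays} (hK : 3 * N + 3 ≤ K) (hbb : A .bb 0 = B)
    (htot : A .tot 0 = N) (hfp : ∀ k, 1 ≤ k → k ≤ N → A .fp k < k)
    (hsz : ∀ x, A .sz x = 0) (hown : ∀ x, A .own x = 0) (hhv : ∀ x, A .hv x = 0) :
    PartialWeights B N 0 (A .fp) (fun k => if A .lab k = 0 then 0 else 1) (sizePhase.run K A .sz)
      (sizePhase.run K A .own) (sizePhase.run K A .hv) := by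
  have h := (sizePhase.run_induction (K := K) (fun k A' => k ≤ N →
    PartialWeights B N (N - k) (A .fp) (fun k => if A .lab k = 0 then 0 else 1) (A' .sz)
      (A' .own) (A' .hv)) htot ?_ ?_).1 le_rfl
  · simpa using h
  · intro _
    refine ⟨fun x => ?_, fun x => ?_, fun x => ?_⟩
    · simp [hsz]
    · simp [hsz, hown]
    · simp [hhv]
  · intro k A' hk hfr hI _
    replace hI := hI hk.le
    obtain ⟨m, hm⟩ : ∃ m, N = k + 1 + m := ⟨N - (k + 1), by omega⟩
    rw [show N - k = m + 1 by omega] at hI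
    rw [show N - (k + 1) = m by omega]
    have hp := hfp (m + 1) (by omega) (by omega)
    have f1 : A' .tot 0 = N := by rw [hfr .tot rfl, htot]
    have f2 : A' .fp = A .fp := hfr .fp rfl
    have f3 : A' .lab = A .lab := hfr .lab rfl
    have f4 : A' .bb 0 = B := by rw [hfr .bb rfl, hbb]
    have f5 : capAdd K N 1 = N + 1 := capAdd_eq (by omega)
    have f6 : N + 1 - (k + 1) = m + 1 := by omega
    have hw : ∀ x, (if A .lab x = 0 then 0 else 1) ≤ 1 := fun x => by split_ifs <;> omega
    have b1 := hI.sz_le (by omega) hfp hw (le_refl (m + 1))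
    have b2 := hI.sz_le (by omega) hfp hw hp.le
    have b3 := hI.own_le (m + 1)
    have b4 := hI.own_le (A .fp (m + 1))
    have b5 := hI.hv_le (A .fp (m + 1))
    have c1 : capAdd K (A' .sz (m + 1)) 1 = A' .sz (m + 1) + 1 := capAdd_eq (by omega)
    have c2 : capAdd K (A' .own (m + 1)) 1 = A' .own (m + 1) + 1 := capAdd_eq (by omega)
    have c3 : capAdd K (A' .sz (A .fp (m + 1))) (A' .sz (m + 1) + 1) =
      A' .sz (A .fp (m + 1)) + (A' .sz (m + 1) + 1) := capAdd_eq (by omega)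
    have c4 : capAdd K (A' .sz (A .fp (m + 1))) (A' .sz (m + 1)) =
      A' .sz (A .fp (m + 1)) + (A' .sz (m + 1)) := capAdd_eq (by omega)
    have c5 : capAdd K (A' .own (A .fp (m + 1))) (A' .sz (m + 1) + 1) =
      A' .own (A .fp (m + 1)) + (A' .sz (m + 1) + 1) := capAdd_eq (by omega)
    have c6 : capAdd K (A' .own (A .fp (m + 1))) (A' .sz (m + 1)) =
      A' .own (A .fp (m + 1)) + (A' .sz (m + 1)) := capAdd_eq (by omega)
    have c7 : capAdd K (A' .hv (A .fp (m + 1))) 1 = A' .hv (A .fp (m + 1)) + 1 :=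
      capAdd_eq (by omega)
    have hne : A .fp (m + 1) ≠ m + 1 := hp.ne
    refine hI.step (by omega) hp ?_ ?_ ?_ <;> intro x <;>
      by_cases hl : A .lab (m + 1) = 0 <;>
      by_cases hB : B < A' .sz (m + 1) + (if A .lab (m + 1) = 0 then 0 else 1) <;>
      by_cases hx : x = m + 1 <;> by_cases hx' : x = A .fp (m + 1) <;>
      simp only [hl, if_true, if_false, add_zero] at hB <;>
      simp [sizePhase, downIndex, run_seq, run_ite_eq, run_ite_lt, run_put, run_skip, eval_zero,
        eval_one, eval_ctr, eval_get, eval_add, eval_sub, f1, f2, f3, f4, f5, f6, hl, Arrays.set,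
        hne, hne.symm, c1, c2, c3, c4, c5, c6, c7, hB, Function.update_apply, hx, hx']
    all_goals omega

end WordRAM

/-! ### Split indices, chains and groups -/

/-- A forest `fp` on `1, …, N` with heavy indices `V`, some of which are split indices `S`. The
other heavy indices have a heavy parent and at most one heavy child. -/
structure SplitForest (B N : ℕ) (fp own : ℕ → ℕ) (V S : ℕ → Prop) : Prop where
  fp_lt : ∀ k, 1 ≤ k → k ≤ N → fp k < k
  heavy_parent : ∀ k, 1 ≤ k → k ≤ N → V k → fp k ≠ 0 → V (fp k)
  split_pos : ∀ k, S k → 1 ≤ k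
  split_heavy : ∀ k, S k → V k
  split_root : ∀ k, 1 ≤ k → k ≤ N → V k → fp k = 0 → S k
  chain_unique : ∀ j j', 1 ≤ j → j ≤ N → 1 ≤ j' → j' ≤ N → V j → V j' → fp j = fp j' → fp j ≠ 0 →
    ¬S (fp j) → j = j'
  own_le : ∀ k, 1 ≤ k → k ≤ N → ¬S k → own k ≤ B

/-- The indices `1, …, k` are distributed to the groups `1, …, M`: `memb` is the group of an index
that is not split, `cur` the current group of a split index, and `rt` the root of a group. -/
structure Grouping (N k : ℕ) (fp : ℕ → ℕ) (V S : ℕ → Prop) (memb cur rt : ℕ → ℕ) (M : ℕ) :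
    Prop where
  num_le : M ≤ k
  memb_zero : memb 0 = 0
  memb_split : ∀ j, 1 ≤ j → j ≤ k → S j → memb j = 0
  memb_pos : ∀ j, 1 ≤ j → j ≤ k → ¬S j → 1 ≤ memb j
  memb_le : ∀ j, j ≤ k → memb j ≤ M
  light_root : ∀ j, 1 ≤ j → j ≤ k → ¬V j → fp j = 0 → rt (memb j) = j
  light_inherit : ∀ j, 1 ≤ j → j ≤ k → ¬V j → fp j ≠ 0 → ¬S (fp j) → memb j = memb (fp j)
  light_split : ∀ j, 1 ≤ j → j ≤ k → ¬V j → S (fp j) → rt (memb j) = fp j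
  chain : ∀ j, 1 ≤ j → j ≤ k → V j → ¬S j →
    rt (memb j) = j ∨ (¬S (fp j) ∧ memb j = memb (fp j))
  chain_rt : ∀ j, 1 ≤ j → j ≤ k → V j → ¬S j → V (rt (memb j)) ∧ ¬S (rt (memb j))
  rt_pos : ∀ c, 1 ≤ c → c ≤ M → 1 ≤ rt c
  rt_le : ∀ c, 1 ≤ c → c ≤ M → rt c ≤ k
  rt_memb : ∀ c, 1 ≤ c → c ≤ M → ¬S (rt c) → memb (rt c) = c
  rt_light : ∀ c, 1 ≤ c → c ≤ M → ¬V (rt c) → fp (rt c) = 0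
  split_rt : ∀ j, 1 ≤ j → j ≤ k → S j → ∃ c, 1 ≤ c ∧ c ≤ M ∧ rt c = j
  cur_le : ∀ j, 1 ≤ j → j ≤ k → S j → cur j ≤ M
  rt_cur : ∀ j, 1 ≤ j → j ≤ k → S j → cur j ≠ 0 → rt (cur j) = j
  distinct : ∀ c c', 1 ≤ c → c ≤ M → 1 ≤ c' → c' ≤ M → c ≠ c' → rt c = rt c' →
    ∃ j, 1 ≤ j ∧ j ≤ k ∧ (memb j = c ∨ memb j = c')
  interval : ∀ j₁ j₂ j₃, 1 ≤ j₁ → j₁ < j₂ → j₂ < j₃ → j₃ ≤ k → fp j₁ = fp j₃ → fp j₂ = fp j₃ →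
    S (fp j₃) → memb j₁ = memb j₃ → memb j₁ ≠ 0 → memb j₂ = memb j₃
  cur_tail : ∀ j j', 1 ≤ j → j < j' → j' ≤ k → fp j = fp j' → S (fp j') → cur (fp j') ≠ 0 →
    memb j = cur (fp j') → memb j' = cur (fp j')

namespace Grouping

variable {B N k M : ℕ} {fp own memb cur rt memb' cur' rt' : ℕ → ℕ} {V S : ℕ → Prop}

/-- A common frame for all cases of the algorithm: the hypotheses `q_…` describe the index `k + 1`,
`n_…` a new group `M + 1`, and `p_cur` the current group of the parent. By `q_old`, a child of a
split index joins an old group only while this is the current one, which keeps the children in a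
group consecutive. -/
theorem step {M' : ℕ} (hF : SplitForest B N fp own V S) (h : Grouping N k fp V S memb cur rt M)
    (hk : k < N) (hM : M' = M ∨ M' = M + 1) (hm : ∀ j, j ≤ k → memb' j = memb j)
    (hrt : ∀ c, 1 ≤ c → c ≤ M → rt' c = rt c)
    (hcur : ∀ j, 1 ≤ j → j ≤ k → S j → j ≠ fp (k + 1) → cur' j = cur j)
    (q_split : S (k + 1) → memb' (k + 1) = 0 ∧ M' = M + 1 ∧ rt' (M + 1) = k + 1 ∧
      cur' (k + 1) = M + 1)
    (q_memb : ¬S (k + 1) → 1 ≤ memb' (k + 1) ∧ memb' (k + 1) ≤ M')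
    (q_root : ¬V (k + 1) → fp (k + 1) = 0 → rt' (memb' (k + 1)) = k + 1)
    (q_inherit : ¬V (k + 1) → fp (k + 1) ≠ 0 → ¬S (fp (k + 1)) →
      memb' (k + 1) = memb (fp (k + 1)))
    (q_light : ¬V (k + 1) → S (fp (k + 1)) → rt' (memb' (k + 1)) = fp (k + 1))
    (q_chain : V (k + 1) → ¬S (k + 1) → rt' (memb' (k + 1)) = k + 1 ∨
      (¬S (fp (k + 1)) ∧ memb' (k + 1) = memb (fp (k + 1))))
    (n_rt : M' = M + 1 → rt' (M + 1) = k + 1 ∨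
      (rt' (M + 1) = fp (k + 1) ∧ S (fp (k + 1)) ∧ memb' (k + 1) = M + 1))
    (n_memb : M' = M + 1 → ¬S (k + 1) → memb' (k + 1) = M + 1)
    (n_light : M' = M + 1 → rt' (M + 1) = k + 1 → ¬V (k + 1) → fp (k + 1) = 0)
    (q_old : S (fp (k + 1)) → memb' (k + 1) ≠ 0 → memb' (k + 1) ≤ M →
      memb' (k + 1) = cur (fp (k + 1)))
    (p_cur : S (fp (k + 1)) →
      (cur' (fp (k + 1)) = cur (fp (k + 1)) ∧ memb' (k + 1) = cur (fp (k + 1))) ∨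
      cur' (fp (k + 1)) = 0 ∨
      (cur' (fp (k + 1)) = M + 1 ∧ M' = M + 1 ∧ rt' (M + 1) = fp (k + 1))) :
    Grouping N (k + 1) fp V S memb' cur' rt' M' := by
  have hlt := hF.fp_lt (k + 1) (by omega) (by omega)
  have hfp : ∀ j, 1 ≤ j → j ≤ k → fp j < j := fun j h1 h2 => hF.fp_lt j h1 (by omega)
  have hcase : ∀ j, j ≤ k + 1 → j ≤ k ∨ j = k + 1 := fun j hj => by omega
  have hcaseM : ∀ c, c ≤ M' → c ≤ M ∨ (c = M + 1 ∧ M' = M + 1) := fun c hc => by omega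
  have hMM : M ≤ M' := by omega
  refine ⟨by have := h.num_le; omega, by rw [hm 0 (by omega)]; exact h.memb_zero, ?_, ?_, ?_, ?_,
    ?_, ?_, ?_, ?_, ?_, ?_, ?_, ?_, ?_, ?_, ?_, ?_, ?_, ?_⟩
  · intro j h1 h2 hj
    rcases hcase j h2 with h2 | rfl
    · rw [hm j h2]; exact h.memb_split j h1 h2 hj
    · exact (q_split hj).1
  · intro j h1 h2 hj
    rcases hcase j h2 with h2 | rfl
    · rw [hm j h2]; exact h.memb_pos j h1 h2 hj
    · exact (q_memb hj).1
  · intro j h2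
    rcases hcase j h2 with h2 | rfl
    · rw [hm j h2]; exact (h.memb_le j h2).trans hMM
    · by_cases hj : S (k + 1)
      · rw [(q_split hj).1]; omega
      · exact (q_memb hj).2
  · intro j h1 h2 hj h0
    rcases hcase j h2 with h2 | rfl
    · have hS : ¬S j := fun hc => hj (hF.split_heavy _ hc)
      rw [hm j h2, hrt _ (h.memb_pos j h1 h2 hS) (h.memb_le j h2)]
      exact h.light_root j h1 h2 hj h0
    · exact q_root hj h0
  · intro j h1 h2 hj h0 hS
    rcases hcase j h2 with h2 | rfl
    · rw [hm j h2, hm (fp j) (by have := hfp j h1 h2; omega)]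
      exact h.light_inherit j h1 h2 hj h0 hS
    · rw [hm (fp (k + 1)) (by omega)]
      exact q_inherit hj h0 hS
  · intro j h1 h2 hj hS
    rcases hcase j h2 with h2 | rfl
    · have hS' : ¬S j := fun hc => hj (hF.split_heavy _ hc)
      rw [hm j h2, hrt _ (h.memb_pos j h1 h2 hS') (h.memb_le j h2)]
      exact h.light_split j h1 h2 hj hS
    · exact q_light hj hS
  · intro j h1 h2 hj hS
    rcases hcase j h2 with h2 | rfl
    · rw [hm j h2, hrt _ (h.memb_pos j h1 h2 hS) (h.memb_le j h2),
        hm (fp j) (by have := hfp j h1 h2; omega)]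
      exact h.chain j h1 h2 hj hS
    · rw [hm (fp (k + 1)) (by omega)]
      exact q_chain hj hS
  · intro j h1 h2 hj hS
    rcases hcase j h2 with h2 | rfl
    · rw [hm j h2, hrt _ (h.memb_pos j h1 h2 hS) (h.memb_le j h2)]
      exact h.chain_rt j h1 h2 hj hS
    · rcases q_chain hj hS with he | ⟨he, he'⟩
      · rw [he]; exact ⟨hj, hS⟩
      · have hp0 : fp (k + 1) ≠ 0 := fun hc => hS (hF.split_root _ (by omega) (by omega) hj hc)
        have hpV := hF.heavy_parent _ (by omega) (by omega) hj hp0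
        rw [he', hrt _ (h.memb_pos _ (by omega) (by omega) he) (h.memb_le _ (by omega))]
        exact h.chain_rt _ (by omega) (by omega) hpV he
  · intro c h1 h2
    rcases hcaseM c h2 with h2 | ⟨rfl, hM1⟩
    · rw [hrt c h1 h2]; exact h.rt_pos c h1 h2
    · rcases n_rt hM1 with he | ⟨he, he', -⟩
      · omega
      · rw [he]; exact hF.split_pos _ he'
  · intro c h1 h2
    rcases hcaseM c h2 with h2 | ⟨rfl, hM1⟩
    · rw [hrt c h1 h2]; exact (h.rt_le c h1 h2).trans (by omega)
    · rcases n_rt hM1 with he | ⟨he, he', -⟩ <;> omega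
  · intro c h1 h2 hS
    rcases hcaseM c h2 with h2 | ⟨rfl, hM1⟩
    · rw [hrt c h1 h2] at hS ⊢
      rw [hm _ (h.rt_le c h1 h2)]; exact h.rt_memb c h1 h2 hS
    · rcases n_rt hM1 with he | ⟨he, he', -⟩
      · rw [he] at hS ⊢; exact n_memb hM1 hS
      · rw [he] at hS; exact absurd he' hS
  · intro c h1 h2 hV
    rcases hcaseM c h2 with h2 | ⟨rfl, hM1⟩
    · rw [hrt c h1 h2] at hV ⊢
      exact h.rt_light c h1 h2 hV
    · rcases n_rt hM1 with he | ⟨he, he', -⟩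
      · have := n_light hM1 he
        rw [he] at hV ⊢; exact this hV
      · rw [he] at hV; exact absurd (hF.split_heavy _ he') hV
  · intro j h1 h2 hS
    rcases hcase j h2 with h2 | rfl
    · obtain ⟨c, c1, c2, c3⟩ := h.split_rt j h1 h2 hS
      exact ⟨c, c1, by omega, by rw [hrt c c1 c2, c3]⟩
    · obtain ⟨-, e2, e3, -⟩ := q_split hS
      exact ⟨M + 1, by omega, by omega, e3⟩
  · intro j h1 h2 hS
    rcases hcase j h2 with h2 | rfl
    · have := h.cur_le j h1 h2 hS
      by_cases hj : j = fp (k + 1)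
      · rcases p_cur (hj ▸ hS) with ⟨e, -⟩ | e | ⟨e, e', -⟩ <;> rw [← hj] at e <;> omega
      · rw [hcur j h1 h2 hS hj]; omega
    · have := q_split hS; omega
  · intro j h1 h2 hS h0
    rcases hcase j h2 with h2 | rfl
    · have g := h.cur_le j h1 h2 hS
      by_cases hj : j = fp (k + 1)
      · rcases p_cur (hj ▸ hS) with ⟨e, -⟩ | e | ⟨e, -, e'⟩ <;> rw [← hj] at e
        · rw [e] at h0 ⊢
          rw [hrt _ (by omega) g]; exact h.rt_cur j h1 h2 hS h0
        · exact absurd e h0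
        · rw [e, e', hj]
      · rw [hcur j h1 h2 hS hj] at h0 ⊢
        rw [hrt _ (by omega) g]; exact h.rt_cur j h1 h2 hS h0
    · obtain ⟨-, -, e3, e4⟩ := q_split hS
      rw [e4, e3]
  · have main : ∀ c, 1 ≤ c → c ≤ M → M' = M + 1 → rt' c = rt' (M + 1) →
        ∃ j, 1 ≤ j ∧ j ≤ k + 1 ∧ memb' j = M + 1 := by
      intro c h1 h2 hM1 he
      rcases n_rt hM1 with e | ⟨-, -, e⟩
      · rw [hrt c h1 h2, e] at he
        have := h.rt_le c h1 h2; omega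
      · exact ⟨k + 1, by omega, le_rfl, e⟩
    intro c c' h1 h2 h1' h2' hne he
    rcases hcaseM c h2 with h2 | ⟨rfl, hM1⟩
    · rcases hcaseM c' h2' with h2' | ⟨rfl, hM1⟩
      · rw [hrt c h1 h2, hrt c' h1' h2'] at he
        obtain ⟨j, j1, j2, j3⟩ := h.distinct c c' h1 h2 h1' h2' hne he
        exact ⟨j, j1, by omega, by rwa [hm j j2]⟩
      · obtain ⟨j, j1, j2, j3⟩ := main c h1 h2 hM1 he
        exact ⟨j, j1, j2, Or.inr j3⟩
    · rcases hcaseM c' h2' with h2' | ⟨rfl, -⟩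
      · obtain ⟨j, j1, j2, j3⟩ := main c' h1' h2' hM1 he.symm
        exact ⟨j, j1, j2, Or.inl j3⟩
      · exact absurd rfl hne
  · intro j₁ j₂ j₃ h1 h2 h3 h4 e1 e2 hS hm1 hm0
    rw [hm j₁ (by omega)] at hm1 hm0
    rw [hm j₂ (by omega)]
    rcases hcase j₃ h4 with h4 | rfl
    · rw [hm j₃ h4] at hm1 ⊢
      exact h.interval j₁ j₂ j₃ h1 h2 h3 h4 e1 e2 hS hm1 hm0
    -- A group shared by `j₁` and `k + 1` is old, hence the current one of the parent; by `cur_tail`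
    -- it contains all children from `j₁` on.
    · have g := q_old hS (by omega) (by have := h.memb_le j₁ (by omega); omega)
      rw [g]
      have := h.cur_tail j₁ j₂ h1 h2 (by omega) (by omega) (by rwa [e2])
      rw [e2] at this
      exact this (by omega) (by omega)
  · intro j j' h1 h2 h3 e hS h0 hj
    rw [hm j (by omega)] at hj
    have g := h.memb_le j (by omega)
    by_cases hp : fp j' = fp (k + 1)
    · rw [hp] at hS h0 hj ⊢
      rcases p_cur hS with ⟨c1, c2⟩ | c1 | ⟨c1, -⟩
      · rw [c1] at h0 hj ⊢
        rcases hcase j' h3 with h3 | rfl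
        · rw [hm j' h3]
          have := h.cur_tail j j' h1 h2 h3 e
          rw [hp] at this
          exact this hS h0 hj
        · exact c2
      · exact absurd c1 h0
      -- The group `M + 1` has only just been created, so it has no member `j ≤ k`.
      · omega
    · rcases hcase j' h3 with h3 | rfl
      · have hpj := hF.split_pos _ hS
        have := hfp j' (by omega) h3
        rw [hcur _ hpj (by omega) hS hp] at h0 hj ⊢
        rw [hm j' h3]
        exact h.cur_tail j j' h1 h2 h3 e hS h0 hj
      · exact absurd rfl hp

theorem rt_le_self (hF : SplitForest B N fp own V S) (h : Grouping N k fp V S memb cur rt M)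
    (hk : k ≤ N) {a : ℕ} (ha : 1 ≤ a) (hak : a ≤ k) (hV : V a) (hS : ¬S a) :
    rt (memb a) ≤ a := by
  induction a using Nat.strong_induction_on with
  | _ a ih =>
    rcases h.chain a ha hak hV hS with e | ⟨e1, e2⟩
    · exact e.le
    · have hp0 : fp a ≠ 0 := fun hc => hS (hF.split_root _ ha (by omega) hV hc)
      have hlt := hF.fp_lt a ha (by omega)
      have := ih (fp a) hlt (by omega) (by omega) (hF.heavy_parent _ ha (by omega) hV hp0) e1
      rw [e2]; omega

/-- The chain members of a group form a path. Climbing from `b`, the path does not end before `a`,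
since the root of the group is at most `a` (`rt_le_self`). As `a` has only one heavy child, the path
reaches `a` through it. -/
theorem heavy_child_le (hF : SplitForest B N fp own V S) (h : Grouping N k fp V S memb cur rt M)
    (hk : k ≤ N) {a b j : ℕ} (ha : 1 ≤ a) (hab : a < b) (hb : b ≤ k) (hVa : V a) (hSa : ¬S a)
    (hVb : V b) (hSb : ¬S b) (he : memb a = memb b) (hj : 1 ≤ j) (hjN : j ≤ N) (hVj : V j)
    (hja : fp j = a) : j ≤ b ∧ memb j = memb b := by
  induction b using Nat.strong_induction_on generalizing a j with
  | _ b ih =>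
    rcases h.chain b (by omega) hb hVb hSb with e | ⟨e1, e2⟩
    · have := h.rt_le_self hF hk ha (by omega) hVa hSa
      rw [he] at this; omega
    · have hp0 : fp b ≠ 0 := fun hc => hSb (hF.split_root _ (by omega) (by omega) hVb hc)
      have hlt := hF.fp_lt b (by omega) (by omega)
      have hVp := hF.heavy_parent _ (by omega) (by omega) hVb hp0
      rcases lt_trichotomy a (fp b) with g | g | g
      · have := ih (fp b) hlt ha g (by omega) hVa hSa hVp e1 (he.trans e2) hj hjN hVj hja
        rw [← e2] at this
        exact ⟨by omega, this.2⟩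
      · obtain rfl := hF.chain_unique j b hj hjN (by omega) (by omega) hVj hVb (hja.trans g)
          (by omega) (by rwa [hja])
        exact ⟨le_rfl, rfl⟩
      -- Here `fp b < a < b`. For the pair `fp b < a`, the induction hypothesis would place the
      -- heavy child `b` of `fp b` at or before `a`.
      · have := ih a hab (a := fp b) (j := b) (by omega) g (by omega) hVp e1 hVa hSa
          (e2.symm.trans he.symm) (by omega) (by omega) hVb rfl
        omega

end Grouping

/-! ### Sizes and number of the groups -/

section

open Finset

theorem card_filter_Icc_succ (k : ℕ) (P : ℕ → Prop) [DecidablePred P] :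
    ((Icc 1 (k + 1)).filter P).card = ((Icc 1 k).filter P).card + if P (k + 1) then 1 else 0 := by
  rw [← insert_Icc_right_eq_Icc_add_one (by omega : 1 ≤ k + 1), filter_insert]
  split_ifs with h
  · rw [card_insert_of_notMem (by simp)]
  · rfl

theorem sum_filter_Icc_succ (k : ℕ) (f : ℕ → ℕ) (P : ℕ → Prop) [DecidablePred P] :
    ∑ j ∈ (Icc 1 (k + 1)).filter P, f j =
      ∑ j ∈ (Icc 1 k).filter P, f j + if P (k + 1) then f (k + 1) else 0 := by
  rw [← insert_Icc_right_eq_Icc_add_one (by omega : 1 ≤ k + 1), filter_insert]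
  split_ifs with h
  · rw [sum_insert (by simp), add_comm]
  · rfl

/-- The indices whose own size is counted in the size of their group. -/
abbrev IsCounted (fp : ℕ → ℕ) (V S : ℕ → Prop) (j : ℕ) : Prop :=
  ¬S j ∧ (V j ∨ fp j = 0 ∨ S (fp j))

/-- The sizes `acc` of the groups, and the set `cl` of the full groups that have been succeeded by
another one. -/
structure Accounting (B N k : ℕ) (fp own : ℕ → ℕ) (V S : ℕ → Prop) [DecidablePred V]
    [DecidablePred S] (memb cur acc rt : ℕ → ℕ) (M : ℕ) (cl : Finset ℕ) : Prop where
  acc_eq : ∀ c, 1 ≤ c → c ≤ M → acc c = (if S (rt c) then 1 else 0) +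
    ∑ j ∈ (Icc 1 k).filter (fun j => IsCounted fp V S j ∧ memb j = c), own j
  acc_le : ∀ c, 1 ≤ c → c ≤ M → V (rt c) → acc c ≤ 2 * B
  cl_mem : ∀ c ∈ cl, 1 ≤ c ∧ c ≤ M
  cl_full : ∀ c ∈ cl, B < acc c ∧ V (rt c)
  cl_split : ∀ c ∈ cl, ∀ p, 1 ≤ p → p ≤ k → S p → cur p ≠ c
  cl_chain : ∀ c ∈ cl, ∀ u, 1 ≤ u → u ≤ k → V u → ¬S u → memb u = c →
    ∀ j, 1 ≤ j → j ≤ N → V j → fp j = u → j ≤ k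
  count : ((Icc 1 M).filter fun c => V (rt c)).card +
      ((Icc 1 k).filter fun p => S p ∧ cur p = 0).card ≤
    ((Icc 1 k).filter fun p => S p).card +
      2 * ((Icc 1 k).filter fun j => V j ∧ S (fp j)).card + cl.card

/-- One step of the grouping algorithm, for the index `k + 1`. -/
inductive GroupStep (B k : ℕ) (fp own : ℕ → ℕ) (V S : ℕ → Prop) (memb cur acc rt : ℕ → ℕ) (M : ℕ)
    (cl : Finset ℕ) : (ℕ → ℕ) → (ℕ → ℕ) → (ℕ → ℕ) → (ℕ → ℕ) → ℕ → Finset ℕ → Prop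
  | lightRoot : ¬V (k + 1) → fp (k + 1) = 0 →
      GroupStep B k fp own V S memb cur acc rt M cl (Function.update memb (k + 1) (M + 1)) cur
        (Function.update acc (M + 1) (own (k + 1))) (Function.update rt (M + 1) (k + 1)) (M + 1) cl
  | lightInherit : ¬V (k + 1) → fp (k + 1) ≠ 0 → ¬S (fp (k + 1)) →
      GroupStep B k fp own V S memb cur acc rt M cl
        (Function.update memb (k + 1) (memb (fp (k + 1)))) cur acc rt M cl
  | lightJoin : ¬V (k + 1) → S (fp (k + 1)) → cur (fp (k + 1)) ≠ 0 →
      acc (cur (fp (k + 1))) + own (k + 1) ≤ 2 * B →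
      GroupStep B k fp own V S memb cur acc rt M cl
        (Function.update memb (k + 1) (cur (fp (k + 1)))) cur
        (Function.update acc (cur (fp (k + 1))) (acc (cur (fp (k + 1))) + own (k + 1))) rt M cl
  | lightNew : ¬V (k + 1) → S (fp (k + 1)) →
      (cur (fp (k + 1)) ≠ 0 → 2 * B < acc (cur (fp (k + 1))) + own (k + 1)) →
      GroupStep B k fp own V S memb cur acc rt M cl (Function.update memb (k + 1) (M + 1))
        (Function.update cur (fp (k + 1)) (M + 1))
        (Function.update acc (M + 1) (own (k + 1) + 1)) (Function.update rt (M + 1) (fp (k + 1)))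
        (M + 1) (if cur (fp (k + 1)) = 0 then cl else insert (cur (fp (k + 1))) cl)
  | split : S (k + 1) →
      GroupStep B k fp own V S memb cur acc rt M cl (Function.update memb (k + 1) 0)
        (Function.update (Function.update cur (fp (k + 1)) 0) (k + 1) (M + 1))
        (Function.update acc (M + 1) 1) (Function.update rt (M + 1) (k + 1)) (M + 1) cl
  | chainJoin : V (k + 1) → ¬S (k + 1) → ¬S (fp (k + 1)) →
      acc (memb (fp (k + 1))) + own (k + 1) ≤ 2 * B →
      GroupStep B k fp own V S memb cur acc rt M cl
        (Function.update memb (k + 1) (memb (fp (k + 1)))) (Function.update cur (fp (k + 1)) 0)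
        (Function.update acc (memb (fp (k + 1))) (acc (memb (fp (k + 1))) + own (k + 1))) rt M cl
  | chainNew : V (k + 1) → ¬S (k + 1) →
      (¬S (fp (k + 1)) → 2 * B < acc (memb (fp (k + 1))) + own (k + 1)) →
      GroupStep B k fp own V S memb cur acc rt M cl (Function.update memb (k + 1) (M + 1))
        (Function.update cur (fp (k + 1)) 0)
        (Function.update acc (M + 1) (own (k + 1))) (Function.update rt (M + 1) (k + 1)) (M + 1)
        (@ite _ (S (fp (k + 1))) (Classical.dec _) cl (insert (memb (fp (k + 1))) cl))

variable {B N k M M' : ℕ} {fp own memb cur acc rt memb' cur' acc' rt' : ℕ → ℕ} {V S : ℕ → Prop}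
  {cl cl' : Finset ℕ}

theorem GroupStep.grouping (hF : SplitForest B N fp own V S)
    (h : Grouping N k fp V S memb cur rt M) (hk : k < N)
    (hs : GroupStep B k fp own V S memb cur acc rt M cl memb' cur' acc' rt' M' cl') :
    Grouping N (k + 1) fp V S memb' cur' rt' M' := by
  have hlt := hF.fp_lt (k + 1) (by omega) (by omega)
  have u1 : ∀ (g : ℕ → ℕ) (c j : ℕ), j ≤ k → Function.update g (k + 1) c j = g j :=
    fun g c j hj => Function.update_of_ne (by omega) _ _
  have u2 : ∀ (g : ℕ → ℕ) (c j : ℕ), 1 ≤ j → j ≤ M → Function.update g (M + 1) c j = g j :=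
    fun g c j _ hj => Function.update_of_ne (by omega) _ _
  have hpne : fp (k + 1) ≠ k + 1 := hlt.ne
  have hpp := hF.split_pos (fp (k + 1))
  have hSV := hF.split_heavy (k + 1)
  have hroot := hF.split_root (k + 1) (by omega) (by omega)
  have hcl := h.cur_le (fp (k + 1))
  have hrc := h.rt_cur (fp (k + 1))
  have hmp := h.memb_pos (fp (k + 1))
  have hml := h.memb_le (fp (k + 1)) (by omega)
  cases hs with
  | lightRoot hV h0 =>
    refine h.step hF hk (Or.inr rfl) (u1 _ _) (u2 _ _) (fun _ _ _ _ _ => rfl) ?_ ?_ ?_ ?_ ?_ ?_ ?_ ?_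
      ?_ ?_ ?_ <;> simp <;> grind
  | lightInherit hV h0 hS =>
    refine h.step hF hk (Or.inl rfl) (u1 _ _) (fun _ _ _ => rfl) (fun _ _ _ _ _ => rfl) ?_ ?_ ?_ ?_ ?_
      ?_ ?_ ?_ ?_ ?_ ?_ <;> simp <;> grind
  | lightJoin hV hS h0 hle =>
    refine h.step hF hk (Or.inl rfl) (u1 _ _) (fun _ _ _ => rfl) (fun _ _ _ _ _ => rfl) ?_ ?_ ?_ ?_ ?_
      ?_ ?_ ?_ ?_ ?_ ?_ <;> simp <;> grind
  | lightNew hV hS hf =>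
    refine h.step hF hk (Or.inr rfl) (u1 _ _) (u2 _ _)
      (fun j _ _ _ hj => Function.update_of_ne hj _ _) ?_ ?_ ?_ ?_ ?_
      ?_ ?_ ?_ ?_ ?_ ?_ <;> simp <;> grind
  | split hS =>
    refine h.step hF hk (Or.inr rfl) (u1 _ _) (u2 _ _)
      (fun j _ hj _ hj' => by rw [Function.update_of_ne (by omega), Function.update_of_ne hj'])
      ?_ ?_ ?_ ?_ ?_ ?_ ?_ ?_ ?_ ?_ ?_ <;> simp <;> grind
  | chainJoin hV hS hSp hle =>
    refine h.step hF hk (Or.inl rfl) (u1 _ _) (fun _ _ _ => rfl)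
      (fun j _ _ _ hj => Function.update_of_ne hj _ _) ?_ ?_ ?_ ?_ ?_
      ?_ ?_ ?_ ?_ ?_ ?_ <;> simp <;> grind
  | chainNew hV hS hf =>
    refine h.step hF hk (Or.inr rfl) (u1 _ _) (u2 _ _)
      (fun j _ _ _ hj => Function.update_of_ne hj _ _) ?_ ?_ ?_ ?_ ?_
      ?_ ?_ ?_ ?_ ?_ ?_ <;> simp <;> grind

namespace Accounting

variable [DecidablePred V] [DecidablePred S]

/-- The heavy children of the chain members of a closed group have all been processed, whereas `k +
1` is such a child of its parent and is still to come. -/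
theorem notMem_of_chain (hF : SplitForest B N fp own V S)
    (ha : Accounting B N k fp own V S memb cur acc rt M cl) (hk : k < N) (hV : V (k + 1))
    (hS : ¬S (k + 1)) (hSp : ¬S (fp (k + 1))) : memb (fp (k + 1)) ∉ cl := by
  intro hc
  have hlt := hF.fp_lt (k + 1) (by omega) (by omega)
  have hp0 : fp (k + 1) ≠ 0 := fun hc => hS (hF.split_root _ (by omega) (by omega) hV hc)
  have := ha.cl_chain _ hc (fp (k + 1)) (by omega) (by omega)
    (hF.heavy_parent _ (by omega) (by omega) hV hp0) hSp rfl (k + 1) (by omega) (by omega) hV rfl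
  omega

/-- The invariant `count` is a potential argument. Groups with heavy roots and interrupted split
indices (those with `cur p = 0`) are paid for by split indices, twice by heavy children of split
indices, and by closed groups; `hcount` is the balance of one step. A group `c₀` is closed only when
`M + 1` succeeds it, as current group of the split parent or as continuation of the parent's chain.
-/
theorem step (hF : SplitForest B N fp own V S) (h : Grouping N k fp V S memb cur rt M)
    (ha : Accounting B N k fp own V S memb cur acc rt M cl) (hk : k < N)
    (hM : M' = M ∨ M' = M + 1) (hm : ∀ j, j ≤ k → memb' j = memb j)
    (hrt : ∀ c, 1 ≤ c → c ≤ M → rt' c = rt c)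
    (hacc : ∀ c, 1 ≤ c → c ≤ M →
      acc' c = acc c + if IsCounted fp V S (k + 1) ∧ memb' (k + 1) = c then own (k + 1) else 0)
    (hnew : M' = M + 1 → acc' (M + 1) = (if S (rt' (M + 1)) then 1 else 0) +
      if IsCounted fp V S (k + 1) ∧ memb' (k + 1) = M + 1 then own (k + 1) else 0)
    (hle : ∀ c, 1 ≤ c → c ≤ M' → V (rt' c) → (c ≤ M ∧ acc' c = acc c) ∨ acc' c ≤ 2 * B)
    (hcl : cl' = cl ∨ ∃ c₀, cl' = insert c₀ cl ∧ 1 ≤ c₀ ∧ c₀ ≤ M ∧ B < acc c₀ ∧ V (rt c₀) ∧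
      ((S (fp (k + 1)) ∧ cur (fp (k + 1)) = c₀ ∧ cur' (fp (k + 1)) = M + 1 ∧ ¬V (k + 1)) ∨
        (V (k + 1) ∧ ¬S (k + 1) ∧ ¬S (fp (k + 1)) ∧ memb (fp (k + 1)) = c₀ ∧
          memb' (k + 1) = M + 1)))
    (hcur : ∀ j, 1 ≤ j → j ≤ k → S j → cur' j = cur j ∨ cur' j = 0 ∨ cur' j = M + 1)
    (q_split : S (k + 1) → cur' (k + 1) = M + 1)
    (q_chain : V (k + 1) → ¬S (k + 1) →
      memb' (k + 1) = M + 1 ∨ (¬S (fp (k + 1)) ∧ memb' (k + 1) = memb (fp (k + 1))))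
    (hcount : (if M' = M + 1 ∧ V (rt' (M + 1)) then 1 else 0) +
        ((Icc 1 (k + 1)).filter fun p => S p ∧ cur' p = 0).card + cl.card ≤
      ((Icc 1 k).filter fun p => S p ∧ cur p = 0).card + (if S (k + 1) then 1 else 0) +
        2 * (if V (k + 1) ∧ S (fp (k + 1)) then 1 else 0) + cl'.card) :
    Accounting B N (k + 1) fp own V S memb' cur' acc' rt' M' cl' := by
  have hlt := hF.fp_lt (k + 1) (by omega) (by omega)
  have hcase : ∀ j, j ≤ k + 1 → j ≤ k ∨ j = k + 1 := fun j hj => by omega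
  have hcaseM : ∀ c, c ≤ M' → c ≤ M ∨ (c = M + 1 ∧ M' = M + 1) := fun c hc => by omega
  have hMM : M ≤ M' := by omega
  have hmono : ∀ c, 1 ≤ c → c ≤ M → acc c ≤ acc' c := fun c h1 h2 => by
    rw [hacc c h1 h2]; omega
  refine ⟨?_, ?_, ?_, ?_, ?_, ?_, ?_⟩
  · intro c h1 h2
    have hsum : ∑ j ∈ (Icc 1 k).filter (fun j => IsCounted fp V S j ∧ memb' j = c), own j =
        ∑ j ∈ (Icc 1 k).filter (fun j => IsCounted fp V S j ∧ memb j = c), own j := by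
      refine sum_congr (filter_congr fun j hj => ?_) fun _ _ => rfl
      rw [hm j (mem_Icc.1 hj).2]
    rw [sum_filter_Icc_succ, hsum]
    rcases hcaseM c h2 with h2 | ⟨rfl, hM1⟩
    · rw [hacc c h1 h2, ha.acc_eq c h1 h2, hrt c h1 h2]; ring
    · rw [hnew hM1, filter_eq_empty_iff.2 (fun j hj hc => by
        have := h.memb_le j (mem_Icc.1 hj).2; omega)]
      simp
  · intro c h1 h2 hV
    rcases hle c h1 h2 hV with ⟨e1, e2⟩ | e
    · rw [hrt c h1 e1] at hV
      rw [e2]; exact ha.acc_le c h1 e1 hV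
    · exact e
  · intro c hc
    rcases hcl with rfl | ⟨c₀, rfl, d1, d2, -⟩
    · have := ha.cl_mem c hc; omega
    · rcases mem_insert.1 hc with rfl | hc
      · omega
      · have := ha.cl_mem c hc; omega
  · have old : ∀ c ∈ cl, B < acc' c ∧ V (rt' c) := by
      intro c hc
      obtain ⟨m1, m2⟩ := ha.cl_mem c hc
      have := hmono c m1 m2
      have g := ha.cl_full c hc
      rw [hrt c m1 m2]
      exact ⟨by omega, g.2⟩
    intro c hc
    rcases hcl with rfl | ⟨c₀, rfl, d1, d2, d3, d4, -⟩
    · exact old c hc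
    · rcases mem_insert.1 hc with rfl | hc
      · have := hmono c d1 d2
        rw [hrt c d1 d2]
        exact ⟨by omega, d4⟩
      · exact old c hc
  · have old : ∀ c ∈ cl, ∀ p, 1 ≤ p → p ≤ k + 1 → S p → cur' p ≠ c := by
      intro c hc p h1 h2 hS
      have g := ha.cl_mem c hc
      rcases hcase p h2 with h2 | rfl
      · have := ha.cl_split c hc p h1 h2 hS
        rcases hcur p h1 h2 hS with e | e | e <;> omega
      · rw [q_split hS]; omega
    intro c hc p h1 h2 hS
    rcases hcl with rfl | ⟨c₀, rfl, d1, d2, d3, d4, d5⟩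
    · exact old c hc p h1 h2 hS
    · rcases mem_insert.1 hc with rfl | hc
      · rcases hcase p h2 with h2 | rfl
        · rcases hcur p h1 h2 hS with e | e | e
          -- If the group closed now were current at `p`, its root would be the split index `p`. In
          -- the first case `p` is then the parent, which has just got the current group `M + 1`; in
          -- the second case the root of a chain group is not split.
          · intro he
            have hrp := h.rt_cur p h1 h2 hS (by omega)
            rw [← e, he] at hrp
            rcases d5 with ⟨g1, g2, g3, g4⟩ | ⟨g1, g2, g3, g4, g5⟩
            · have := h.rt_cur (fp (k + 1)) (hF.split_pos _ g1) (by omega) g1 (by omega)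
              rw [g2, hrp] at this
              rw [← this] at g3; omega
            · have hp0 : fp (k + 1) ≠ 0 := fun hc =>
                g2 (hF.split_root _ (by omega) (by omega) g1 hc)
              have := h.chain_rt (fp (k + 1)) (by omega) (by omega)
                (hF.heavy_parent _ (by omega) (by omega) g1 hp0) g3
              rw [g4, hrp] at this
              exact this.2 hS
          · omega
          · omega
        · rw [q_split hS]; omega
      · exact old c hc p h1 h2 hS
  · have old : ∀ c ∈ cl, ∀ u, 1 ≤ u → u ≤ k + 1 → V u → ¬S u → memb' u = c →
        ∀ j, 1 ≤ j → j ≤ N → V j → fp j = u → j ≤ k + 1 := by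
      intro c hc u h1 h2 hV hS hu j h3 h4 h5 h6
      rcases hcase u h2 with h2 | rfl
      · rw [hm u h2] at hu
        have := ha.cl_chain c hc u h1 h2 hV hS hu j h3 h4 h5 h6; omega
      · have g := ha.cl_mem c hc
        rcases q_chain hV hS with e | ⟨e1, e2⟩
        · omega
        · have := ha.notMem_of_chain hF hk hV hS e1
          rw [← e2, hu] at this
          exact absurd hc this
    intro c hc u h1 h2 hV hS hu j h3 h4 h5 h6
    rcases hcl with rfl | ⟨c₀, rfl, d1, d2, d3, d4, d5⟩
    · exact old c hc u h1 h2 hV hS hu j h3 h4 h5 h6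
    · rcases mem_insert.1 hc with rfl | hc
      · rcases d5 with ⟨g1, g2, g3, g4⟩ | ⟨g1, g2, g3, g4, g5⟩
        · rcases hcase u h2 with h2 | rfl
          · rw [hm u h2] at hu
            have := h.chain_rt u h1 h2 hV hS
            rw [hu, ← g2, h.rt_cur (fp (k + 1)) (hF.split_pos _ g1) (by omega) g1 (by omega)] at this
            exact absurd g1 this.2
          · exact absurd hV g4
        · have hp0 : fp (k + 1) ≠ 0 := fun hc =>
            g2 (hF.split_root _ (by omega) (by omega) g1 hc)
          have hVp := hF.heavy_parent _ (by omega) (by omega) g1 hp0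
          rcases hcase u h2 with h2 | rfl
          · rw [hm u h2] at hu
            -- A chain member before the parent has its heavy child in the closed group already, and
            -- the heavy child of the parent is `k + 1`. A chain member after the parent would force
            -- `k + 1 ≤ u`.
            rcases lt_trichotomy u (fp (k + 1)) with g | g | g
            · have := h.heavy_child_le hF hk.le h1 g (by omega) hV hS hVp g3 (hu.trans g4.symm)
                h3 h4 h5 h6
              omega
            · have := hF.chain_unique j (k + 1) h3 h4 (by omega) (by omega) h5 g1 (h6.trans g)
                (by omega) (by rwa [h6])
              omega
            · have := h.heavy_child_le hF hk.le (by omega) g h2 hVp g3 hV hS (g4.trans hu.symm)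
                (j := k + 1) (by omega) (by omega) g1 rfl
              omega
          · omega
      · exact old c hc u h1 h2 hV hS hu j h3 h4 h5 h6
  · have hc := ha.count
    rw [card_filter_Icc_succ k (fun p => S p), card_filter_Icc_succ k (fun j => V j ∧ S (fp j))]
    have hfat : ((Icc 1 M').filter fun c => V (rt' c)).card =
        ((Icc 1 M).filter fun c => V (rt c)).card +
          if M' = M + 1 ∧ V (rt' (M + 1)) then 1 else 0 := by
      have e : ((Icc 1 M).filter fun c => V (rt' c)) = ((Icc 1 M).filter fun c => V (rt c)) :=
        filter_congr fun c hc => by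
          rw [mem_Icc] at hc
          rw [hrt c hc.1 hc.2]
      rcases hM with rfl | rfl
      · rw [e, if_neg (by omega)]; rfl
      · rw [card_filter_Icc_succ, e]; simp
    rw [hfat]
    omega

/-- Only the parent can become interrupted in one step. -/
theorem card_zero_le (hq : S (k + 1) → cur' (k + 1) ≠ 0)
    (hc : ∀ j, 1 ≤ j → j ≤ k → S j → j ≠ fp (k + 1) → cur' j = cur j) :
    ((Icc 1 (k + 1)).filter fun p => S p ∧ cur' p = 0).card ≤
      ((Icc 1 k).filter fun p => S p ∧ cur p = 0).card + if S (fp (k + 1)) then 1 else 0 := by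
  have key : ∀ j ∈ (Icc 1 (k + 1)).filter (fun p => S p ∧ cur' p = 0), j ≠ fp (k + 1) →
      j ∈ (Icc 1 k).filter fun p => S p ∧ cur p = 0 := by
    intro j hj hne
    simp only [mem_filter, mem_Icc] at hj ⊢
    have hjk : j ≠ k + 1 := by rintro rfl; exact hq hj.2.1 hj.2.2
    exact ⟨by omega, hj.2.1, by rw [← hc j hj.1.1 (by omega) hj.2.1 hne]; exact hj.2.2⟩
  split_ifs with hS
  · refine (card_le_card (t := insert (fp (k + 1)) _) fun j hj => ?_).trans (card_insert_le _ _)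
    by_cases hne : j = fp (k + 1)
    · exact mem_insert.2 (Or.inl hne)
    · exact mem_insert.2 (Or.inr (key j hj hne))
  · refine card_le_card fun j hj => key j hj ?_
    rintro rfl
    exact hS (mem_filter.1 hj).2.1

/-- When an interrupted parent gets a new group, it leaves the set of interrupted indices, and this
pays for the group. -/
theorem card_zero_add_le (hq : S (k + 1) → cur' (k + 1) ≠ 0) (hS : S (fp (k + 1)))
    (hp : 1 ≤ fp (k + 1)) (hlt : fp (k + 1) ≤ k)
    (hc : ∀ j, 1 ≤ j → j ≤ k → S j → j ≠ fp (k + 1) → cur' j = cur j)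
    (hne : cur' (fp (k + 1)) ≠ 0) :
    ((Icc 1 (k + 1)).filter fun p => S p ∧ cur' p = 0).card +
        (if cur (fp (k + 1)) = 0 then 1 else 0) ≤
      ((Icc 1 k).filter fun p => S p ∧ cur p = 0).card := by
  have key : ∀ j ∈ (Icc 1 (k + 1)).filter (fun p => S p ∧ cur' p = 0), j ≠ fp (k + 1) ∧
      j ∈ (Icc 1 k).filter fun p => S p ∧ cur p = 0 := by
    intro j hj
    simp only [mem_filter, mem_Icc] at hj ⊢
    have hjk : j ≠ k + 1 := by rintro rfl; exact hq hj.2.1 hj.2.2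
    have hjp : j ≠ fp (k + 1) := by rintro rfl; exact hne hj.2.2
    exact ⟨hjp, by omega, hj.2.1, by rw [← hc j hj.1.1 (by omega) hj.2.1 hjp]; exact hj.2.2⟩
  split_ifs with h0
  · rw [← card_erase_add_one (s := (Icc 1 k).filter fun p => S p ∧ cur p = 0) (a := fp (k + 1))
      (by simp only [mem_filter, mem_Icc]; exact ⟨⟨hp, hlt⟩, hS, h0⟩)]
    exact Nat.add_le_add_right (card_le_card fun j hj => mem_erase.2 (key j hj)) _
  · exact card_le_card fun j hj => (key j hj).2

end Accounting

/-- A group is closed only if the next own size, at most `B`, would push it above `2 * B`; so its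
size exceeds `B`. By `cl_split` and `cl_chain` it was not closed before, hence `cl` grows by one and
pays for the successor. A new group at a light child has size at most `B + 1`, which needs `1 ≤ B`.
-/
theorem GroupStep.accounting [DecidablePred V] [DecidablePred S]
    (hF : SplitForest B N fp own V S)
    (h : Grouping N k fp V S memb cur rt M)
    (ha : Accounting B N k fp own V S memb cur acc rt M cl) (hk : k < N)
    (hB : 1 ≤ B)
    (hs : GroupStep B k fp own V S memb cur acc rt M cl memb' cur' acc' rt' M' cl') :
    Accounting B N (k + 1) fp own V S memb' cur' acc' rt' M' cl' := by
  have hlt := hF.fp_lt (k + 1) (by omega) (by omega)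
  have u1 : ∀ (g : ℕ → ℕ) (c j : ℕ), j ≤ k → Function.update g (k + 1) c j = g j :=
    fun g c j hj => Function.update_of_ne (by omega) _ _
  have u2 : ∀ (g : ℕ → ℕ) (c j : ℕ), 1 ≤ j → j ≤ M → Function.update g (M + 1) c j = g j :=
    fun g c j _ hj => Function.update_of_ne (by omega) _ _
  have hpne : fp (k + 1) ≠ k + 1 := hlt.ne
  have hpp := hF.split_pos (fp (k + 1))
  have hSV := hF.split_heavy (k + 1)
  have hSVp := hF.split_heavy (fp (k + 1))
  have hroot := hF.split_root (k + 1) (by omega) (by omega)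
  have hVp := hF.heavy_parent (k + 1) (by omega) (by omega)
  have hcl := h.cur_le (fp (k + 1))
  have hrc := h.rt_cur (fp (k + 1))
  have hmp := h.memb_pos (fp (k + 1))
  have hml := h.memb_le (fp (k + 1)) (by omega)
  have hmr := h.chain_rt (fp (k + 1))
  have hown := hF.own_le (k + 1) (by omega) (by omega)
  cases hs with
  | lightRoot hV h0 =>
    have hz := Accounting.card_zero_le (k := k) (fp := fp) (S := S) (cur := cur) (cur' := cur)
      (fun hc => absurd (hSV hc) hV) (fun _ _ _ _ _ => rfl)
    refine ha.step hF h hk (Or.inr rfl) (u1 _ _) (u2 _ _) ?_ ?_ ?_ (Or.inl rfl) ?_ ?_ ?_ ?_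
    · intro c h1 h2; rw [u2 _ _ c h1 h2]; grind
    · simp; grind
    · intro c h1 h2; grind
    · simp
    · grind
    · grind
    · simp; grind
  | lightInherit hV h0 hS =>
    have hz := Accounting.card_zero_le (k := k) (fp := fp) (S := S) (cur := cur) (cur' := cur)
      (fun hc => absurd (hSV hc) hV) (fun _ _ _ _ _ => rfl)
    refine ha.step hF h hk (Or.inl rfl) (u1 _ _) (fun _ _ _ => rfl) ?_ ?_ ?_ (Or.inl rfl) ?_ ?_ ?_ ?_
    · intro c h1 h2; grind
    · simp
    · intro c h1 h2; simp; grind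
    · simp
    · grind
    · grind
    · simp; grind
  | lightJoin hV hS h0 hle =>
    have hz : ((Icc 1 (k + 1)).filter fun p => S p ∧ cur p = 0).card =
        ((Icc 1 k).filter fun p => S p ∧ cur p = 0).card := by
      rw [card_filter_Icc_succ, if_neg (fun hc => hV (hSV hc.1))]; rfl
    refine ha.step hF h hk (Or.inl rfl) (u1 _ _) (fun _ _ _ => rfl) ?_ ?_ ?_ (Or.inl rfl) ?_ ?_ ?_ ?_
    · intro c h1 h2; simp [Function.update_apply]; grind
    · simp
    · intro c h1 h2; simp [Function.update_apply]; grind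
    · simp
    · grind
    · grind
    · simp; grind
  | lightNew hV hS hf =>
    have hz := Accounting.card_zero_add_le (k := k) (fp := fp) (S := S) (cur := cur)
      (cur' := Function.update cur (fp (k + 1)) (M + 1)) (fun hc => absurd (hSV hc) hV) hS (hpp hS)
      (by omega) (fun j _ _ _ hj => Function.update_of_ne hj _ _) (by simp)
    have hnm : cur (fp (k + 1)) ∉ cl := fun hc =>
      ha.cl_split _ hc (fp (k + 1)) (hpp hS) (by omega) hS rfl
    refine ha.step hF h hk (Or.inr rfl) (u1 _ _) (u2 _ _) ?_ ?_ ?_ ?_ ?_ ?_ ?_ ?_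
    · intro c h1 h2; rw [u2 _ _ c h1 h2]; grind
    · simp [hS]; grind
    · intro c h1 h2; simp [Function.update_apply]; grind
    · by_cases h0 : cur (fp (k + 1)) = 0
      · exact Or.inl (if_pos h0)
      · refine Or.inr ⟨_, if_neg h0, ?_⟩
        simp; grind
    · intro j; simp [Function.update_apply]; grind
    · grind
    · grind
    · by_cases h0 : cur (fp (k + 1)) = 0
      · simp only [h0, if_true] at hz ⊢; simp; grind
      · simp only [h0, if_false] at hz ⊢
        rw [card_insert_of_notMem hnm]; simp; grind
  | split hS =>
    have hz := Accounting.card_zero_le (k := k) (fp := fp) (S := S) (cur := cur)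
      (cur' := Function.update (Function.update cur (fp (k + 1)) 0) (k + 1) (M + 1))
      (by simp) (fun j _ hj _ hj' => by
        rw [Function.update_of_ne (by omega), Function.update_of_ne hj'])
    refine ha.step hF h hk (Or.inr rfl) (u1 _ _) (u2 _ _) ?_ ?_ ?_ (Or.inl rfl) ?_ ?_ ?_ ?_
    · intro c h1 h2; rw [u2 _ _ c h1 h2]; grind
    · simp [hS]
    · intro c h1 h2; simp [Function.update_apply]; grind
    · intro j; simp [Function.update_apply]; grind
    · simp
    · grind
    · simp only [hS, hSV hS, Function.update_self, true_and, if_true]; grind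
  | chainJoin hV hS hSp hle =>
    have hz := Accounting.card_zero_le (k := k) (fp := fp) (S := S) (cur := cur)
      (cur' := Function.update cur (fp (k + 1)) 0)
      (fun hc => absurd hc hS) (fun j _ hj _ hj' => Function.update_of_ne hj' _ _)
    refine ha.step hF h hk (Or.inl rfl) (u1 _ _) (fun _ _ _ => rfl) ?_ ?_ ?_ (Or.inl rfl) ?_ ?_ ?_ ?_
    · intro c h1 h2; simp [Function.update_apply]; grind
    · simp
    · intro c h1 h2; simp [Function.update_apply]; grind
    · intro j; simp [Function.update_apply]; grind
    · grind
    · simp [hSp]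
    · simp only [hSp, if_false] at hz; simp; grind
  | chainNew hV hS hf =>
    have hz := Accounting.card_zero_le (k := k) (fp := fp) (S := S) (cur := cur)
      (cur' := Function.update cur (fp (k + 1)) 0)
      (fun hc => absurd hc hS) (fun j _ hj _ hj' => Function.update_of_ne hj' _ _)
    refine ha.step hF h hk (Or.inr rfl) (u1 _ _) (u2 _ _) ?_ ?_ ?_ ?_ ?_ ?_ ?_ ?_
    · intro c h1 h2; rw [u2 _ _ c h1 h2]; grind
    · simp [hS, hV]
    · intro c h1 h2; simp [Function.update_apply]; grind
    · by_cases h0 : S (fp (k + 1))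
      · exact Or.inl (if_pos h0)
      · refine Or.inr ⟨_, if_neg h0, ?_⟩
        simp; grind
    · intro j; simp [Function.update_apply]; grind
    · grind
    · simp
    · by_cases h0 : S (fp (k + 1))
      · simp only [h0, if_true] at hz ⊢; simp [hV]; grind
      · have hnm := ha.notMem_of_chain hF hk hV hS h0
        simp only [h0, if_false] at hz ⊢
        rw [card_insert_of_notMem hnm]; simp [hV, hS]; grind

end

/-! ### The pass that forms the groups -/

section

open Finset

/-- The heavy indices that become roots of groups that share a root. -/
abbrev IsSplit (B : ℕ) (fp sz own hv : ℕ → ℕ) (k : ℕ) : Prop :=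
  1 ≤ k ∧ B < sz k ∧ (fp k = 0 ∨ hv k ≠ 1 ∨ B < own k)

theorem PartialWeights.sz_le_parent {B N : ℕ} {fp wt sz own hv : ℕ → ℕ}
    (h : PartialWeights B N 0 fp wt sz own hv) {k : ℕ} (h1 : 1 ≤ k) (h2 : k ≤ N) :
    sz k ≤ sz (fp k) := by
  rw [h.sz_eq (fp k)]
  have : sz k ≤ ∑ j ∈ (Ioc 0 N).filter (fun j => fp j = fp k), sz j :=
    single_le_sum (f := sz) (fun _ _ => Nat.zero_le _) (by simp; omega)
  omega

/-- By the choice of `IsSplit`, a heavy index that is not split has a parent, exactly one heavy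
child, and own size at most `B`. For a light index the own size is bounded by the size. -/
theorem PartialWeights.splitForest {B N : ℕ} {fp wt sz own hv : ℕ → ℕ}
    (h : PartialWeights B N 0 fp wt sz own hv) (hfp : ∀ k, 1 ≤ k → k ≤ N → fp k < k) :
    SplitForest B N fp own (fun k => B < sz k) (IsSplit B fp sz own hv) where
  fp_lt := hfp
  heavy_parent k h1 h2 hV _ := hV.trans_le (h.sz_le_parent h1 h2)
  split_pos k hS := hS.1
  split_heavy k hS := hS.2.1
  split_root k h1 _ hV h0 := ⟨h1, hV, Or.inl h0⟩
  chain_unique j j' h1 h2 h1' h2' hV hV' he h0 hS := by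
    have hVp : B < sz (fp j) := hV.trans_le (h.sz_le_parent h1 h2)
    have h1v : hv (fp j) = 1 := by
      by_contra hc
      exact hS ⟨Nat.one_le_iff_ne_zero.2 h0, hVp, Or.inr (Or.inl hc)⟩
    rw [h.hv_eq] at h1v
    exact card_le_one.1 h1v.le j (by simp; omega) j' (by simp; omega)
  own_le k h1 h2 hS := by
    by_cases hV : B < sz k
    · by_contra hc
      exact hS ⟨h1, hV, Or.inr (Or.inr (not_le.1 hc))⟩
    · exact (h.own_le k).trans (not_lt.1 hV)

namespace WordRAM

open HExpr HProg

set_option linter.unusedSimpArgs false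

/-- Creates a group with the given root and size. -/
def newGroup (r a : HExpr) : HProg :=
  .seq (put .num zero (add (var .num) one)) (.seq (put .rt (var .num) r) (put .acc (var .num) a))

/-- Adds the current index to a group. -/
def joinGroup (c : HExpr) : HProg :=
  .seq (put .acc c (add (get .acc c) (get .own ctr))) (put .memb ctr c)

/-- Does `p` when the current index does not fit into a group, and `q` otherwise. -/
def ifFull (c : HExpr) (p q : HProg) : HProg :=
  .ite (.eq c zero) p
    (.ite (.lt (add (var .bb) (var .bb)) (add (get .acc c) (get .own ctr))) p q)

/-- Treats a light index. -/
def lightBody : HProg :=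
  .ite (.eq (get .fp ctr) zero)
    (.seq (newGroup ctr (get .own ctr)) (put .memb ctr (var .num)))
    (.ite (.eq (get .memb (get .fp ctr)) zero)
      (ifFull (get .cur (get .fp ctr))
        (.seq (newGroup (get .fp ctr) (add (get .own ctr) one))
          (.seq (put .memb ctr (var .num)) (put .cur (get .fp ctr) (var .num))))
        (joinGroup (get .cur (get .fp ctr))))
      (put .memb ctr (get .memb (get .fp ctr))))

/-- Treats a split index. -/
def splitBody : HProg :=
  .seq (put .memb ctr zero) (.seq (newGroup ctr one) (put .cur ctr (var .num)))

/-- Treats a heavy index that is not split. -/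
def chainBody : HProg :=
  ifFull (get .memb (get .fp ctr))
    (.seq (newGroup ctr (get .own ctr)) (put .memb ctr (var .num)))
    (joinGroup (get .memb (get .fp ctr)))

/-- Distributes the indices to groups. -/
def groupPhase : Phase where
  lim := .tot
  body :=
    .ite (.lt (var .bb) (get .sz ctr))
      (.seq (put .cur (get .fp ctr) zero)
        (.ite (.eq (get .fp ctr) zero) splitBody
          (.ite (.eq (get .hv ctr) one)
            (.ite (.lt (var .bb) (get .own ctr)) splitBody chainBody) splitBody)))
      lightBody

-- Each branch of the program realizes one constructor of `GroupStep`. The program recognizes a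
-- split parent by its entry `0` in `memb`.
set_option maxHeartbeats 1000000 in
theorem groupPhase_step {K B N k : ℕ} {A : Arrays} {wt : ℕ → ℕ} {cl : Finset ℕ}
    (hK : 2 * B + N + 2 ≤ K) (hB : 1 ≤ B) (hbb : A .bb 0 = B) (hk : k < N)
    (hfp : ∀ k, 1 ≤ k → k ≤ N → A .fp k < k) (hwt : ∀ x, wt x ≤ 1)
    (hW : PartialWeights B N 0 (A .fp) wt (A .sz) (A .own) (A .hv))
    (h : Grouping N k (A .fp) (fun k => B < A .sz k) (IsSplit B (A .fp) (A .sz) (A .own) (A .hv))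
      (A .memb) (A .cur) (A .rt) (A .num 0))
    (ha : Accounting B N k (A .fp) (A .own) (fun k => B < A .sz k)
      (IsSplit B (A .fp) (A .sz) (A .own) (A .hv)) (A .memb) (A .cur) (A .acc) (A .rt) (A .num 0) cl)
    {A' : Arrays} (hA' : A' = groupPhase.body.run K (k + 1) A) :
    ∃ cl', GroupStep B k (A .fp) (A .own) (fun k => B < A .sz k)
      (IsSplit B (A .fp) (A .sz) (A .own) (A .hv)) (A .memb) (A .cur) (A .acc) (A .rt) (A .num 0) cl
      (A' .memb) (A' .cur) (A' .acc) (A' .rt) (A' .num 0) cl' := by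
  have hF := hW.splitForest hfp
  have hlt := hfp (k + 1) (by omega) (by omega)
  have hnum := h.num_le
  have hroot := hF.split_root (k + 1) (by omega) (by omega)
  have hVp := hF.heavy_parent (k + 1) (by omega) (by omega)
  have hmemb : A .fp (k + 1) ≠ 0 → (A .memb (A .fp (k + 1)) = 0 ↔
      IsSplit B (A .fp) (A .sz) (A .own) (A .hv) (A .fp (k + 1))) := by
    intro h0
    constructor
    · intro h1
      by_contra hc
      have := h.memb_pos _ (by omega) (by omega) hc
      omega
    · exact h.memb_split _ (by omega) (by omega)
  -- Sizes do not decrease towards the roots, and cell `0` collects the total weight. With the bound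
  -- `2 * B` on the sizes of groups, all sums stay below the cap.
  have hown : A .own (k + 1) ≤ N := by
    have h1 := hW.own_le (k + 1)
    have h2 := hW.sz_eq 0
    have h3 := hW.sum_sz (Nat.zero_le _) hfp
    have h4 : A .sz (k + 1) ≤ A .sz 0 := by
      have key : ∀ j, 1 ≤ j → j ≤ N → A .sz j ≤ A .sz 0 := by
        intro j
        induction j using Nat.strong_induction_on with
        | _ j ih =>
          intro j1 j2
          have e1 := hW.sz_le_parent j1 j2
          have e2 := hfp j j1 j2
          rcases Nat.eq_zero_or_pos (A .fp j) with h0 | h0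
          · rwa [h0] at e1
          · exact e1.trans (ih _ e2 h0 (by omega))
      exact key _ (by omega) (by omega)
    have h5 := hW.sz_le (Nat.zero_le _) hfp hwt (le_refl 0)
    omega
  have c1 : capAdd K (A .num 0) 1 = A .num 0 + 1 := capAdd_eq (by omega)
  have c2 : capAdd K B B = 2 * B := by rw [capAdd_eq (by omega)]; ring
  have c3 : capAdd K (A .own (k + 1)) 1 = A .own (k + 1) + 1 := capAdd_eq (by omega)
  have hne : A .fp (k + 1) ≠ k + 1 := hlt.ne
  by_cases hV : B < A .sz (k + 1)
  · by_cases hS : IsSplit B (A .fp) (A .sz) (A .own) (A .hv) (k + 1)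
    · refine ⟨cl, ?_⟩
      have hgs := GroupStep.split (B := B) (fp := A .fp) (own := A .own) (V := fun k => B < A .sz k)
        (memb := A .memb) (cur := A .cur) (acc := A .acc) (rt := A .rt) (M := A .num 0) (cl := cl) hS
      have hrun : groupPhase.body.run K (k + 1) A =
          splitBody.run K (k + 1) (A.set .cur (A .fp (k + 1)) 0) := by
        simp only [groupPhase, run_seq, run_ite_eq, run_ite_lt, run_put, eval_zero, eval_one,
          eval_ctr, eval_get, hbb, hV, if_true]
        obtain ⟨-, -, h0⟩ := hS
        have e : ∀ a : Arr, a ≠ .cur → (A.set .cur (A .fp (k + 1)) 0) a = A a :=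
          fun a ha => Arrays.set_of_ne A ha _ _
        simp only [e .fp (by decide), e .hv (by decide), e .bb (by decide), e .own (by decide), hbb]
        split_ifs <;> first | rfl | (exfalso; omega)
      rw [hrun] at hA'
      simp only [splitBody, newGroup, run_seq, run_put, eval_zero, eval_one, eval_ctr, eval_get,
        eval_add, Arrays.set, Function.update_self, ne_eq, reduceCtorEq, not_false_eq_true,
        Function.update_of_ne, c1] at hA'
      subst hA'
      simpa using hgs
    · have h0 : A .fp (k + 1) ≠ 0 := fun hc => hS (hroot hV hc)
      have hVp' := hVp hV h0
      have hrun : groupPhase.body.run K (k + 1) A =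
          chainBody.run K (k + 1) (A.set .cur (A .fp (k + 1)) 0) := by
        simp only [groupPhase, run_seq, run_ite_eq, run_ite_lt, run_put, eval_zero, eval_one,
          eval_ctr, eval_get, hbb, hV, if_true]
        have e : ∀ a : Arr, a ≠ .cur → (A.set .cur (A .fp (k + 1)) 0) a = A a :=
          fun a ha => Arrays.set_of_ne A ha _ _
        simp only [e .fp (by decide), e .hv (by decide), e .bb (by decide), e .own (by decide), hbb]
        rw [if_neg h0, if_pos (by by_contra hc; exact hS ⟨by omega, hV, Or.inr (Or.inl hc)⟩),
          if_neg (fun hc => hS ⟨by omega, hV, Or.inr (Or.inr hc)⟩)]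
      rw [hrun] at hA'
      have hnew : (A .memb (A .fp (k + 1)) = 0 ∨
          2 * B < A .acc (A .memb (A .fp (k + 1))) + A .own (k + 1)) ∨
          (¬IsSplit B (A .fp) (A .sz) (A .own) (A .hv) (A .fp (k + 1)) ∧
            A .acc (A .memb (A .fp (k + 1))) + A .own (k + 1) ≤ 2 * B) := by
        rw [hmemb h0, ← not_lt]; tauto
      have c4 : A .memb (A .fp (k + 1)) ≠ 0 →
          capAdd K (A .acc (A .memb (A .fp (k + 1)))) (A .own (k + 1)) =
            A .acc (A .memb (A .fp (k + 1))) + A .own (k + 1) := by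
        intro hm0
        have hSp := mt (hmemb h0).2 hm0
        have := (h.chain_rt _ (by omega) (by omega) hVp' hSp).1
        have := ha.acc_le _ (by omega) (h.memb_le _ (by omega)) this
        exact capAdd_eq (by omega)
      rcases hnew with hn | ⟨hSp, hle⟩
      · obtain ⟨cl', hgs⟩ : ∃ cl', GroupStep B k (A .fp) (A .own) (fun k => B < A .sz k)
            (IsSplit B (A .fp) (A .sz) (A .own) (A .hv)) (A .memb) (A .cur) (A .acc) (A .rt)
            (A .num 0) cl _ _ _ _ _ cl' :=
          ⟨_, GroupStep.chainNew hV hS (fun hSp => hn.resolve_left (mt (hmemb h0).1 hSp))⟩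
        refine ⟨cl', ?_⟩
        have hrun2 : chainBody.run K (k + 1) (A.set .cur (A .fp (k + 1)) 0) =
            ((newGroup ctr (get .own ctr)).seq (put .memb ctr (var .num))).run K (k + 1)
              (A.set .cur (A .fp (k + 1)) 0) := by
          simp only [chainBody, ifFull, run_ite_eq, run_ite_lt, eval_zero, eval_ctr, eval_get,
            eval_add, Arrays.set, ne_eq, reduceCtorEq, not_false_eq_true, Function.update_of_ne, hbb,
            c2]
          by_cases hm0 : A .memb (A .fp (k + 1)) = 0
          · rw [if_pos hm0]
          · rw [if_neg hm0, c4 hm0, if_pos (hn.resolve_left hm0)]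
        rw [hrun2] at hA'
        simp only [newGroup, run_seq, run_put, eval_zero, eval_one, eval_ctr, eval_get,
          eval_add, Arrays.set, Function.update_self, ne_eq, reduceCtorEq, not_false_eq_true,
          Function.update_of_ne, c1] at hA'
        subst hA'
        simpa using hgs
      · have hm0 : A .memb (A .fp (k + 1)) ≠ 0 := mt (hmemb h0).1 hSp
        have hgs := GroupStep.chainJoin (B := B) (fp := A .fp) (own := A .own)
          (V := fun k => B < A .sz k) (S := IsSplit B (A .fp) (A .sz) (A .own) (A .hv))
          (memb := A .memb) (cur := A .cur) (acc := A .acc) (rt := A .rt) (M := A .num 0) (cl := cl)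
          hV hS hSp hle
        refine ⟨cl, ?_⟩
        simp only [chainBody, ifFull, joinGroup, run_ite_eq, run_ite_lt, eval_zero, eval_ctr,
          eval_get, eval_add, Arrays.set, ne_eq, reduceCtorEq, not_false_eq_true,
          Function.update_of_ne, hbb, c2, hm0, if_false, c4 hm0, not_lt.2 hle, run_seq, run_put,
          Function.update_self] at hA'
        subst hA'
        simpa using hgs
  · have hrun : groupPhase.body.run K (k + 1) A = lightBody.run K (k + 1) A := by
      simp only [groupPhase, run_ite_lt, eval_zero, eval_ctr, eval_get, hbb, hV, if_false]
    rw [hrun] at hA'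
    by_cases h0 : A .fp (k + 1) = 0
    · have hgs := GroupStep.lightRoot (B := B) (fp := A .fp) (own := A .own)
          (V := fun k => B < A .sz k) (S := IsSplit B (A .fp) (A .sz) (A .own) (A .hv))
          (memb := A .memb) (cur := A .cur) (acc := A .acc) (rt := A .rt) (M := A .num 0) (cl := cl)
          hV h0
      refine ⟨cl, ?_⟩
      simp only [lightBody, newGroup, run_ite_eq, run_seq, run_put, eval_zero, eval_one, eval_ctr,
        eval_get, eval_add, Arrays.set, Function.update_self, ne_eq, reduceCtorEq,
        not_false_eq_true, Function.update_of_ne, c1, h0, if_true] at hA'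
      subst hA'
      simpa using hgs
    · by_cases hSp : IsSplit B (A .fp) (A .sz) (A .own) (A .hv) (A .fp (k + 1))
      · have hm0 := (hmemb h0).2 hSp
        have c4 : A .cur (A .fp (k + 1)) ≠ 0 →
            capAdd K (A .acc (A .cur (A .fp (k + 1)))) (A .own (k + 1)) =
              A .acc (A .cur (A .fp (k + 1))) + A .own (k + 1) := by
          intro hc0
          have e := h.rt_cur _ (by omega) (by omega) hSp hc0
          have := ha.acc_le _ (by omega) (h.cur_le _ (by omega) (by omega) hSp)
            (by rw [e]; exact hSp.2.1)
          exact capAdd_eq (by omega)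
        by_cases hn : A .cur (A .fp (k + 1)) = 0 ∨
            2 * B < A .acc (A .cur (A .fp (k + 1))) + A .own (k + 1)
        · obtain ⟨cl', hgs⟩ : ∃ cl', GroupStep B k (A .fp) (A .own) (fun k => B < A .sz k)
              (IsSplit B (A .fp) (A .sz) (A .own) (A .hv)) (A .memb) (A .cur) (A .acc) (A .rt)
              (A .num 0) cl _ _ _ _ _ cl' :=
            ⟨_, GroupStep.lightNew hV hSp (fun hc0 => hn.resolve_left hc0)⟩
          refine ⟨cl', ?_⟩
          have hrun2 : lightBody.run K (k + 1) A =
              ((newGroup (get .fp ctr) (add (get .own ctr) one)).seq ((put .memb ctr (var .num)).seq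
                (put .cur (get .fp ctr) (var .num)))).run K (k + 1) A := by
            simp only [lightBody, ifFull, run_ite_eq, run_ite_lt, eval_zero, eval_ctr, eval_get,
              eval_add, hbb, c2, h0, hm0, if_true, if_false]
            by_cases hc0 : A .cur (A .fp (k + 1)) = 0
            · rw [if_pos hc0]
            · rw [if_neg hc0, c4 hc0, if_pos (hn.resolve_left hc0)]
          rw [hrun2] at hA'
          simp only [newGroup, run_seq, run_put, eval_zero, eval_one, eval_ctr, eval_get,
            eval_add, Arrays.set, Function.update_self, ne_eq, reduceCtorEq, not_false_eq_true,
            Function.update_of_ne, c1, c3] at hA'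
          subst hA'
          simpa using hgs
        · rw [not_or, not_lt] at hn
          have hgs := GroupStep.lightJoin (B := B) (fp := A .fp) (own := A .own)
            (V := fun k => B < A .sz k) (S := IsSplit B (A .fp) (A .sz) (A .own) (A .hv))
            (memb := A .memb) (cur := A .cur) (acc := A .acc) (rt := A .rt) (M := A .num 0)
            (cl := cl) hV hSp hn.1 hn.2
          refine ⟨cl, ?_⟩
          simp only [lightBody, ifFull, joinGroup, run_ite_eq, run_ite_lt, eval_zero, eval_ctr,
            eval_get, eval_add, hbb, c2, h0, hm0, hn.1, if_true, if_false, c4 hn.1, not_lt.2 hn.2,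
            run_seq, run_put, Arrays.set, Function.update_self, ne_eq, reduceCtorEq,
            not_false_eq_true, Function.update_of_ne] at hA'
          subst hA'
          simpa using hgs
      · have hm0 := mt (hmemb h0).1 hSp
        have hgs := GroupStep.lightInherit (B := B) (fp := A .fp) (own := A .own)
          (V := fun k => B < A .sz k) (S := IsSplit B (A .fp) (A .sz) (A .own) (A .hv))
          (memb := A .memb) (cur := A .cur) (acc := A .acc) (rt := A .rt) (M := A .num 0) (cl := cl)
          hV h0 hSp
        refine ⟨cl, ?_⟩
        simp only [lightBody, run_ite_eq, run_put, eval_zero, eval_ctr, eval_get, h0, hm0, if_false,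
          Arrays.set] at hA'
        subst hA'
        simpa using hgs

theorem groupPhase_spec {K B N : ℕ} {A : Arrays} {wt : ℕ → ℕ}
    (hK : 2 * B + N + 2 ≤ K) (hB : 1 ≤ B) (hbb : A .bb 0 = B) (htot : A .tot 0 = N)
    (hfp : ∀ k, 1 ≤ k → k ≤ N → A .fp k < k) (hwt : ∀ x, wt x ≤ 1)
    (hW : PartialWeights B N 0 (A .fp) wt (A .sz) (A .own) (A .hv))
    (hmemb : ∀ x, A .memb x = 0) (hnum : A .num 0 = 0) {A' : Arrays}
    (hA' : A' = groupPhase.run K A) :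
    Grouping N N (A .fp) (fun k => B < A .sz k) (IsSplit B (A .fp) (A .sz) (A .own) (A .hv))
      (A' .memb) (A' .cur) (A' .rt) (A' .num 0) ∧
    ∃ cl, Accounting B N N (A .fp) (A .own) (fun k => B < A .sz k)
      (IsSplit B (A .fp) (A .sz) (A .own) (A .hv)) (A' .memb) (A' .cur) (A' .acc) (A' .rt)
      (A' .num 0) cl := by
  subst hA'
  refine (groupPhase.run_induction (K := K) (fun k A' =>
    Grouping N k (A .fp) (fun k => B < A .sz k) (IsSplit B (A .fp) (A .sz) (A .own) (A .hv))
      (A' .memb) (A' .cur) (A' .rt) (A' .num 0) ∧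
    ∃ cl, Accounting B N k (A .fp) (A .own) (fun k => B < A .sz k)
      (IsSplit B (A .fp) (A .sz) (A .own) (A .hv)) (A' .memb) (A' .cur) (A' .acc) (A' .rt)
      (A' .num 0) cl) htot ?_ ?_).1
  · constructor
    · constructor
      all_goals try (intros; omega)
      · exact hmemb 0
      · intro j hj
        rw [hmemb]; exact Nat.zero_le _
    · refine ⟨∅, ?_⟩
      constructor
      all_goals try (intros; omega)
      all_goals try simp
      omega
  · rintro k A' hk hfr ⟨h1, cl, h2⟩
    have f1 := hfr .fp rfl
    have f2 := hfr .sz rfl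
    have f3 := hfr .own rfl
    have f4 := hfr .hv rfl
    have f5 := hfr .bb rfl
    rw [← f1, ← f2, ← f3, ← f4] at h1 h2 hW ⊢
    obtain ⟨cl', hs⟩ := groupPhase_step hK hB (by rw [f5, hbb]) hk (by rwa [f1]) hwt hW h1 h2 rfl
    rw [← f1] at hfp
    exact ⟨hs.grouping (hW.splitForest hfp) h1 hk, cl',
      hs.accounting (hW.splitForest hfp) h1 h2 hk hB⟩

end WordRAM

end

/-! ### Writing the output -/

/-- The indices `1, …, k` that belong to the group `c`, apart from its root. -/
def memberList (memb rt : ℕ → ℕ) (k c : ℕ) : List ℕ :=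
  (List.range' 1 k).filter fun j => memb j = c ∧ rt c ≠ j

theorem memberList_succ (memb rt : ℕ → ℕ) (k c : ℕ) :
    memberList memb rt (k + 1) c =
      memberList memb rt k c ++ if memb (k + 1) = c ∧ rt c ≠ k + 1 then [k + 1] else [] := by
  unfold memberList
  rw [List.range'_concat, List.filter_append]
  congr 1
  split_ifs with h <;> simp [add_comm, h]

theorem memberList_length_mono (memb rt : ℕ → ℕ) {k k' : ℕ} (h : k ≤ k') (c : ℕ) :
    (memberList memb rt k c).length ≤ (memberList memb rt k' c).length := by
  induction k', h using Nat.le_induction with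
  | base => exact le_rfl
  | succ m _ ih => rw [memberList_succ, List.length_append]; omega

/-- Each index is in at most one list, because `memb` is a function. -/
theorem sum_memberList_le (memb rt : ℕ → ℕ) (k M : ℕ) :
    ∑ i ∈ Finset.range M, (memberList memb rt k (i + 1)).length ≤ k := by
  induction k with
  | zero => simp [memberList]
  | succ k ih =>
    simp only [memberList_succ, List.length_append, Finset.sum_add_distrib]
    have : ∑ i ∈ Finset.range M,
        (if memb (k + 1) = i + 1 ∧ rt (i + 1) ≠ k + 1 then [k + 1] else []).length ≤
        ∑ i ∈ Finset.range M, if memb (k + 1) - 1 = i then 1 else 0 := by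
      refine Finset.sum_le_sum fun i _ => ?_
      split_ifs with h1 h2 <;> simp
      omega
    rw [Finset.sum_ite_eq] at this
    split_ifs at this <;> omega

/-- The words that describe the group `c`, with the members up to index `k` only. -/
def groupBlock (lab fs memb rt : ℕ → ℕ) (N k c : ℕ) : List ℕ :=
  [fs (rt c), lab (rt c), (memberList memb rt N c).length + 1, lab (rt c)] ++
    (memberList memb rt k c).map lab

theorem groupBlock_length (lab fs memb rt : ℕ → ℕ) (N k c : ℕ) :
    (groupBlock lab fs memb rt N k c).length = 4 + (memberList memb rt k c).length := by
  simp [groupBlock]; omega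

theorem groupBlock_succ (lab fs memb rt : ℕ → ℕ) (N k c : ℕ) :
    groupBlock lab fs memb rt N (k + 1) c = groupBlock lab fs memb rt N k c ++
      if memb (k + 1) = c ∧ rt c ≠ k + 1 then [lab (k + 1)] else [] := by
  unfold groupBlock
  rw [memberList_succ, List.map_append, List.append_assoc]
  split_ifs <;> rfl

/-- The number of words used for the groups `1, …, c`. -/
def blockEnd (memb rt : ℕ → ℕ) (N c : ℕ) : ℕ :=
  ∑ i ∈ Finset.range c, (4 + (memberList memb rt N (i + 1)).length)

theorem blockEnd_succ (memb rt : ℕ → ℕ) (N c : ℕ) : blockEnd memb rt N (c + 1) =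
    blockEnd memb rt N c + (4 + (memberList memb rt N (c + 1)).length) :=
  Finset.sum_range_succ _ _

theorem blockEnd_mono (memb rt : ℕ → ℕ) (N : ℕ) {c c' : ℕ} (h : c ≤ c') :
    blockEnd memb rt N c ≤ blockEnd memb rt N c' :=
  Finset.sum_le_sum_of_subset (Finset.range_mono h)

theorem blockEnd_le (memb rt : ℕ → ℕ) (N M : ℕ) : blockEnd memb rt N M ≤ 4 * M + N := by
  have := sum_memberList_le memb rt N M
  rw [blockEnd, Finset.sum_add_distrib]
  simp; omega

theorem flatMap_blocks {lab fs memb rt out : ℕ → ℕ} {N : ℕ} (M : ℕ)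
    (h : ∀ c, c < M → ∀ j x, (groupBlock lab fs memb rt N N (c + 1))[j]? = some x →
      out (blockEnd memb rt N c + 1 + j) = x) :
    ((List.range' 1 M).flatMap (groupBlock lab fs memb rt N N)).length = blockEnd memb rt N M ∧
    ∀ j x, ((List.range' 1 M).flatMap (groupBlock lab fs memb rt N N))[j]? = some x →
      out (1 + j) = x := by
  induction M with
  | zero => simp [blockEnd]
  | succ M ih =>
    obtain ⟨h1, h2⟩ := ih fun c hc => h c (by omega)
    have e : (List.range' 1 (M + 1)).flatMap (groupBlock lab fs memb rt N N) =
        (List.range' 1 M).flatMap (groupBlock lab fs memb rt N N) ++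
          groupBlock lab fs memb rt N N (M + 1) := by
      rw [List.range'_concat, List.flatMap_append]
      simp [add_comm]
    rw [e]
    refine ⟨by rw [List.length_append, h1, groupBlock_length, blockEnd_succ], fun j x hj => ?_⟩
    rcases Nat.lt_or_ge j ((List.range' 1 M).flatMap (groupBlock lab fs memb rt N N)).length with
      hl | hl
    · rw [List.getElem?_append_left hl] at hj
      exact h2 j x hj
    · rw [List.getElem?_append_right hl] at hj
      have := h M (by omega) _ x hj
      rw [h1] at this hl
      rw [← this]; congr 1; omega

namespace WordRAM

open HExpr HProg

set_option linter.unusedSimpArgs false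

/-- Does `p` when the current index is in a group of which it is not the root. -/
def ifMember (p : HProg) : HProg :=
  .ite (.eq (get .memb ctr) zero) skip
    (.ite (.eq (get .rt (get .memb ctr)) ctr) skip p)

theorem run_ifMember {K k : ℕ} (p : HProg) (A : Arrays) :
    (ifMember p).run K k A =
      if A .memb k ≠ 0 ∧ A .rt (A .memb k) ≠ k then p.run K k A else A := by
  simp only [ifMember, run_ite_eq, run_skip, eval_get, eval_zero, eval_ctr]
  by_cases h1 : A .memb k = 0
  · simp [h1]
  · by_cases h2 : A .rt (A .memb k) = k
    · simp [h2]
    · simp [h1, h2]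

/-- Counts the members of the groups. -/
def countPhase : Phase where
  lim := .tot
  body := ifMember (put .csz (get .memb ctr) (add (get .csz (get .memb ctr)) one))

theorem countPhase_spec {K N : ℕ} {A : Arrays} (hK : N + 1 ≤ K) (htot : A .tot 0 = N)
    (hcsz : ∀ x, A .csz x = 0) :
    ∀ c, 1 ≤ c → countPhase.run K A .csz c = (memberList (A .memb) (A .rt) N c).length := by
  refine (countPhase.run_induction (K := K) (fun k A' => ∀ c, 1 ≤ c →
    A' .csz c = (memberList (A .memb) (A .rt) k c).length) htot
    (fun c _ => by simp [hcsz, memberList]) ?_).1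
  intro k A' hk hfr hI c hc
  have f1 := hfr .memb rfl
  have f2 := hfr .rt rfl
  have hle : ∀ c, (memberList (A .memb) (A .rt) k c).length ≤ k := fun c => by
    unfold memberList
    exact (List.length_filter_le _ _).trans (by simp)
  rw [memberList_succ, List.length_append, ← hI c hc]
  simp only [countPhase, run_ifMember, run_put, eval_get, eval_ctr, eval_add, eval_one, f1, f2]
  by_cases h : A .memb (k + 1) ≠ 0 ∧ A .rt (A .memb (k + 1)) ≠ k + 1
  · have e := hI _ (Nat.one_le_iff_ne_zero.2 h.1)
    have := hle (A .memb (k + 1))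
    rw [if_pos h, Arrays.set_same, capAdd_eq (by omega)]
    by_cases hm : A .memb (k + 1) = c
    · subst hm
      rw [if_pos ⟨rfl, h.2⟩, Function.update_self]; rfl
    · rw [Function.update_of_ne (Ne.symm hm), if_neg (fun hc => hm hc.1)]; rfl
  · rw [if_neg h, if_neg]
    · rfl
    · rintro ⟨rfl, h2⟩
      exact h ⟨by omega, h2⟩

/-- Appends a word to the output. -/
def push (e : HExpr) : HProg :=
  .seq (put .ptr zero (add (var .ptr) one)) (put .out (var .ptr) e)

/-- Writes the first words of the descriptions of the groups. -/
def headerPhase : Phase where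
  lim := .num
  body :=
    .seq (put .out zero (var .num))
      (.seq (push (get .fs (get .rt ctr)))
        (.seq (push (get .lab (get .rt ctr)))
          (.seq (push (add (get .csz ctr) one))
            (.seq (push (get .lab (get .rt ctr)))
              (.seq (put .cpos ctr (add (var .ptr) one))
                (put .ptr zero (add (var .ptr) (get .csz ctr))))))))

/-- Cell `0` is reserved for `M`, so a block begins at `blockEnd + 1`, and its members begin four
header words later, at `blockEnd + 5`. Cell `0` is written inside the loop, hence the condition `1 ≤
M`. -/
theorem headerPhase_spec {K N M : ℕ} {A : Arrays} (hK : 4 * M + N + 1 ≤ K) (hnum : A .num 0 = M)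
    (hptr : A .ptr 0 = 0)
    (hcsz : ∀ c, 1 ≤ c → A .csz c = (memberList (A .memb) (A .rt) N c).length) :
    (1 ≤ M → headerPhase.run K A .out 0 = M) ∧
    (∀ c, c < M → headerPhase.run K A .cpos (c + 1) = blockEnd (A .memb) (A .rt) N c + 5) ∧
    ∀ c, c < M → ∀ j x, (groupBlock (A .lab) (A .fs) (A .memb) (A .rt) N 0 (c + 1))[j]? = some x →
      headerPhase.run K A .out (blockEnd (A .memb) (A .rt) N c + 1 + j) = x := by
  have h := (headerPhase.run_induction (K := K) (fun k A' =>
    A' .ptr 0 = blockEnd (A .memb) (A .rt) N k ∧ (1 ≤ k → A' .out 0 = M) ∧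
    (∀ c, c < k → A' .cpos (c + 1) = blockEnd (A .memb) (A .rt) N c + 5) ∧
    ∀ c, c < k → ∀ j x, (groupBlock (A .lab) (A .fs) (A .memb) (A .rt) N 0 (c + 1))[j]? = some x →
      A' .out (blockEnd (A .memb) (A .rt) N c + 1 + j) = x) hnum
    ⟨by simp [hptr, blockEnd], by omega, by omega, by omega⟩ ?_).1
  · exact h.2
  rintro k A' hk hfr ⟨h1, h2, h3, h4⟩
  have f1 := hfr .rt rfl
  have f2 := hfr .lab rfl
  have f3 := hfr .fs rfl
  have f4 : A' .csz (k + 1) = (memberList (A .memb) (A .rt) N (k + 1)).length := by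
    rw [hfr .csz rfl]; exact hcsz _ (by omega)
  have f5 : A' .num 0 = M := by rw [hfr .num rfl, hnum]
  have hE := (blockEnd_mono (A .memb) (A .rt) N (show k + 1 ≤ M by omega)).trans
    (blockEnd_le (A .memb) (A .rt) N M)
  have hE' := blockEnd_succ (A .memb) (A .rt) N k
  set E := blockEnd (A .memb) (A .rt) N k with hEdef
  set l := (memberList (A .memb) (A .rt) N (k + 1)).length with hl
  have c1 : capAdd K E 1 = E + 1 := capAdd_eq (by omega)
  have c2 : capAdd K (E + 1) 1 = E + 2 := capAdd_eq (by omega)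
  have c3 : capAdd K (E + 2) 1 = E + 3 := capAdd_eq (by omega)
  have c4 : capAdd K (E + 3) 1 = E + 4 := capAdd_eq (by omega)
  have c5 : capAdd K (E + 4) 1 = E + 5 := capAdd_eq (by omega)
  have c6 : capAdd K (E + 4) l = E + 4 + l := capAdd_eq (by omega)
  have c7 : capAdd K l 1 = l + 1 := capAdd_eq (by omega)
  have hrun : ∀ A'', A'' = headerPhase.body.run K (k + 1) A' → A'' .ptr 0 = E + 4 + l ∧
      A'' .cpos = Function.update (A' .cpos) (k + 1) (E + 5) ∧
      A'' .out = Function.update (Function.update (Function.update (Function.update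
        (Function.update (A' .out) 0 M) (E + 1) (A .fs (A .rt (k + 1))))
        (E + 2) (A .lab (A .rt (k + 1)))) (E + 3) (l + 1)) (E + 4) (A .lab (A .rt (k + 1))) := by
    intro A'' hA''
    simp only [headerPhase, push, run_seq, run_put, eval_zero, eval_one, eval_ctr, eval_get,
      eval_add, Arrays.set, Function.update_self, ne_eq, reduceCtorEq, not_false_eq_true,
      Function.update_of_ne, h1, f1, f2, f3, f4, f5, c1, c2, c3, c4, c5, c6, c7] at hA''
    subst hA''
    simp
  obtain ⟨r1, r2, r3⟩ := hrun _ rfl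
  refine ⟨by rw [r1, hE']; omega, fun _ => ?_, ?_, ?_⟩
  · rw [r3, Function.update_of_ne (by omega), Function.update_of_ne (by omega),
      Function.update_of_ne (by omega), Function.update_of_ne (by omega), Function.update_self]
  · intro c hc
    rw [r2]
    rcases Nat.lt_or_ge c k with hck | hck
    · rw [Function.update_of_ne (by omega)]; exact h3 c hck
    · obtain rfl : c = k := by omega
      rw [Function.update_self]
  · intro c hc j x hj
    have hjl : j < 4 := by
      have := (List.getElem?_eq_some_iff.1 hj).1
      rw [groupBlock_length] at this
      simpa [memberList] using this
    rw [r3]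
    rcases Nat.lt_or_ge c k with hck | hck
    · have hcE := blockEnd_mono (A .memb) (A .rt) N (show c + 1 ≤ k by omega)
      rw [blockEnd_succ] at hcE
      rw [Function.update_of_ne (by omega), Function.update_of_ne (by omega),
        Function.update_of_ne (by omega), Function.update_of_ne (by omega),
        Function.update_of_ne (by omega)]
      exact h4 c hck j x hj
    · obtain rfl : c = k := by omega
      have h0 : memberList (A .memb) (A .rt) 0 (c + 1) = [] := rfl
      simp only [groupBlock, h0, List.map_nil, List.append_nil] at hj
      rw [← hEdef]
      interval_cases j <;> simp [Function.update_apply] at hj ⊢ <;> exact hj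

/-- Writes the members of the groups. -/
def fillPhase : Phase where
  lim := .tot
  body := ifMember (.seq (put .out (get .cpos (get .memb ctr)) (get .lab ctr))
    (put .cpos (get .memb ctr) (add (get .cpos (get .memb ctr)) one)))

/-- As in counting sort, `cpos` holds the next free position of each group, and the earlier count
reserves exactly the space that its members need. -/
theorem fillPhase_spec {K N M : ℕ} {A : Arrays} (hK : 4 * M + N + 1 ≤ K) (htot : A .tot 0 = N)
    (hout : A .out 0 = M) (hmemb : ∀ j, 1 ≤ j → j ≤ N → A .memb j ≤ M)
    (hcpos : ∀ c, c < M → A .cpos (c + 1) = blockEnd (A .memb) (A .rt) N c + 5)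
    (hhead : ∀ c, c < M → ∀ j x,
      (groupBlock (A .lab) (A .fs) (A .memb) (A .rt) N 0 (c + 1))[j]? = some x →
      A .out (blockEnd (A .memb) (A .rt) N c + 1 + j) = x) :
    fillPhase.run K A .out 0 = M ∧
    ∀ c, c < M → ∀ j x,
      (groupBlock (A .lab) (A .fs) (A .memb) (A .rt) N N (c + 1))[j]? = some x →
      fillPhase.run K A .out (blockEnd (A .memb) (A .rt) N c + 1 + j) = x := by
  have h := (fillPhase.run_induction (K := K) (fun k A' =>
    A' .out 0 = M ∧
    (∀ c, c < M → A' .cpos (c + 1) = blockEnd (A .memb) (A .rt) N c + 5 +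
      (memberList (A .memb) (A .rt) k (c + 1)).length) ∧
    ∀ c, c < M → ∀ j x,
      (groupBlock (A .lab) (A .fs) (A .memb) (A .rt) N k (c + 1))[j]? = some x →
      A' .out (blockEnd (A .memb) (A .rt) N c + 1 + j) = x) htot
    ⟨hout, fun c hc => by simp [hcpos c hc, memberList], hhead⟩ ?_).1
  · exact ⟨h.1, h.2.2⟩
  rintro k A' hk hfr ⟨h1, h2, h3⟩
  have f1 := hfr .rt rfl
  have f2 := hfr .lab rfl
  have f3 := hfr .memb rfl
  simp only [fillPhase, run_ifMember, run_seq, run_put, eval_get, eval_ctr, eval_add, eval_one, f1,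
    f2, f3]
  by_cases h : A .memb (k + 1) ≠ 0 ∧ A .rt (A .memb (k + 1)) ≠ k + 1
  · rw [if_pos h]
    have hmM := hmemb (k + 1) (by omega) (by omega)
    obtain ⟨d, hd⟩ : ∃ d, A .memb (k + 1) = d + 1 := ⟨A .memb (k + 1) - 1, by omega⟩
    rw [hd] at h hmM ⊢
    have hdpos := h2 d (by omega)
    -- The index `k + 1` is itself a member not yet written, so the position lies inside the block
    -- and no other block is touched.
    have hlen : (memberList (A .memb) (A .rt) k (d + 1)).length + 1 ≤
        (memberList (A .memb) (A .rt) N (d + 1)).length := by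
      refine le_trans ?_ (memberList_length_mono (A .memb) (A .rt) (show k + 1 ≤ N by omega) (d + 1))
      rw [memberList_succ, if_pos ⟨hd, h.2⟩]; simp
    have hE := (blockEnd_mono (A .memb) (A .rt) N (show d + 1 ≤ M by omega)).trans
      (blockEnd_le (A .memb) (A .rt) N M)
    have hE' := blockEnd_succ (A .memb) (A .rt) N d
    simp only [Arrays.set, ne_eq, reduceCtorEq, not_false_eq_true, Function.update_of_ne,
      Function.update_self, f2, f3, hd, hdpos]
    rw [capAdd_eq (by omega)]
    refine ⟨?_, ?_, ?_⟩
    · rw [Function.update_of_ne (by omega)]; exact h1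
    · intro c hc
      rw [memberList_succ, hd]
      by_cases hcd : c = d
      · subst hcd
        rw [Function.update_self, if_pos ⟨rfl, h.2⟩, List.length_append]; simp; omega
      · rw [Function.update_of_ne (by omega), if_neg (fun hc => hcd (by omega)), List.append_nil]
        exact h2 c hc
    · intro c hc j x hj
      have hjl := (List.getElem?_eq_some_iff.1 hj).1
      rw [groupBlock_length] at hjl
      rw [groupBlock_succ, hd] at hj
      have hmono := memberList_length_mono (A .memb) (A .rt) (show k + 1 ≤ N by omega) (c + 1)
      rcases lt_trichotomy c d with hcd | rfl | hcd
      · have := blockEnd_mono (A .memb) (A .rt) N (show c + 1 ≤ d by omega)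
        rw [blockEnd_succ] at this
        rw [Function.update_of_ne (by omega)]
        rw [if_neg (by omega), List.append_nil] at hj
        exact h3 c hc j x hj
      · rw [if_pos ⟨rfl, h.2⟩] at hj
        rcases Nat.lt_or_ge j (groupBlock (A .lab) (A .fs) (A .memb) (A .rt) N k (c + 1)).length with
          hl | hl
        · rw [List.getElem?_append_left hl] at hj
          rw [groupBlock_length] at hl
          rw [Function.update_of_ne (by omega)]
          exact h3 c hc j x hj
        · rw [List.getElem?_append_right hl] at hj
          have hz := (List.getElem?_eq_some_iff.1 hj).1
          simp only [List.length_singleton] at hz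
          have hz' : j - (groupBlock (A .lab) (A .fs) (A .memb) (A .rt) N k (c + 1)).length = 0 := by
            omega
          rw [hz'] at hj
          simp only [List.getElem?_cons_zero, Option.some.injEq] at hj
          rw [groupBlock_length] at hl hz
          rw [show blockEnd (A .memb) (A .rt) N c + 1 + j = blockEnd (A .memb) (A .rt) N c + 5 +
            (memberList (A .memb) (A .rt) k (c + 1)).length by omega, Function.update_self, hj]
      · have := blockEnd_mono (A .memb) (A .rt) N (show d + 1 ≤ c by omega)
        rw [Function.update_of_ne (by omega)]
        rw [if_neg (by omega), List.append_nil] at hj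
        exact h3 c hc j x hj
  · rw [if_neg h]
    have hno : ∀ c, ¬(A .memb (k + 1) = c + 1 ∧ A .rt (c + 1) ≠ k + 1) := by
      rintro c ⟨g1, g2⟩
      rw [g1] at h
      exact h ⟨by omega, g2⟩
    refine ⟨h1, fun c hc => ?_, fun c hc j x hj => ?_⟩
    · rw [memberList_succ, if_neg (hno c), List.append_nil]; exact h2 c hc
    · rw [groupBlock_succ, if_neg (hno c), List.append_nil] at hj
      exact h3 c hc j x hj

end WordRAM

/-! ### Groups as subtrees of slabs -/

/-- The group `c` as a subtree of its slab. -/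
def groupSubtree (lab fs memb rt : ℕ → ℕ) (N c : ℕ) : SlabSubtree where
  slab := fs (rt c)
  root := lab (rt c)
  nodes := (lab (rt c) :: (memberList memb rt N c).map lab).toFinset

/-- The laid-out slab trees of `T` with the subtree sizes and a grouping. -/
structure SlabGrouping {n : ℕ} (T : OrdinalTree n) (H o b N M : ℕ)
    (fp lab fs sz own hv memb cur rt : ℕ → ℕ) : Prop where
  forest : SlabForest T H o N fp lab fs
  weights : PartialWeights b N 0 fp (fun k => if lab k = 0 then 0 else 1) sz own hv
  groups : Grouping N N fp (fun k => b < sz k) (IsSplit b fp sz own hv) memb cur rt M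

namespace SlabForest

variable {n : ℕ} {T : OrdinalTree n} {H o N : ℕ} {fp lab fs : ℕ → ℕ}

theorem label_inj (h : SlabForest T H o N fp lab fs) {j k : ℕ} (hj : 1 ≤ j) (hjN : j ≤ N)
    (hk : 1 ≤ k) (hkN : k ≤ N) (hs : fs j = fs k) (hl : lab j = lab k) : j = k := by
  rcases lt_trichotomy j k with h1 | h1 | h1
  · exact absurd hl (h.label_lt j k hj h1 hkN hs).ne
  · exact h1
  · exact absurd hl.symm (h.label_lt k j hk h1 hjN hs.symm).ne

theorem label_lt_iff (h : SlabForest T H o N fp lab fs) {j k : ℕ} (hj : 1 ≤ j) (hjN : j ≤ N)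
    (hk : 1 ≤ k) (hkN : k ≤ N) (hs : fs j = fs k) : lab j < lab k ↔ j < k := by
  rcases lt_trichotomy j k with h1 | rfl | h1
  · simp [h1, h.label_lt j k hj h1 hkN hs]
  · simp
  · have := h.label_lt k j hk h1 hjN hs.symm
    omega

/-- Every edge of a slab tree is present in the array. A root index is a dummy or the node `1` in
slab `0`, neither of which has a slab parent; for any other index, the parent index carries the
unique slab parent, and labels are injective within a slab. -/
theorem exists_child (h : SlabForest T H o N fp lab fs) {j v : ℕ} (hj : 1 ≤ j) (hjN : j ≤ N)
    (hc : T.IsSlabChild H o (fs j) (lab j) v) :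
    ∃ k, 1 ≤ k ∧ k ≤ N ∧ fs k = fs j ∧ lab k = v ∧ fp k = j := by
  obtain ⟨k, k1, k2, k3, rfl⟩ := h.exists_index (fs j) v (T.mem_slabNodes.2 (Or.inl hc.1))
  have hv1 := (T.mem_slab.1 hc.1).1.1
  refine ⟨k, k1, k2, k3, rfl, ?_⟩
  have h0 : fp k ≠ 0 := by
    intro h0
    rcases h.root k k1 k2 h0 with e | ⟨e1, e2⟩
    · omega
    · have hu := hc.2.2
      rw [e2, T.parent_one, ite_self] at hu
      have hm := hc.2.1
      rw [hu, T.mem_slabNodes] at hm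
      rcases hm with hm | hm
      · exact T.zero_notMem_slab hm
      · exact hm.2.1 (by rw [← k3, e1])
  have hp := h.parent_lt k k1 k2
  have hcc := h.child k k1 k2 h0
  rw [k3] at hcc
  exact h.label_inj (by omega) (by omega) hj hjN ((h.parent_slab k k1 k2 h0).trans k3)
    (hcc.unique hc)

theorem root_unique (h : SlabForest T H o N fp lab fs) {j k : ℕ} (hj : 1 ≤ j) (hjN : j ≤ N)
    (hk : 1 ≤ k) (hkN : k ≤ N) (hs : fs j = fs k) (hj0 : fp j = 0) (hk0 : fp k = 0) : j = k := by
  apply h.label_inj hj hjN hk hkN hs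
  have a := h.dummy j hj hjN
  have b := h.dummy k hk hkN
  rcases h.root j hj hjN hj0 with e | e <;> rcases h.root k hk hkN hk0 with e' | e'
  · omega
  · exact absurd (hs.trans e'.1) (a e).2
  · exact absurd (hs.symm.trans e.1) (b e').2
  · omega

/-- The index of a non-dummy node on the last level of its slab has no children. -/
theorem no_child_of_last (h : SlabForest T H o N fp lab fs) {j : ℕ} (hj : 1 ≤ j)
    (h0 : lab j ≠ 0) (hl : T.depth (lab j) = fs j * H + o) :
    ∀ k, 1 ≤ k → k ≤ N → fp k ≠ j := by
  rintro k k1 k2 rfl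
  have hc := h.child k k1 k2 (by omega)
  rw [h.parent_slab k k1 k2 (by omega)] at hl
  have e := hc.eq_parent h0
  have hm := T.mem_slab.1 hc.1
  have := T.depth_eq (hc.two_le h0) hm.1.2
  rw [← e] at this
  omega

end SlabForest

namespace SlabGrouping

variable {n : ℕ} {T : OrdinalTree n} {H o b N M : ℕ}
  {fp lab fs sz own hv memb cur rt : ℕ → ℕ}

theorem splitForest (h : SlabGrouping T H o b N M fp lab fs sz own hv memb cur rt) :
    SplitForest b N fp own (fun k => b < sz k) (IsSplit b fp sz own hv) :=
  h.weights.splitForest h.forest.parent_lt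

theorem not_split (h : SlabGrouping T H o b N M fp lab fs sz own hv memb cur rt) {j : ℕ}
    (hj : 1 ≤ j) (hjN : j ≤ N) (hm : 1 ≤ memb j) : ¬IsSplit b fp sz own hv j := fun hS => by
  rw [h.groups.memb_split j hj hjN hS] at hm; omega

/-- This makes the groups connected. The first alternative is needed for split parents: their `memb`
is `0`, so they belong to a group only as its root. -/
theorem parent_mem (h : SlabGrouping T H o b N M fp lab fs sz own hv memb cur rt) {j : ℕ}
    (hj : 1 ≤ j) (hjN : j ≤ N) (hm : 1 ≤ memb j) (hr : j ≠ rt (memb j)) :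
    fp j ≠ 0 ∧ (fp j = rt (memb j) ∨ memb (fp j) = memb j) := by
  have hS := h.not_split hj hjN hm
  by_cases hV : b < sz j
  · have h0 : fp j ≠ 0 := fun h0 => hS (h.splitForest.split_root j hj hjN hV h0)
    rcases h.groups.chain j hj hjN hV hS with e | e
    · exact absurd e.symm hr
    · exact ⟨h0, Or.inr e.2.symm⟩
  · have h0 : fp j ≠ 0 := fun h0 => hr (h.groups.light_root j hj hjN hV h0).symm
    refine ⟨h0, ?_⟩
    by_cases hSp : IsSplit b fp sz own hv (fp j)
    · exact Or.inl (h.groups.light_split j hj hjN hV hSp).symm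
    · exact Or.inr (h.groups.light_inherit j hj hjN hV h0 hSp).symm

theorem slab_eq (h : SlabGrouping T H o b N M fp lab fs sz own hv memb cur rt) {j : ℕ}
    (hj : 1 ≤ j) (hjN : j ≤ N) (hm : 1 ≤ memb j) :
    fs j = fs (rt (memb j)) ∧ rt (memb j) ≤ j := by
  induction j using Nat.strong_induction_on with
  | _ j ih =>
    by_cases hr : j = rt (memb j)
    · rw [← hr]; exact ⟨rfl, le_rfl⟩
    · obtain ⟨h0, h1⟩ := h.parent_mem hj hjN hm hr
      have hlt := h.forest.parent_lt j hj hjN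
      have hs := h.forest.parent_slab j hj hjN h0
      rcases h1 with h1 | h1
      · rw [← h1]; exact ⟨hs.symm, hlt.le⟩
      · have := ih (fp j) hlt (by omega) (by omega) (by omega)
        rw [h1, hs] at this
        exact ⟨this.1, by omega⟩

theorem mem_nodes (h : SlabGrouping T H o b N M fp lab fs sz own hv memb cur rt) {c x : ℕ}
    (hc : 1 ≤ c) (hcM : c ≤ M) : x ∈ (groupSubtree lab fs memb rt N c).nodes ↔
      ∃ j, 1 ≤ j ∧ j ≤ N ∧ (j = rt c ∨ memb j = c) ∧ fs j = fs (rt c) ∧ rt c ≤ j ∧ lab j = x := by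
  have hr1 := h.groups.rt_pos c hc hcM
  have hr2 := h.groups.rt_le c hc hcM
  simp only [groupSubtree, memberList, List.toFinset_cons, Finset.mem_insert, List.mem_toFinset,
    List.mem_map, List.mem_filter, List.mem_range'_1, decide_eq_true_eq]
  constructor
  · rintro (rfl | ⟨j, ⟨h1, h2, h3⟩, rfl⟩)
    · exact ⟨rt c, hr1, hr2, Or.inl rfl, rfl, le_rfl, rfl⟩
    · have := h.slab_eq (j := j) (by omega) (by omega) (by omega)
      rw [h2] at this
      exact ⟨j, by omega, by omega, Or.inr h2, this.1, this.2, rfl⟩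
  · rintro ⟨j, h1, h2, h3, -, -, rfl⟩
    by_cases hj : j = rt c
    · exact Or.inl (by rw [hj])
    · exact Or.inr ⟨j, ⟨by omega, by tauto, Ne.symm hj⟩, rfl⟩

theorem pairwise_labels (h : SlabGrouping T H o b N M fp lab fs sz own hv memb cur rt) {c : ℕ}
    (hc : 1 ≤ c) (hcM : c ≤ M) :
    (lab (rt c) :: (memberList memb rt N c).map lab).Pairwise (· < ·) := by
  have hr1 := h.groups.rt_pos c hc hcM
  have key : ∀ j ∈ memberList memb rt N c, (1 ≤ j ∧ j ≤ N) ∧ fs j = fs (rt c) ∧ rt c < j := by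
    intro j hj
    simp only [memberList, List.mem_filter, List.mem_range'_1, decide_eq_true_eq] at hj
    have := h.slab_eq (j := j) (by omega) (by omega) (by omega)
    rw [hj.2.1] at this
    omega
  rw [List.pairwise_cons]
  constructor
  · intro x hx
    obtain ⟨j, hj, rfl⟩ := List.mem_map.1 hx
    obtain ⟨h1, h2, h3⟩ := key j hj
    exact h.forest.label_lt _ _ hr1 h3 h1.2 h2.symm
  · rw [List.pairwise_map]
    have hp : (memberList memb rt N c).Pairwise (· < ·) := (List.pairwise_lt_range' (s := 1) (n := N)).filter _
    refine hp.imp_of_mem ?_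
    intro x y hx hy hxy
    have kx := key x hx
    have ky := key y hy
    exact h.forest.label_lt _ _ kx.1.1 hxy ky.1.2 (kx.2.1.trans ky.2.1.symm)

theorem sort_nodes (h : SlabGrouping T H o b N M fp lab fs sz own hv memb cur rt) {c : ℕ}
    (hc : 1 ≤ c) (hcM : c ≤ M) : (groupSubtree lab fs memb rt N c).nodes.sort (· ≤ ·) =
      lab (rt c) :: (memberList memb rt N c).map lab := by
  have hp := h.pairwise_labels hc hcM
  have hn := hp.imp (S := fun a b => a ≠ b) fun h => Nat.ne_of_lt h
  exact (List.toFinset_sort (· ≤ ·) hn).2 (hp.imp fun h => Nat.le_of_lt h)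

theorem card_nodes (h : SlabGrouping T H o b N M fp lab fs sz own hv memb cur rt) {c : ℕ}
    (hc : 1 ≤ c) (hcM : c ≤ M) :
    (groupSubtree lab fs memb rt N c).nodes.card = (memberList memb rt N c).length + 1 := by
  rw [← Finset.length_sort (· ≤ ·), h.sort_nodes hc hcM]
  simp

theorem isSubtree (h : SlabGrouping T H o b N M fp lab fs sz own hv memb cur rt) {c : ℕ}
    (hc : 1 ≤ c) (hcM : c ≤ M) : T.IsSubtree H o (groupSubtree lab fs memb rt N c) := by
  refine ⟨?_, by simp [groupSubtree], ?_⟩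
  · intro x hx
    obtain ⟨j, h1, h2, -, h3, -, rfl⟩ := (h.mem_nodes hc hcM).1 hx
    have := h.forest.label_mem j h1 h2
    rwa [h3] at this
  · intro x hx hxr
    obtain ⟨j, h1, h2, h3, h4, -, rfl⟩ := (h.mem_nodes hc hcM).1 hx
    have hjr : j ≠ rt c := by rintro rfl; exact hxr rfl
    have hm : memb j = c := by tauto
    obtain ⟨h5, h6⟩ := h.parent_mem h1 h2 (by omega) (by rwa [hm])
    rw [hm] at h6
    have hch := h.forest.child j h1 h2 h5
    have hlt := h.forest.parent_lt j h1 h2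
    have hs := h.forest.parent_slab j h1 h2 h5
    rw [h4] at hch
    refine ⟨_, (h.mem_nodes hc hcM).2 ⟨fp j, by omega, by omega, h6, hs.trans h4, ?_, rfl⟩, hch⟩
    rcases h6 with h6 | h6
    · exact h6.ge
    · have := (h.slab_eq (j := fp j) (by omega) (by omega) (by omega)).2
      rwa [h6] at this

/-- An index with `memb j ≠ 0` is not split, and if it is the root of a group, it is also a member
of that group. So it lies in one group only. -/
theorem eq_root_of_mem_two (h : SlabGrouping T H o b N M fp lab fs sz own hv memb cur rt)
    {c c' j : ℕ} (hc : 1 ≤ c) (hcM : c ≤ M) (hc' : 1 ≤ c') (hcM' : c' ≤ M) (hne : c ≠ c')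
    (hj : 1 ≤ j) (hjN : j ≤ N)
    (h1 : j = rt c ∨ memb j = c) (h2 : j = rt c' ∨ memb j = c') : j = rt c ∧ j = rt c' := by
  have key : ∀ c, 1 ≤ c → c ≤ M → 1 ≤ memb j → j = rt c → memb j = c := by
    intro c a1 a2 a3 a4
    have := h.not_split hj hjN a3
    rw [a4] at this ⊢
    exact h.groups.rt_memb c a1 a2 this
  rcases h1 with h1 | h1 <;> rcases h2 with h2 | h2
  · exact ⟨h1, h2⟩
  · exact absurd ((key c hc hcM (by omega) h1).symm.trans h2) hne
  · exact absurd (h1.symm.trans (key c' hc' hcM' (by omega) h2)) hne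
  · exact absurd (h1.symm.trans h2) hne

theorem split_of_mem_two (h : SlabGrouping T H o b N M fp lab fs sz own hv memb cur rt)
    {c c' : ℕ} (hc : 1 ≤ c) (hcM : c ≤ M) (hc' : 1 ≤ c') (hcM' : c' ≤ M) (hne : c ≠ c')
    (he : rt c = rt c') : IsSplit b fp sz own hv (rt c) := by
  by_contra hS
  have e1 := h.groups.rt_memb c hc hcM hS
  have e2 := h.groups.rt_memb c' hc' hcM' (he ▸ hS)
  rw [← he] at e2
  omega

theorem mem_two (h : SlabGrouping T H o b N M fp lab fs sz own hv memb cur rt)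
    {c c' v : ℕ} (hc : 1 ≤ c) (hcM : c ≤ M) (hc' : 1 ≤ c') (hcM' : c' ≤ M) (hne : c ≠ c')
    (hs : fs (rt c) = fs (rt c')) (hv : v ∈ (groupSubtree lab fs memb rt N c).nodes)
    (hv' : v ∈ (groupSubtree lab fs memb rt N c').nodes) : v = lab (rt c) ∧ rt c = rt c' := by
  obtain ⟨j, h1, h2, h3, h4, -, rfl⟩ := (h.mem_nodes hc hcM).1 hv
  obtain ⟨j', h1', h2', h3', h4', -, h5⟩ := (h.mem_nodes hc' hcM').1 hv'
  obtain rfl := h.forest.label_inj h1' h2' h1 h2 (h4'.trans (hs.symm.trans h4.symm)) h5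
  obtain ⟨e1, e2⟩ := h.eq_root_of_mem_two hc hcM hc' hcM' hne h1 h2 h3 h3'
  exact ⟨by rw [← e1], e1.symm.trans e2⟩

/-- Equal subtrees have the same, split root. By `distinct` one of the two groups has a further
member; it would lie in both subtrees, which share nothing but the root. -/
theorem groupSubtree_inj (h : SlabGrouping T H o b N M fp lab fs sz own hv memb cur rt)
    {c c' : ℕ} (hc : 1 ≤ c) (hcM : c ≤ M) (hc' : 1 ≤ c') (hcM' : c' ≤ M)
    (he : groupSubtree lab fs memb rt N c = groupSubtree lab fs memb rt N c') : c = c' := by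
  by_contra hne
  have es : fs (rt c) = fs (rt c') := congrArg SlabSubtree.slab he
  have en := congrArg SlabSubtree.nodes he
  have m : lab (rt c) ∈ (groupSubtree lab fs memb rt N c).nodes := (h.isSubtree hc hcM).2.1
  have er := (h.mem_two hc hcM hc' hcM' hne es m (en ▸ m)).2
  have hS := h.split_of_mem_two hc hcM hc' hcM' hne er
  have hm0 := h.groups.memb_split _ (h.groups.rt_pos c hc hcM) (h.groups.rt_le c hc hcM) hS
  obtain ⟨j, j1, j2, j3⟩ := h.groups.distinct c c' hc hcM hc' hcM' hne er
  have hsl := h.slab_eq j1 j2 (by omega)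
  have hj : lab j ∈ (groupSubtree lab fs memb rt N c).nodes := by
    rcases j3 with j3 | j3
    · exact (h.mem_nodes hc hcM).2 ⟨j, j1, j2, Or.inr j3, by rw [hsl.1, j3], by
        have := hsl.2; rwa [j3] at this, rfl⟩
    · rw [en]
      exact (h.mem_nodes hc' hcM').2 ⟨j, j1, j2, Or.inr j3, by rw [hsl.1, j3], by
        have := hsl.2; rwa [j3] at this, rfl⟩
  have hl := (h.mem_two hc hcM hc' hcM' hne es hj (en ▸ hj)).1
  have hjs : fs j = fs (rt c) := by rcases j3 with j3 | j3 <;> rw [hsl.1, j3]; exact es.symm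
  have := h.forest.label_inj j1 j2 (h.groups.rt_pos c hc hcM) (h.groups.rt_le c hc hcM) hjs hl
  rw [this] at j3
  omega

theorem cover (h : SlabGrouping T H o b N M fp lab fs sz own hv memb cur rt) {i v : ℕ}
    (hx : v ∈ T.slabNodes H o i) : ∃ c, (1 ≤ c ∧ c ≤ M) ∧ fs (rt c) = i ∧
      v ∈ (groupSubtree lab fs memb rt N c).nodes := by
  obtain ⟨k, k1, k2, rfl, rfl⟩ := h.forest.exists_index i v hx
  by_cases hS : IsSplit b fp sz own hv k
  · obtain ⟨c, c1, c2, c3⟩ := h.groups.split_rt k k1 k2 hS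
    refine ⟨c, ⟨c1, c2⟩, by rw [c3], ?_⟩
    rw [← c3]
    exact (h.isSubtree c1 c2).2.1
  · have hm := h.groups.memb_pos k k1 k2 hS
    have hM := h.groups.memb_le k k2
    have := h.slab_eq k1 k2 hm
    exact ⟨memb k, ⟨hm, hM⟩, this.1.symm,
      (h.mem_nodes hm hM).2 ⟨k, k1, k2, Or.inr rfl, this.1, this.2, rfl⟩⟩

/-- A shared root is split, and by the invariant `interval` one block is enough: it runs from the
least to the greatest child in the group, since labels and indices of a slab are ordered alike. The
second block `[1 .. 0]` is empty. -/
theorem two_blocks (h : SlabGrouping T H o b N M fp lab fs sz own hv memb cur rt) {c c' : ℕ}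
    (hc : 1 ≤ c) (hcM : c ≤ M) (hc' : 1 ≤ c') (hcM' : c' ≤ M) (hne : c ≠ c')
    (hsh : OrdinalTree.SharesRoot (groupSubtree lab fs memb rt N c) (groupSubtree lab fs memb rt N c')) :
    T.AtMostTwoBlocks H o (groupSubtree lab fs memb rt N c) := by
  have hr1 := h.groups.rt_pos c hc hcM
  have hr2 := h.groups.rt_le c hc hcM
  have er : rt c = rt c' := h.forest.label_inj hr1 hr2 (h.groups.rt_pos c' hc' hcM')
    (h.groups.rt_le c' hc' hcM') hsh.1 hsh.2
  have hS := h.split_of_mem_two hc hcM hc' hcM' hne er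
  have hmem : ∀ k, 1 ≤ k → k ≤ N → fs k = fs (rt c) → fp k = rt c →
      (lab k ∈ (groupSubtree lab fs memb rt N c).nodes ↔ memb k = c) := by
    intro k k1 k2 k3 k4
    have hlt := h.forest.parent_lt k k1 k2
    constructor
    · intro hk
      obtain ⟨j, j1, j2, j3, j4, -, j5⟩ := (h.mem_nodes hc hcM).1 hk
      obtain rfl := h.forest.label_inj j1 j2 k1 k2 (j4.trans k3.symm) j5
      rcases j3 with j3 | j3
      · omega
      · exact j3
    · intro hk
      exact (h.mem_nodes hc hcM).2 ⟨k, k1, k2, Or.inr hk, k3, by omega, rfl⟩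
  set J := (Finset.Icc 1 N).filter fun j => fp j = rt c ∧ memb j = c with hJ
  have hJs : ∀ j ∈ J, (1 ≤ j ∧ j ≤ N) ∧ fs j = fs (rt c) ∧ fp j = rt c ∧ memb j = c := by
    intro j hj
    rw [hJ, Finset.mem_filter, Finset.mem_Icc] at hj
    refine ⟨hj.1, ?_, hj.2.1, hj.2.2⟩
    rw [← h.forest.parent_slab j hj.1.1 hj.1.2 (by omega), hj.2.1]
  rcases J.eq_empty_or_nonempty with hJe | hJn
  · refine ⟨1, 0, 1, 0, fun v hv => ?_⟩
    obtain ⟨k, k1, k2, k3, rfl, k4⟩ := h.forest.exists_child hr1 hr2 hv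
    rw [hmem k k1 k2 k3 k4]
    constructor
    · intro hk
      have : k ∈ J := by rw [hJ, Finset.mem_filter, Finset.mem_Icc]; exact ⟨⟨k1, k2⟩, k4, hk⟩
      rw [hJe] at this
      exact absurd this (Finset.notMem_empty _)
    · omega
  · obtain ⟨a1, a2, a3, a4⟩ := hJs _ (J.min'_mem hJn)
    obtain ⟨b1, b2, b3, b4⟩ := hJs _ (J.max'_mem hJn)
    refine ⟨lab (J.min' hJn), lab (J.max' hJn), 1, 0, fun v hv => ?_⟩
    obtain ⟨k, k1, k2, k3, rfl, k4⟩ := h.forest.exists_child hr1 hr2 hv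
    rw [hmem k k1 k2 k3 k4]
    have l1 := h.forest.label_lt_iff k1 k2 a1.1 a1.2 (k3.trans a2.symm)
    have l2 := h.forest.label_lt_iff b1.1 b1.2 k1 k2 (b2.trans k3.symm)
    constructor
    · intro hk
      have hkJ : k ∈ J := by rw [hJ, Finset.mem_filter, Finset.mem_Icc]; exact ⟨⟨k1, k2⟩, k4, hk⟩
      have := J.min'_le k hkJ
      have := J.le_max' k hkJ
      omega
    · intro hk
      rcases Nat.lt_trichotomy (J.min' hJn) k with hlt | heq | hgt
      · rcases Nat.lt_trichotomy k (J.max' hJn) with hlt' | heq' | hgt'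
        · rw [← b4]
          exact h.groups.interval _ k _ a1.1 hlt hlt' b1.2 (a3.trans b3.symm) (k4.trans b3.symm)
            (b3 ▸ hS) (a4.trans b4.symm) (by omega)
        · rw [heq']; exact b4
        · omega
      · rw [← heq]; exact a4
      · omega

/-- A light child of an index that is not split inherits its group. So an outgoing edge leads from a
chain index to its heavy child. If two such edges began at different indices, `heavy_child_le` would
place the heavy child of the smaller one inside the group. -/
theorem external_edge (h : SlabGrouping T H o b N M fp lab fs sz own hv memb cur rt) {c : ℕ}
    (hc : 1 ≤ c) (hcM : c ≤ M) {u u' v v' : ℕ}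
    (hu : u ∈ (groupSubtree lab fs memb rt N c).nodes)
    (hu' : u' ∈ (groupSubtree lab fs memb rt N c).nodes)
    (hur : u ≠ lab (rt c)) (hur' : u' ≠ lab (rt c))
    (hx : v ∉ (groupSubtree lab fs memb rt N c).nodes)
    (hx' : v' ∉ (groupSubtree lab fs memb rt N c).nodes)
    (he : T.IsSlabChild H o (fs (rt c)) u v) (he' : T.IsSlabChild H o (fs (rt c)) u' v') :
    u = u' ∧ v = v' := by
  have key : ∀ u v, u ∈ (groupSubtree lab fs memb rt N c).nodes → u ≠ lab (rt c) →
      v ∉ (groupSubtree lab fs memb rt N c).nodes → T.IsSlabChild H o (fs (rt c)) u v →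
      ∃ j k, (1 ≤ j ∧ j ≤ N) ∧ (1 ≤ k ∧ k ≤ N) ∧ u = lab j ∧ v = lab k ∧ memb j = c ∧ memb k ≠ c ∧
        fp k = j ∧ b < sz k ∧ b < sz j ∧ ¬IsSplit b fp sz own hv j := by
    intro u v hu hur hx he
    obtain ⟨j, j1, j2, j3, j4, j6, rfl⟩ := (h.mem_nodes hc hcM).1 hu
    have hjr : j ≠ rt c := by rintro rfl; exact hur rfl
    have hjm : memb j = c := by tauto
    rw [← j4] at he
    obtain ⟨k, k1, k2, k3, rfl, k4⟩ := h.forest.exists_child j1 j2 he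
    have hS := h.not_split j1 j2 (by omega)
    have hlt := h.forest.parent_lt k k1 k2
    have hkm : memb k ≠ c := fun hk => hx ((h.mem_nodes hc hcM).2
      ⟨k, k1, k2, Or.inr hk, k3.trans j4, by omega, rfl⟩)
    have hV : b < sz k := by
      by_contra hV
      apply hkm
      rw [← hjm, ← k4]
      exact h.groups.light_inherit k k1 k2 hV (by omega) (by rwa [k4])
    refine ⟨j, k, ⟨j1, j2⟩, ⟨k1, k2⟩, rfl, rfl, hjm, hkm, k4, hV, ?_, hS⟩
    have := h.splitForest.heavy_parent k k1 k2 hV (by omega)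
    rwa [k4] at this
  obtain ⟨j, k, j1, k1, rfl, rfl, j2, k2, e, Vk, Vj, Sj⟩ := key u v hu hur hx he
  obtain ⟨j', k', j1', k1', rfl, rfl, j2', k2', e', Vk', Vj', Sj'⟩ := key u' v' hu' hur' hx' he'
  have main : ∀ a a' k, 1 ≤ a → a < a' → a' ≤ N → b < sz a → b < sz a' →
      ¬IsSplit b fp sz own hv a → ¬IsSplit b fp sz own hv a' → memb a = memb a' → 1 ≤ k → k ≤ N →
      b < sz k → fp k = a → memb k = memb a' := fun a a' k g1 g2 g3 g4 g5 g6 g7 g8 g9 g10 g11 g12 =>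
    (h.groups.heavy_child_le h.splitForest le_rfl g1 g2 g3 g4 g6 g5 g7 g8 g9 g10 g11 g12).2
  rcases lt_trichotomy j j' with hlt | rfl | hlt
  · exact absurd ((main j j' k j1.1 hlt j1'.2 Vj Vj' Sj Sj' (j2.trans j2'.symm) k1.1 k1.2 Vk e).trans
      j2') k2
  · have := h.splitForest.chain_unique k k' k1.1 k1.2 k1'.1 k1'.2 Vk Vk' (e.trans e'.symm)
      (by omega) (by rwa [e])
    exact ⟨rfl, by rw [this]⟩
  · exact absurd ((main j' j k' j1'.1 hlt j1.2 Vj' Vj Sj' Sj (j2'.trans j2.symm) k1'.1 k1'.2 Vk'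
      e').trans j2) k2'

end SlabGrouping

/-! ### Counting the split indices -/

namespace PartialWeights

open Finset

variable {b N : ℕ} {fp wt sz own hv : ℕ → ℕ}

theorem sum_children (fp : ℕ → ℕ) (s X : Finset ℕ) (p : ℕ → Prop) [DecidablePred p] (f : ℕ → ℕ) :
    ∑ x ∈ X, ∑ j ∈ s.filter (fun j => fp j = x ∧ p j), f j =
      ∑ j ∈ s.filter (fun j => fp j ∈ X ∧ p j), f j := by
  rw [← sum_fiberwise_of_maps_to (s := s.filter (fun j => fp j ∈ X ∧ p j)) (t := X) (g := fp)
    (fun j hj => (mem_filter.1 hj).2.1)]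
  refine sum_congr rfl fun x hx => ?_
  rw [filter_filter]
  refine sum_congr (filter_congr fun j _ => ?_) fun _ _ => rfl
  constructor
  · rintro ⟨rfl, h⟩; exact ⟨⟨hx, h⟩, rfl⟩
  · rintro ⟨⟨-, h⟩, rfl⟩; exact ⟨rfl, h⟩

theorem own_of_light (h : PartialWeights b N 0 fp wt sz own hv) {x : ℕ} (hx : ¬b < sz x) :
    own x = sz x := by
  rw [h.own_eq, h.sz_eq]
  congr 2
  refine filter_congr fun j hj => ?_
  rw [mem_Ioc] at hj
  constructor
  · exact fun h => h.1
  · intro he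
    refine ⟨he, ?_⟩
    have := h.sz_le_parent (k := j) (by omega) hj.2
    rw [he] at this
    omega

theorem sz_eq_own_add (h : PartialWeights b N 0 fp wt sz own hv) (x : ℕ) :
    sz x = own x + ∑ j ∈ (Icc 1 N).filter (fun j => fp j = x ∧ b < sz j), sz j := by
  rw [h.sz_eq x, h.own_eq x, add_assoc]
  congr 1
  rw [← sum_filter_add_sum_filter_not ((Ioc 0 N).filter fun j => fp j = x) (fun j => sz j ≤ b),
    filter_filter, filter_filter]
  simp only [not_le]
  rfl

/-- The total size of the roots of a part of a forest that consists of entire trees. -/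
theorem sum_roots (h : PartialWeights b N 0 fp wt sz own hv) (p : ℕ → Prop) [DecidablePred p]
    (hp : ∀ j, 1 ≤ j → j ≤ N → fp j ≠ 0 → (p (fp j) ↔ p j))
    (hfp : ∀ k, 1 ≤ k → k ≤ N → fp k < k) :
    ∑ j ∈ (Icc 1 N).filter (fun j => p j ∧ fp j = 0), sz j =
      ∑ j ∈ (Icc 1 N).filter p, wt j := by
  have e : ∑ x ∈ (Icc 1 N).filter p, sz x = ∑ x ∈ (Icc 1 N).filter p, wt x +
      ∑ x ∈ (Icc 1 N).filter p, ∑ j ∈ (Icc 1 N).filter (fun j => fp j = x ∧ True), sz j := by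
    rw [← sum_add_distrib]
    refine sum_congr rfl fun x hx => ?_
    rw [mem_filter, mem_Icc] at hx
    rw [h.sz_eq x, if_pos (by omega)]
    simp only [and_true]
    rfl
  rw [sum_children] at e
  have e2 : (Icc 1 N).filter (fun j => fp j ∈ (Icc 1 N).filter p ∧ True) =
      ((Icc 1 N).filter p).filter (fun j => ¬fp j = 0) := by
    rw [filter_filter]
    refine filter_congr fun j hj => ?_
    rw [mem_Icc] at hj
    have := hfp j hj.1 hj.2
    rw [mem_filter, mem_Icc]
    constructor
    · rintro ⟨⟨h1, h2⟩, -⟩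
      exact ⟨(hp j hj.1 hj.2 (by omega)).1 h2, by omega⟩
    · rintro ⟨h1, h2⟩
      exact ⟨⟨by omega, (hp j hj.1 hj.2 h2).2 h1⟩, trivial⟩
  rw [e2, ← sum_filter_add_sum_filter_not ((Icc 1 N).filter p) (fun j => fp j = 0),
    filter_filter] at e
  omega

/-- The own sizes of the heavy indices add up to at most the total weight. -/
theorem sum_own_heavy_le (h : PartialWeights b N 0 fp wt sz own hv)
    (hfp : ∀ k, 1 ≤ k → k ≤ N → fp k < k) :
    ∑ x ∈ (Icc 1 N).filter (fun x => b < sz x), own x ≤ ∑ x ∈ Icc 1 N, wt x := by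
  have e : ∑ x ∈ (Icc 1 N).filter (fun x => b < sz x), sz x =
      ∑ x ∈ (Icc 1 N).filter (fun x => b < sz x), own x +
      ∑ x ∈ (Icc 1 N).filter (fun x => b < sz x),
        ∑ j ∈ (Icc 1 N).filter (fun j => fp j = x ∧ b < sz j), sz j := by
    rw [← sum_add_distrib]
    exact sum_congr rfl fun x _ => h.sz_eq_own_add x
  rw [sum_children] at e
  -- A heavy index with a parent has a heavy parent, so the double sum runs over the heavy indices
  -- that are not roots, and the sizes telescope to those of the heavy roots.
  have e2 : (Icc 1 N).filter (fun j => fp j ∈ (Icc 1 N).filter (fun x => b < sz x) ∧ b < sz j) =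
      ((Icc 1 N).filter (fun x => b < sz x)).filter (fun j => ¬fp j = 0) := by
    rw [filter_filter]
    refine filter_congr fun j hj => ?_
    rw [mem_Icc] at hj
    have := hfp j hj.1 hj.2
    have := h.sz_le_parent hj.1 hj.2
    rw [mem_filter, mem_Icc]
    omega
  rw [e2, ← sum_filter_add_sum_filter_not ((Icc 1 N).filter (fun x => b < sz x))
    (fun j => fp j = 0)] at e
  have e3 := h.sum_roots (fun _ => True) (fun _ _ _ _ => Iff.rfl) hfp
  have e4 : ∑ x ∈ ((Icc 1 N).filter (fun x => b < sz x)).filter (fun j => fp j = 0), sz x ≤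
      ∑ j ∈ (Icc 1 N).filter (fun j => True ∧ fp j = 0), sz j := by
    refine sum_le_sum_of_subset fun j => ?_
    simp +contextual
  rw [e3] at e4
  simp only [filter_true] at e4
  omega

/-- The children numbers of the split indices. -/
theorem sum_hv_split (h : PartialWeights b N 0 fp wt sz own hv)
    (hfp : ∀ k, 1 ≤ k → k ≤ N → fp k < k) :
    ∑ x ∈ (Icc 1 N).filter (IsSplit b fp sz own hv), hv x +
      ((Icc 1 N).filter fun j => b < sz j ∧ fp j = 0).card =
      ((Icc 1 N).filter (IsSplit b fp sz own hv)).card := by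
  have e : ∑ x ∈ (Icc 1 N).filter (fun x => b < sz x), hv x =
      ((Icc 1 N).filter fun j => b < sz j ∧ ¬fp j = 0).card := by
    have e1 : ∀ x ∈ (Icc 1 N).filter (fun x => b < sz x), hv x =
        ∑ j ∈ (Icc 1 N).filter (fun j => fp j = x ∧ b < sz j), 1 := by
      intro x _
      rw [h.hv_eq x, card_eq_sum_ones]; rfl
    rw [sum_congr rfl e1, sum_children, ← card_eq_sum_ones]
    congr 1
    refine filter_congr fun j hj => ?_
    rw [mem_Icc] at hj
    have := hfp j hj.1 hj.2
    have := h.sz_le_parent hj.1 hj.2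
    rw [mem_filter, mem_Icc]
    omega
  have e2 : ((Icc 1 N).filter fun j => b < sz j ∧ fp j = 0).card +
      ((Icc 1 N).filter fun j => b < sz j ∧ ¬fp j = 0).card =
      ((Icc 1 N).filter fun j => b < sz j).card := by
    rw [← filter_filter, ← filter_filter, card_filter_add_card_filter_not]
  have s1 : (((Icc 1 N).filter fun j => b < sz j).filter (IsSplit b fp sz own hv)) =
      (Icc 1 N).filter (IsSplit b fp sz own hv) := by
    rw [filter_filter]
    refine filter_congr fun j _ => ?_
    simp only [IsSplit]; omega
  have e3 := card_filter_add_card_filter_not (s := (Icc 1 N).filter fun j => b < sz j)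
    (IsSplit b fp sz own hv)
  have e4 := sum_filter_add_sum_filter_not ((Icc 1 N).filter fun j => b < sz j)
    (IsSplit b fp sz own hv) hv
  -- Heavy indices that are not split have one heavy child each and cancel from the count of edges
  -- between heavy indices.
  have e5 : ∑ x ∈ ((Icc 1 N).filter fun j => b < sz j).filter (fun x => ¬IsSplit b fp sz own hv x),
      hv x = (((Icc 1 N).filter fun j => b < sz j).filter
        (fun x => ¬IsSplit b fp sz own hv x)).card := by
    rw [card_eq_sum_ones]
    refine sum_congr rfl fun x hx => ?_
    rw [filter_filter, mem_filter, mem_Icc] at hx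
    by_contra hc
    exact hx.2.2 ⟨hx.1.1, hx.2.1, Or.inr (Or.inl hc)⟩
  rw [s1] at e3 e4
  omega

/-- By `sum_hv_split`, the number of heavy children, plus 1 for a root, is 1 on average over the
split indices. A split index with own size at most `b` contributes at least 2, so at most half of
the split indices are of this kind. -/
theorem card_split_le (h : PartialWeights b N 0 fp wt sz own hv)
    (hfp : ∀ k, 1 ≤ k → k ≤ N → fp k < k) :
    ((Icc 1 N).filter (IsSplit b fp sz own hv)).card ≤
      2 * ((Icc 1 N).filter fun x => b < sz x ∧ b < own x).card := by
  have e := h.sum_hv_split hfp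
  set S := (Icc 1 N).filter (IsSplit b fp sz own hv) with hS
  have r : ((Icc 1 N).filter fun j => b < sz j ∧ fp j = 0).card =
      ∑ x ∈ S, if fp x = 0 then 1 else 0 := by
    rw [← card_filter, hS, filter_filter]
    congr 1
    refine filter_congr fun j hj => ?_
    rw [mem_Icc] at hj
    simp only [IsSplit]; omega
  rw [r, ← sum_add_distrib,
    ← sum_filter_add_sum_filter_not S (fun x => b < own x)] at e
  have c := card_filter_add_card_filter_not (s := S) (fun x => b < own x)
  have l : 2 * (S.filter fun x => ¬b < own x).card ≤
      ∑ x ∈ S.filter (fun x => ¬b < own x), (hv x + if fp x = 0 then 1 else 0) := by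
    rw [mul_comm, ← smul_eq_mul]
    refine card_nsmul_le_sum _ _ _ fun x hx => ?_
    rw [mem_filter, hS, mem_filter] at hx
    obtain ⟨⟨-, -, hV, hx1⟩, hx2⟩ := hx
    -- Without heavy children, the size of `x` would be its own size, hence at most `b`.
    have h0 : hv x ≠ 0 := by
      intro h0
      rw [h.hv_eq, card_eq_zero] at h0
      have := h.sz_eq_own_add x
      have e : (Icc 1 N).filter (fun j => fp j = x ∧ b < sz j) = ∅ := h0
      rw [e, sum_empty] at this
      omega
    split_ifs <;> omega
  have m : (S.filter fun x => b < own x).card ≤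
      ((Icc 1 N).filter fun x => b < sz x ∧ b < own x).card := by
    refine card_le_card fun x => ?_
    simp only [hS, mem_filter, IsSplit]
    tauto
  omega

theorem mul_card_split_le (h : PartialWeights b N 0 fp wt sz own hv)
    (hfp : ∀ k, 1 ≤ k → k ≤ N → fp k < k) :
    b * ((Icc 1 N).filter (IsSplit b fp sz own hv)).card ≤ 2 * ∑ x ∈ Icc 1 N, wt x := by
  have h1 := h.card_split_le hfp
  have h2 := h.sum_own_heavy_le hfp
  have h3 : ((Icc 1 N).filter fun x => b < sz x ∧ b < own x).card * b ≤
      ∑ x ∈ (Icc 1 N).filter (fun x => b < sz x ∧ b < own x), own x := by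
    rw [← smul_eq_mul]
    exact card_nsmul_le_sum _ _ _ fun x hx => (mem_filter.1 hx).2.2.le
  have h4 : ∑ x ∈ (Icc 1 N).filter (fun x => b < sz x ∧ b < own x), own x ≤
      ∑ x ∈ (Icc 1 N).filter (fun x => b < sz x), own x := by
    refine sum_le_sum_of_subset fun x => ?_
    simp +contextual
  calc _ ≤ b * (2 * ((Icc 1 N).filter fun x => b < sz x ∧ b < own x).card) :=
        Nat.mul_le_mul_left _ h1
    _ = 2 * (((Icc 1 N).filter fun x => b < sz x ∧ b < own x).card * b) := by ring
    _ ≤ _ := by omega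

end PartialWeights

/-! ### Size of the groups and number of groups with heavy roots -/

namespace SlabGrouping

open Finset

variable {n : ℕ} {T : OrdinalTree n} {H o b N M : ℕ}
  {fp lab fs sz own hv memb cur rt acc : ℕ → ℕ} {cl : Finset ℕ}

/-- The members that are not counted are exactly the light children of members. The own sizes of all
members add up to the weight of the group plus the sizes of these children; for a light index own
size and size agree, so dropping them leaves the weight. -/
theorem sum_counted (h : SlabGrouping T H o b N M fp lab fs sz own hv memb cur rt) {c : ℕ}
    (hc : 1 ≤ c) : ∑ j ∈ (Icc 1 N).filter (fun j =>
      IsCounted fp (fun k => b < sz k) (IsSplit b fp sz own hv) j ∧ memb j = c), own j =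
    ∑ j ∈ (Icc 1 N).filter (fun j => memb j = c), if lab j = 0 then 0 else 1 := by
  have e : ∑ x ∈ (Icc 1 N).filter (fun j => memb j = c), own x =
      ∑ x ∈ (Icc 1 N).filter (fun j => memb j = c), (if lab x = 0 then 0 else 1) +
      ∑ x ∈ (Icc 1 N).filter (fun j => memb j = c),
        ∑ j ∈ (Icc 1 N).filter (fun j => fp j = x ∧ sz j ≤ b), sz j := by
    rw [← sum_add_distrib]
    refine sum_congr rfl fun x hx => ?_
    rw [mem_filter, mem_Icc] at hx
    rw [h.weights.own_eq x, if_pos (by omega)]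
    rfl
  rw [PartialWeights.sum_children] at e
  have e2 : (Icc 1 N).filter (fun j => fp j ∈ (Icc 1 N).filter (fun j => memb j = c) ∧ sz j ≤ b) =
      ((Icc 1 N).filter (fun j => memb j = c)).filter
        (fun j => ¬IsCounted fp (fun k => b < sz k) (IsSplit b fp sz own hv) j) := by
    rw [filter_filter]
    refine filter_congr fun j hj => ?_
    rw [mem_Icc] at hj
    have hlt := h.forest.parent_lt j hj.1 hj.2
    rw [mem_filter, mem_Icc]
    constructor
    · rintro ⟨⟨h1, h2⟩, h3⟩
      have hS := h.not_split (j := fp j) (by omega) (by omega) (by omega)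
      refine ⟨(h.groups.light_inherit j hj.1 hj.2 (by omega) (by omega) hS).trans h2, ?_⟩
      rintro ⟨-, h4 | h4 | h4⟩
      · omega
      · omega
      · exact hS h4
    · rintro ⟨h1, h2⟩
      have hS := h.not_split hj.1 hj.2 (by omega)
      have h3 : ¬b < sz j := fun h3 => h2 ⟨hS, Or.inl h3⟩
      have h4 : fp j ≠ 0 := fun h3 => h2 ⟨hS, Or.inr (Or.inl h3)⟩
      have h5 : ¬IsSplit b fp sz own hv (fp j) := fun h3 => h2 ⟨hS, Or.inr (Or.inr h3)⟩
      exact ⟨⟨by omega, (h.groups.light_inherit j hj.1 hj.2 h3 h4 h5).symm.trans h1⟩, by omega⟩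
  have e3 : ∑ j ∈ ((Icc 1 N).filter (fun j => memb j = c)).filter
        (fun j => ¬IsCounted fp (fun k => b < sz k) (IsSplit b fp sz own hv) j), sz j =
      ∑ j ∈ ((Icc 1 N).filter (fun j => memb j = c)).filter
        (fun j => ¬IsCounted fp (fun k => b < sz k) (IsSplit b fp sz own hv) j), own j := by
    refine sum_congr rfl fun j hj => ?_
    rw [filter_filter, mem_filter, mem_Icc] at hj
    have hS := h.not_split hj.1.1 hj.1.2 (by omega)
    exact (h.weights.own_of_light fun h3 => hj.2.2 ⟨hS, Or.inl h3⟩).symm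
  have e4 := sum_filter_add_sum_filter_not ((Icc 1 N).filter (fun j => memb j = c))
    (fun j => IsCounted fp (fun k => b < sz k) (IsSplit b fp sz own hv) j) own
  have e5 : (Icc 1 N).filter (fun j =>
      IsCounted fp (fun k => b < sz k) (IsSplit b fp sz own hv) j ∧ memb j = c) =
      ((Icc 1 N).filter (fun j => memb j = c)).filter
        (fun j => IsCounted fp (fun k => b < sz k) (IsSplit b fp sz own hv) j) := by
    rw [filter_filter]
    exact filter_congr fun j _ => and_comm
  rw [e5]
  rw [e2, e3] at e
  omega

theorem label_ne_zero (h : SlabGrouping T H o b N M fp lab fs sz own hv memb cur rt) {j : ℕ}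
    (hj : 1 ≤ j) (hjN : j ≤ N) (h0 : fp j ≠ 0) : lab j ≠ 0 := fun hl =>
  h0 (h.forest.dummy j hj hjN hl).1

theorem length_memberList (h : SlabGrouping T H o b N M fp lab fs sz own hv memb cur rt) {c : ℕ}
    (hc : 1 ≤ c) : (memberList memb rt N c).length =
    ∑ j ∈ (Icc 1 N).filter (fun j => memb j = c ∧ rt c ≠ j), if lab j = 0 then 0 else 1 := by
  have e : (Icc 1 N).filter (fun j => memb j = c ∧ rt c ≠ j) =
      (memberList memb rt N c).toFinset := by
    ext j
    simp only [memberList, mem_filter, mem_Icc, List.mem_toFinset, List.mem_filter,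
      List.mem_range'_1, decide_eq_true_eq]
    omega
  have hn : (memberList memb rt N c).Nodup := (List.nodup_range' (s := 1) (n := N)).filter _
  rw [← List.toFinset_card_of_nodup hn, ← e, card_eq_sum_ones]
  refine sum_congr rfl fun j hj => ?_
  rw [mem_filter, mem_Icc] at hj
  rw [if_neg]
  exact h.label_ne_zero hj.1.1 hj.1.2 (h.parent_mem hj.1.1 hj.1.2 (by omega)
    (by rw [hj.2.1]; exact hj.2.2.symm)).1

/-- The recorded size counts the members, plus 1 for a split root, which is not a member. A heavy
root that is not split is a member and has a parent, so it is no dummy and weighs 1. -/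
theorem card_nodes_le (h : SlabGrouping T H o b N M fp lab fs sz own hv memb cur rt)
    (ha : Accounting b N N fp own (fun k => b < sz k) (IsSplit b fp sz own hv) memb cur acc rt M cl)
    {c : ℕ} (hc : 1 ≤ c) (hcM : c ≤ M) (hV : b < sz (rt c)) :
    (groupSubtree lab fs memb rt N c).nodes.card ≤ 2 * b := by
  refine le_trans ?_ (ha.acc_le c hc hcM hV)
  rw [h.card_nodes hc hcM, ha.acc_eq c hc hcM, h.sum_counted hc, h.length_memberList hc]
  have hr1 := h.groups.rt_pos c hc hcM
  have hr2 := h.groups.rt_le c hc hcM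
  split_ifs with hS
  · rw [add_comm]
    refine Nat.add_le_add_left (sum_le_sum_of_subset fun j => ?_) _
    simp +contextual
  · have hm := h.groups.rt_memb c hc hcM hS
    have h0 : fp (rt c) ≠ 0 := fun h0 => hS (h.splitForest.split_root _ hr1 hr2 hV h0)
    have e : (Icc 1 N).filter (fun j => memb j = c) =
        insert (rt c) ((Icc 1 N).filter (fun j => memb j = c ∧ rt c ≠ j)) := by
      ext j
      simp only [mem_filter, mem_Icc, mem_insert]
      by_cases hj : j = rt c
      · subst hj; simp [hm, hr1, hr2]
      · simp [hj, Ne.symm hj]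
    rw [e, sum_insert (by simp), if_neg (h.label_ne_zero hr1 hr2 h0)]
    omega

/-- Dummy roots weigh 0, so the weight of the indices of a slab is its number of nodes. -/
theorem card_slab (h : SlabGrouping T H o b N M fp lab fs sz own hv memb cur rt) (i : ℕ) :
    (T.slab H o i).card =
      ∑ j ∈ (Icc 1 N).filter (fun j => fs j = i ∧ fp j = 0), sz j := by
  rw [h.weights.sum_roots (fun j => fs j = i)
    (fun j h1 h2 h3 => by rw [h.forest.parent_slab j h1 h2 h3]) h.forest.parent_lt]
  have e : ∀ j, (if lab j = 0 then 0 else 1) = if lab j ≠ 0 then 1 else 0 := by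
    intro j; split_ifs <;> simp_all
  simp only [e]
  rw [← card_filter, filter_filter]
  symm
  refine card_bij (fun j _ => lab j) ?_ ?_ ?_
  · intro j hj
    rw [mem_filter, mem_Icc] at hj
    obtain ⟨⟨h1, h2⟩, rfl, h3⟩ := hj
    rcases T.mem_slabNodes.1 (h.forest.label_mem j h1 h2) with h4 | h4
    · exact h4
    · exact absurd h4.1 h3
  · intro j hj k hk he
    rw [mem_filter, mem_Icc] at hj hk
    exact h.forest.label_inj hj.1.1 hj.1.2 hk.1.1 hk.1.2 (hj.2.1.trans hk.2.1.symm) he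
  · intro v hv
    obtain ⟨k, k1, k2, k3, rfl⟩ := h.forest.exists_index i v (T.mem_slabNodes.2 (Or.inl hv))
    refine ⟨k, ?_, rfl⟩
    rw [mem_filter, mem_Icc]
    exact ⟨⟨k1, k2⟩, k3, Nat.one_le_iff_ne_zero.1 (T.mem_slab.1 hv).1.1⟩

theorem sz_le_card_slab (h : SlabGrouping T H o b N M fp lab fs sz own hv memb cur rt) {k : ℕ}
    (hk : 1 ≤ k) (hkN : k ≤ N) : sz k ≤ (T.slab H o (fs k)).card := by
  induction k using Nat.strong_induction_on with
  | _ k ih =>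
    by_cases h0 : fp k = 0
    · rw [h.card_slab]
      exact single_le_sum (f := sz) (fun _ _ => Nat.zero_le _) (by simp; omega)
    · have hlt := h.forest.parent_lt k hk hkN
      have := ih (fp k) hlt (by omega) (by omega)
      rw [h.forest.parent_slab k hk hkN h0] at this
      exact (h.weights.sz_le_parent hk hkN).trans this

theorem card_slab_of_root (h : SlabGrouping T H o b N M fp lab fs sz own hv memb cur rt) {k : ℕ}
    (hk : 1 ≤ k) (hkN : k ≤ N) (h0 : fp k = 0) : (T.slab H o (fs k)).card = sz k := by
  rw [h.card_slab]
  refine sum_eq_single_of_mem k (by simp; omega) fun j hj hne => ?_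
  rw [mem_filter, mem_Icc] at hj
  exact absurd (h.forest.root_unique hj.1.1 hj.1.2 hk hkN hj.2.1 hj.2.2 h0) hne

/-- The group of a light root is an entire slab tree. -/
theorem nodes_of_light (h : SlabGrouping T H o b N M fp lab fs sz own hv memb cur rt) {c : ℕ}
    (hc : 1 ≤ c) (hcM : c ≤ M) (hV : ¬b < sz (rt c)) :
    (groupSubtree lab fs memb rt N c).nodes = T.slabNodes H o (fs (rt c)) := by
  have hr1 := h.groups.rt_pos c hc hcM
  have hr2 := h.groups.rt_le c hc hcM
  have h0 := h.groups.rt_light c hc hcM hV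
  have hm := h.groups.rt_memb c hc hcM fun hS => hV (h.splitForest.split_heavy _ hS)
  have key : ∀ k, 1 ≤ k → k ≤ N → fs k = fs (rt c) → ¬b < sz k ∧ memb k = c := by
    intro k
    induction k using Nat.strong_induction_on with
    | _ k ih =>
      intro k1 k2 hs
      by_cases hk0 : fp k = 0
      · rw [h.forest.root_unique k1 k2 hr1 hr2 hs hk0 h0]; exact ⟨hV, hm⟩
      · have hlt := h.forest.parent_lt k k1 k2
        obtain ⟨g1, g2⟩ := ih (fp k) hlt (by omega) (by omega)
          ((h.forest.parent_slab k k1 k2 hk0).trans hs)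
        have hle := h.weights.sz_le_parent k1 k2
        refine ⟨by omega, ?_⟩
        rw [← g2]
        exact h.groups.light_inherit k k1 k2 (by omega) hk0
          fun hS => g1 (h.splitForest.split_heavy _ hS)
  refine Subset.antisymm (h.isSubtree hc hcM).1 fun x hx => ?_
  obtain ⟨k, k1, k2, k3, rfl⟩ := h.forest.exists_index _ x hx
  have hkm := (key k k1 k2 k3).2
  refine (h.mem_nodes hc hcM).2 ⟨k, k1, k2, Or.inr hkm, k3, ?_, rfl⟩
  have := (h.slab_eq k1 k2 (by omega)).2
  rwa [hkm] at this

/-- The total weight is at most `3 * n`. So `b` times the number of split indices is at most `6 *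
n`, and their heavy children are no more numerous (`sum_hv_split`); by `count` this contributes `18
* n`. The closed groups have disjoint members of weight at least `b` each, which contributes `3 *
n`. -/
theorem mul_card_heavy_le (h : SlabGrouping T H o b N M fp lab fs sz own hv memb cur rt)
    (ha : Accounting b N N fp own (fun k => b < sz k) (IsSplit b fp sz own hv) memb cur acc rt M
      cl) : b * ((Icc 1 M).filter fun c => b < sz (rt c)).card ≤ 21 * n := by
  have hW : ∑ x ∈ Icc 1 N, (if lab x = 0 then 0 else 1) ≤ 3 * n := by
    refine le_trans (sum_le_sum (g := fun _ => 1) fun x _ => ?_) ?_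
    · split_ifs <;> omega
    · have := h.forest.card_le
      simpa using this
  have h1 := h.weights.mul_card_split_le h.forest.parent_lt
  have h2 : ((Icc 1 M).filter fun c => b < sz (rt c)).card ≤
      ((Icc 1 N).filter (IsSplit b fp sz own hv)).card +
      2 * ((Icc 1 N).filter fun j => b < sz j ∧ IsSplit b fp sz own hv (fp j)).card + cl.card :=
    (Nat.le_add_right _ _).trans ha.count
  have h3 : ((Icc 1 N).filter fun j => b < sz j ∧ IsSplit b fp sz own hv (fp j)).card ≤
      ((Icc 1 N).filter (IsSplit b fp sz own hv)).card := by
    rw [← h.weights.sum_hv_split h.forest.parent_lt]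
    refine le_trans (le_of_eq ?_) (Nat.le_add_right _ _)
    have e1 : ∀ x ∈ (Icc 1 N).filter (IsSplit b fp sz own hv), hv x =
        ∑ j ∈ (Icc 1 N).filter (fun j => fp j = x ∧ b < sz j), 1 := by
      intro x _
      rw [h.weights.hv_eq x, card_eq_sum_ones]; rfl
    rw [sum_congr rfl e1, PartialWeights.sum_children, ← card_eq_sum_ones]
    congr 1
    refine filter_congr fun j hj => ?_
    rw [mem_Icc] at hj
    have := h.forest.parent_lt j hj.1 hj.2
    rw [mem_filter, mem_Icc]
    constructor
    · rintro ⟨h1, h2⟩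
      exact ⟨⟨⟨h2.1, by omega⟩, h2⟩, h1⟩
    · rintro ⟨⟨-, h2⟩, h1⟩
      exact ⟨h1, h2⟩
  have h4 : b * cl.card ≤ 3 * n := by
    refine le_trans ?_ hW
    rw [mul_comm, ← smul_eq_mul]
    calc cl.card • b ≤ ∑ c ∈ cl, ∑ j ∈ (Icc 1 N).filter (fun j => memb j = c),
          (if lab j = 0 then 0 else 1) := by
          refine card_nsmul_le_sum _ _ _ fun c hc => ?_
          have g1 := ha.cl_full c hc
          obtain ⟨g2, g3⟩ := ha.cl_mem c hc
          rw [ha.acc_eq c g2 g3, h.sum_counted g2] at g1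
          have g4 := g1.1
          -- The size exceeds `b`, so the members weigh at least `b` even without the unit for a
          -- split root.
          split_ifs at g4 <;> omega
      _ = ∑ c ∈ cl, ∑ j ∈ (Icc 1 N).filter (fun j => memb j = c ∧ True),
          (if lab j = 0 then 0 else 1) := by simp only [and_true]
      _ = _ := PartialWeights.sum_children _ _ _ _ _
      _ ≤ _ := sum_le_sum_of_subset (filter_subset _ _)
  calc _ ≤ b * (3 * ((Icc 1 N).filter (IsSplit b fp sz own hv)).card + cl.card) :=
        Nat.mul_le_mul_left _ (by omega)
    _ = 3 * (b * ((Icc 1 N).filter (IsSplit b fp sz own hv)).card) + b * cl.card := by ring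
    _ ≤ _ := by omega

end SlabGrouping

/-! ### Connections through promoted s-nodes -/

namespace OrdinalTree

open Finset

variable {n : ℕ} {T : OrdinalTree n}

theorem exists_depth {v d : ℕ} (h1 : 1 ≤ v) (hn : v ≤ n) (hd : d ≤ T.depth v) :
    ∃ u, 1 ≤ u ∧ u ≤ n ∧ T.depth u = d := by
  induction v using Nat.strong_induction_on with
  | _ v ih =>
    rcases Nat.lt_or_ge (T.depth v) (d + 1) with h | h
    · exact ⟨v, h1, hn, by omega⟩
    · have h2 : 2 ≤ v := by
        by_contra hc
        obtain rfl : v = 1 := by omega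
        rw [T.depth_one] at h; omega
      have := T.depth_eq h2 hn
      have hl := T.parent_lt h1 hn
      exact ih _ hl (T.one_le_parent h2 hn) (by omega) (by omega)

/-- By `hu`, the s-node determines `μ`. If it is not the root of `μ'`, it also determines `μ'`, by
disjointness. If it is the root, then `μ'` determines the connection, and `μ'` is fat because a
skinny subtree of a later slab has the dummy root. -/
theorem IsTreeSlabbing.card_promotedConnections_le {H B o : ℕ} {D : Finset SlabSubtree}
    (h : T.IsTreeSlabbing H B o D)
    (hu : ∀ μ ∈ D, ∀ μ' ∈ D, μ.slab = μ'.slab → ∀ v, v ≠ 0 → v ∈ μ.nodes → v ∈ μ'.nodes →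
      T.depth v = μ.slab * H + o → μ = μ') :
    (T.promotedConnections H o D).card ≤ (T.sNodes H o).card + (D.filter (T.IsFat H B o)).card := by
  classical
  have hH : 1 ≤ H := h.offset_mem.1.trans h.offset_mem.2
  have key : ∀ x ∈ T.promotedConnections H o D,
      x.1.1 ∈ D ∧ x.1.2 ∈ D ∧ 1 ≤ x.2 ∧ T.ThroughPromoted H o x.1.1 x.1.2 x.2 := by
    intro x hx
    simp only [promotedConnections, mem_filter, mem_product, mem_Icc] at hx
    exact ⟨hx.1.1.1, hx.1.1.2, hx.1.2.1, hx.2⟩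
  have hslab : ∀ {i j : ℕ}, i * H + o = j * H + o → i = j := fun he =>
    Nat.eq_of_mul_eq_mul_right hH (by omega)
  have huu : ∀ x ∈ T.promotedConnections H o D, ∀ y ∈ T.promotedConnections H o D,
      x.2 = y.2 → x.1.1 = y.1.1 ∧ x.1.2.slab = y.1.2.slab := by
    intro x hx y hy he
    obtain ⟨a1, a2, a3, a4, a5, a6, a7, a8⟩ := key x hx
    obtain ⟨b1, b2, b3, b4, b5, b6, b7, b8⟩ := key y hy
    rw [← he] at b6 b7
    have hs := hslab (a6.symm.trans b6)
    exact ⟨hu _ a1 _ b1 hs x.2 (by omega) a7 b7 a6, by rw [a4, b4, hs]⟩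
  have hcard := card_filter_add_card_filter_not (s := T.promotedConnections H o D)
    (fun x => x.2 ≠ x.1.2.root)
  have c1 : ((T.promotedConnections H o D).filter fun x => x.2 ≠ x.1.2.root).card ≤
      (T.sNodes H o).card := by
    refine card_le_card_of_injOn (fun x => x.2) ?_ ?_
    · intro x hx
      rw [mem_coe, mem_filter] at hx
      exact (key x hx.1).2.2.2.2.1
    · intro x hx y hy he
      rw [mem_coe, mem_filter] at hx hy
      obtain ⟨e1, e2⟩ := huu x hx.1 y hy.1 he
      have hx' := key x hx.1
      have hy' := key y hy.1
      have e3 : x.1.2 = y.1.2 := by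
        by_contra hne
        exact hx.2 (h.disjoint _ hx'.2.1 _ hy'.2.1 hne e2 x.2 hx'.2.2.2.2.2.2.2
          (by rw [show x.2 = y.2 from he]; exact hy'.2.2.2.2.2.2.2)).1
      exact Prod.ext (Prod.ext e1 e3) he
  have c2 : ((T.promotedConnections H o D).filter fun x => ¬x.2 ≠ x.1.2.root).card ≤
      (D.filter (T.IsFat H B o)).card := by
    refine card_le_card_of_injOn (fun x => x.1.2) ?_ ?_
    · intro x hx
      rw [mem_coe, mem_filter, not_not] at hx
      obtain ⟨a1, a2, a3, a4, a5, a6, a7, a8⟩ := key x hx.1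
      rw [mem_coe, mem_filter]
      refine ⟨a2, (h.skinny_or_fat _ a2).resolve_left fun hs => ?_⟩
      have hsub := h.subtree _ a2
      have h0 : 0 ∈ x.1.2.nodes := by
        rw [hs.2, T.mem_slabNodes]
        refine Or.inr ⟨rfl, by omega, fun he => ?_⟩
        have := hsub.mem_slab a8 (by omega)
        rw [he] at this
        exact notMem_empty _ this
      have := hsub.root_eq_zero h0
      omega
    · intro x hx y hy he
      rw [mem_coe, mem_filter, not_not] at hx hy
      have e : x.2 = y.2 := by rw [hx.2, hy.2, show x.1.2 = y.1.2 from he]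
      exact Prod.ext (Prod.ext (huu x hx.1 y hy.1 e).1 he) e
  omega

end OrdinalTree

/-! ### Assembling the properties of the decomposition -/

namespace SlabGrouping

open Finset

variable {n : ℕ} {T : OrdinalTree n} {H B o b N M : ℕ}
  {fp lab fs sz own hv memb cur rt acc : ℕ → ℕ} {cl : Finset ℕ} {D : Finset SlabSubtree}

theorem skinny_of_light (h : SlabGrouping T H o b N M fp lab fs sz own hv memb cur rt)
    (hbB : b ≤ B) {c : ℕ} (hc : 1 ≤ c) (hcM : c ≤ M) (hV : ¬b < sz (rt c)) :
    T.IsSkinny H B o (groupSubtree lab fs memb rt N c) := by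
  refine ⟨?_, h.nodes_of_light hc hcM hV⟩
  have := h.card_slab_of_root (h.groups.rt_pos c hc hcM) (h.groups.rt_le c hc hcM)
    (h.groups.rt_light c hc hcM hV)
  have e : (groupSubtree lab fs memb rt N c).slab = fs (rt c) := rfl
  rw [e, this]; omega

theorem lt_card_slab (h : SlabGrouping T H o b N M fp lab fs sz own hv memb cur rt) {c : ℕ}
    (hc : 1 ≤ c) (hcM : c ≤ M) (hV : b < sz (rt c)) : b < (T.slab H o (fs (rt c))).card :=
  hV.trans_le (h.sz_le_card_slab (h.groups.rt_pos c hc hcM) (h.groups.rt_le c hc hcM))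

/-- Here `b` stands for `min B n`. A heavy root forces a slab of more than `b` nodes, which is
possible only for `b < n`; then `b = B`, and the slab is fat. -/
theorem isTreeSlabbing (h : SlabGrouping T H o b N M fp lab fs sz own hv memb cur rt)
    (ha : Accounting b N N fp own (fun k => b < sz k) (IsSplit b fp sz own hv) memb cur acc rt M cl)
    (hb : 1 ≤ b) (hbB : b ≤ B) (hbn : b < n → b = B) (h1 : 1 ≤ o) (h2 : o ≤ H)
    (hmin : ∀ o', 1 ≤ o' → o' ≤ H → (T.sNodes H o).card ≤ (T.sNodes H o').card)
    (hD : ∀ μ, μ ∈ D ↔ ∃ c, (1 ≤ c ∧ c ≤ M) ∧ groupSubtree lab fs memb rt N c = μ) :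
    T.IsTreeSlabbing H B o D := by
  have hsub : ∀ μ ∈ D, T.IsSubtree H o μ := by
    intro μ hμ
    obtain ⟨c, ⟨c1, c2⟩, rfl⟩ := (hD μ).1 hμ
    exact h.isSubtree c1 c2
  have hdis : ∀ μ ∈ D, ∀ μ' ∈ D, μ ≠ μ' → μ.slab = μ'.slab →
      ∀ v, v ∈ μ.nodes → v ∈ μ'.nodes → v = μ.root ∧ v = μ'.root := by
    intro μ hμ μ' hμ' hne hs v hv hv'
    obtain ⟨c, ⟨c1, c2⟩, rfl⟩ := (hD μ).1 hμ
    obtain ⟨c', ⟨c1', c2'⟩, rfl⟩ := (hD μ').1 hμ'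
    obtain ⟨e1, e2⟩ := h.mem_two c1 c2 c1' c2' (by rintro rfl; exact hne rfl) hs hv hv'
    exact ⟨e1, by rw [e1, e2]; rfl⟩
  have hsn : ∀ i, (T.slab H o i).card ≤ n := fun i =>
    (card_le_card (filter_subset _ _)).trans (by simp)
  exact
    { offset_mem := ⟨h1, h2⟩
      offset_min := hmin
      subtree := hsub
      cover := by
        intro i v hv
        obtain ⟨c, hc, e, hm⟩ := h.cover hv
        exact ⟨_, (hD _).2 ⟨c, hc, rfl⟩, e, hm⟩
      disjoint := hdis
      size_le := by
        intro μ hμ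
        obtain ⟨c, ⟨c1, c2⟩, rfl⟩ := (hD μ).1 hμ
        by_cases hV : b < sz (rt c)
        · have := h.card_nodes_le ha c1 c2 hV
          omega
        · have hs := h.skinny_of_light hbB c1 c2 hV
          have := T.card_slabNodes_le (H := H) (o := o) (i := fs (rt c))
          have h3 : (T.slab H o (fs (rt c))).card ≤ B := hs.1
          have h4 : (groupSubtree lab fs memb rt N c).nodes = T.slabNodes H o (fs (rt c)) := hs.2
          rw [h4]; omega
      height_le := fun μ hμ => (hsub μ hμ).height_le
      pure_or_glued := fun μ hμ => (hsub μ hμ).pure_or_glued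
      skinny_or_fat := by
        intro μ hμ
        obtain ⟨c, ⟨c1, c2⟩, rfl⟩ := (hD μ).1 hμ
        by_cases hV : b < sz (rt c)
        · right
          have := h.lt_card_slab c1 c2 hV
          have h3 := hsn (fs (rt c))
          rw [hbn (by omega)] at this
          exact this
        · exact Or.inl (h.skinny_of_light hbB c1 c2 hV)
      connection := by
        intro μ hμ μ' hμ' hne hc
        have d1 := hdis μ hμ μ' hμ' hne
        have d2 := hdis μ' hμ' μ hμ hne.symm
        rcases hc with hc | hc
        · rcases OrdinalTree.connection_cases h1 h2 (hsub μ hμ) (hsub μ' hμ') d1 hc with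
            e | e | e | e
          · exact Or.inl e
          · exact Or.inr (Or.inl (Or.inl e))
          · exact Or.inr (Or.inr (Or.inl (Or.inl e)))
          · exact Or.inr (Or.inr (Or.inr e))
        · rcases OrdinalTree.connection_cases h1 h2 (hsub μ' hμ') (hsub μ hμ) d2 hc with
            e | e | e | e
          · exact Or.inl ⟨e.1.symm, e.2.symm⟩
          · exact Or.inr (Or.inl (Or.inr e))
          · exact Or.inr (Or.inr (Or.inl (Or.inr e)))
          · exact Or.inr (Or.inr (Or.inr e.symm))
      two_blocks := by
        intro μ hμ μ' hμ' hne hs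
        obtain ⟨c, ⟨c1, c2⟩, rfl⟩ := (hD μ).1 hμ
        obtain ⟨c', ⟨c1', c2'⟩, rfl⟩ := (hD μ').1 hμ'
        exact h.two_blocks c1 c2 c1' c2' (by rintro rfl; exact hne rfl) hs
      external_edge := by
        intro μ hμ u u' v v' hu hu' hur hur' hv hv' he he'
        obtain ⟨c, ⟨c1, c2⟩, rfl⟩ := (hD μ).1 hμ
        exact h.external_edge c1 c2 hu hu' hur hur' hv hv' he he' }

/-- A node in two groups is split, hence of size more than `b ≥ 1`; but a node on the last level has
no children in its slab and size 1. -/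
theorem unique_of_last (h : SlabGrouping T H o b N M fp lab fs sz own hv memb cur rt)
    (hb : 1 ≤ b) {c c' v : ℕ} (hc : 1 ≤ c) (hcM : c ≤ M) (hc' : 1 ≤ c') (hcM' : c' ≤ M)
    (hs : fs (rt c) = fs (rt c')) (h0 : v ≠ 0)
    (hv : v ∈ (groupSubtree lab fs memb rt N c).nodes)
    (hv' : v ∈ (groupSubtree lab fs memb rt N c').nodes)
    (hl : T.depth v = fs (rt c) * H + o) : c = c' := by
  by_contra hne
  obtain ⟨rfl, e⟩ := h.mem_two hc hcM hc' hcM' hne hs hv hv'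
  have hr1 := h.groups.rt_pos c hc hcM
  have hV := (h.split_of_mem_two hc hcM hc' hcM' hne e).2.1
  rw [h.weights.sz_eq, filter_false_of_mem, sum_empty] at hV
  · split_ifs at hV <;> omega
  · intro k hk
    rw [mem_Ioc] at hk
    exact h.forest.no_child_of_last hr1 h0 hl k (by omega) hk.2

/-- There is one such group per slab tree at most, and each slab `i + 1` is mapped to an s-node on
its first level, which exists because the slab is nonempty. -/
theorem card_light_le (h : SlabGrouping T H o b N M fp lab fs sz own hv memb cur rt)
    (h1 : 1 ≤ o) (h2 : o ≤ H) :
    ((Icc 1 M).filter fun c => ¬b < sz (rt c)).card ≤ 1 + (T.sNodes H o).card := by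
  have e : ((Icc 1 M).filter fun c => ¬b < sz (rt c)).card ≤
      (insert 0 ((T.sNodes H o).image fun v => (T.depth v + H - o) / H)).card := by
    refine card_le_card_of_injOn (fun c => fs (rt c)) ?_ ?_
    · intro c hc
      rw [mem_coe, mem_filter, mem_Icc] at hc
      obtain ⟨⟨c1, c2⟩, hV⟩ := hc
      have hr1 := h.groups.rt_pos c c1 c2
      have hr2 := h.groups.rt_le c c1 c2
      have h0 := h.groups.rt_light c c1 c2 hV
      rw [mem_coe, mem_insert, mem_image]
      by_cases hz : fs (rt c) = 0
      · exact Or.inl hz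
      · right
        rcases h.forest.root _ hr1 hr2 h0 with hl | hl
        · have hm := h.forest.label_mem _ hr1 hr2
          rw [hl, T.mem_slabNodes] at hm
          obtain ⟨v, hv⟩ : (T.slab H o (fs (rt c))).Nonempty := by
            rcases hm with hm | hm
            · exact absurd hm T.zero_notMem_slab
            · exact nonempty_iff_ne_empty.2 hm.2.2
          rw [T.mem_slab] at hv
          obtain ⟨i, hi⟩ : ∃ i, fs (rt c) = i + 1 := ⟨fs (rt c) - 1, by omega⟩
          rw [hi, Nat.add_mul] at hv
          obtain ⟨u, u1, u2, u3⟩ := T.exists_depth (d := i * H + o) hv.1.1 hv.1.2 (by omega)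
          refine ⟨u, ?_, ?_⟩
          · rw [T.mem_sNodes_iff h1 h2, levelRes_eq_iff h1 h2, u3]
            exact ⟨⟨u1, u2⟩, by omega, ⟨i, by rw [mul_comm]; omega⟩⟩
          · change _ = fs (rt c)
            rw [u3, hi, show i * H + o + H - o = (i + 1) * H by rw [Nat.add_mul]; omega]
            exact Nat.mul_div_cancel _ (by omega)
        · exact absurd hl.1 hz
    · intro c hc c' hc' he
      rw [mem_coe, mem_filter, mem_Icc] at hc hc'
      have hr := h.forest.root_unique (h.groups.rt_pos c hc.1.1 hc.1.2)
        (h.groups.rt_le c hc.1.1 hc.1.2) (h.groups.rt_pos c' hc'.1.1 hc'.1.2)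
        (h.groups.rt_le c' hc'.1.1 hc'.1.2) he (h.groups.rt_light c hc.1.1 hc.1.2 hc.2)
        (h.groups.rt_light c' hc'.1.1 hc'.1.2 hc'.2)
      by_contra hne
      exact hc.2 (h.split_of_mem_two hc.1.1 hc.1.2 hc'.1.1 hc'.1.2 hne hr).2.1
  refine e.trans ((card_insert_le _ _).trans ?_)
  have := card_image_le (s := T.sNodes H o) (f := fun v => (T.depth v + H - o) / H)
  omega

/-- The groups with heavy roots contribute `21 * n`, a bound that passes from `B` to `H` since `H ≤
B`; the s-nodes contribute `n`, and slab `0` the summand `H`. -/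
theorem counts (h : SlabGrouping T H o b N M fp lab fs sz own hv memb cur rt)
    (ha : Accounting b N N fp own (fun k => b < sz k) (IsSplit b fp sz own hv) memb cur acc rt M cl)
    (hb : 1 ≤ b) (hbB : b ≤ B) (hbn : b < n → b = B) (h1 : 1 ≤ o) (h2 : o ≤ H) (hHB : H ≤ B)
    (hmin : ∀ o', 1 ≤ o' → o' ≤ H → (T.sNodes H o).card ≤ (T.sNodes H o').card)
    (hD : ∀ μ, μ ∈ D ↔ ∃ c, (1 ≤ c ∧ c ≤ M) ∧ groupSubtree lab fs memb rt N c = μ) :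
    H * D.card ≤ 22 * n + H ∧ B * (D.filter (T.IsFat H B o)).card ≤ 21 * n ∧
      H * (T.promotedConnections H o D).card ≤ 22 * n := by
  classical
  have hsn := T.mul_card_sNodes_le hmin
  have hV : B * ((Icc 1 M).filter fun c => b < sz (rt c)).card ≤ 21 * n := by
    by_cases hbn' : b < n
    · have := h.mul_card_heavy_le ha
      rwa [hbn hbn'] at this ⊢
    -- If `n ≤ b`, no group has a heavy root, because no slab has more than `n` nodes.
    · rw [card_eq_zero.2 (filter_eq_empty_iff.2 fun c hc hV => ?_)]
      · omega
      · rw [mem_Icc] at hc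
        have h3 := h.lt_card_slab hc.1 hc.2 hV
        have h4 : (T.slab H o (fs (rt c))).card ≤ n :=
          (card_le_card (filter_subset _ _)).trans (by simp)
        omega
  have hDe : D = (Icc 1 M).image (groupSubtree lab fs memb rt N) := by
    ext μ
    rw [hD, mem_image]
    simp only [mem_Icc]
  have hM : D.card ≤ ((Icc 1 M).filter fun c => b < sz (rt c)).card + (1 + (T.sNodes H o).card) := by
    rw [hDe]
    refine card_image_le.trans ?_
    rw [← card_filter_add_card_filter_not (s := Icc 1 M) (fun c => b < sz (rt c))]
    exact Nat.add_le_add_left (h.card_light_le h1 h2) _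
  have hF : (D.filter (T.IsFat H B o)).card ≤
      ((Icc 1 M).filter fun c => b < sz (rt c)).card := by
    refine le_trans (card_le_card ?_)
      (card_image_le (s := (Icc 1 M).filter fun c => b < sz (rt c))
        (f := groupSubtree lab fs memb rt N))
    intro μ hμ
    rw [mem_filter, hD] at hμ
    obtain ⟨⟨c, hc, rfl⟩, hf⟩ := hμ
    refine mem_image_of_mem _ ?_
    rw [mem_filter, mem_Icc]
    refine ⟨hc, ?_⟩
    by_contra hV'
    exact absurd (h.skinny_of_light hbB hc.1 hc.2 hV').1 (not_le.2 hf)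
  have hT := h.isTreeSlabbing ha hb hbB hbn h1 h2 hmin hD
  have hP := hT.card_promotedConnections_le (by
    intro μ hμ μ' hμ' hs v hv0 hv hv' hd
    obtain ⟨c, ⟨c1, c2⟩, rfl⟩ := (hD μ).1 hμ
    obtain ⟨c', ⟨c1', c2'⟩, rfl⟩ := (hD μ').1 hμ'
    rw [h.unique_of_last hb c1 c2 c1' c2' hs hv0 hv hv' hd])
  have hVH := (Nat.mul_le_mul_right ((Icc 1 M).filter fun c => b < sz (rt c)).card hHB).trans hV
  refine ⟨?_, (Nat.mul_le_mul_left _ hF).trans hV, ?_⟩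
  · have := Nat.mul_le_mul_left H hM
    rw [Nat.mul_add, Nat.mul_add, mul_one] at this
    omega
  · have := Nat.mul_le_mul_left H (hP.trans (Nat.add_le_add_left hF _))
    rw [Nat.mul_add] at this
    omega

end SlabGrouping

/-! ### The complete program and its running time -/

theorem WordRAM.Phase.run_of_not_writes {K : ℕ} {A : WordRAM.Arrays} (ph : WordRAM.Phase)
    {a : WordRAM.Arr} (h : ph.body.writes a = false) : ph.run K A a = A a :=
  (ph.run_induction (fun _ _ => True) rfl trivial fun _ _ _ _ _ => trivial).2 a h

namespace WordRAM

open OrdinalTree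

/-- The phases of tree slabbing. -/
def slabbingPhases : List Phase :=
  [levelPhase, offsetPhase, forestPhase, sizePhase, groupPhase, countPhase, headerPhase, fillPhase]

/-- The arrays before the first phase. -/
def initialArrays {n : ℕ} (T : OrdinalTree n) (h b : ℕ) : Arrays
  | .par, x => if x ∈ Finset.Icc 1 n then T.parent x else 0
  | .nn, x => if x = 0 then n else 0
  | .hh, x => if x = 0 then h else 0
  | .bb, x => if x = 0 then b else 0
  | _, _ => 0

/-- The bound `20 * n` has room for everything: at most `3 * n` indices and as many groups, sizes up
to `2 * b` plus one own size, and an output of at most `15 * n + 1` words. After each phase the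
arrays are generalized, so that only its specification and the frame conditions remain. -/
theorem runPhases_slabbing {n K H b : ℕ} (T : OrdinalTree n) (hK : K = 20 * n) (hH : 3 ≤ H)
    (hb : 1 ≤ b) (hbn : b ≤ n) :
    ∃ (o N M : ℕ) (fp lab fs sz own hv memb cur rt acc : ℕ → ℕ) (cl : Finset ℕ),
      (1 ≤ o ∧ o ≤ H) ∧
      (∀ o', 1 ≤ o' → o' ≤ H → (T.sNodes H o).card ≤ (T.sNodes H o').card) ∧
      SlabGrouping T H o b N M fp lab fs sz own hv memb cur rt ∧
      Accounting b N N fp own (fun k => b < sz k) (IsSplit b fp sz own hv) memb cur acc rt M cl ∧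
      runPhases K slabbingPhases (initialArrays T (min H n) b) .out 0 = M ∧
      ∀ c, c < M → ∀ j x, (groupBlock lab fs memb rt N N (c + 1))[j]? = some x →
        runPhases K slabbingPhases (initialArrays T (min H n) b) .out
          (blockEnd memb rt N c + 1 + j) = x := by
  have hn := T.pos
  generalize hA0 : initialArrays T (min H n) b = A0
  have z : ∀ a, a ≠ .par → a ≠ .nn → a ≠ .hh → a ≠ .bb → ∀ x, A0 a x = 0 := by
    intro a h1 h2 h3 h4 x
    rw [← hA0]
    cases a <;> first | rfl | contradiction
  have hpar : ∀ v, 1 ≤ v → v ≤ n → A0 .par v = T.parent v := by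
    intro v h1 h2
    rw [← hA0]
    exact if_pos (Finset.mem_Icc.2 ⟨h1, h2⟩)
  have hnn : A0 .nn 0 = n := by rw [← hA0]; rfl
  have hhh : A0 .hh 0 = min H n := by rw [← hA0]; rfl
  have hbb : A0 .bb 0 = b := by rw [← hA0]; rfl
  clear hA0
  simp only [slabbingPhases, runPhases]
  obtain ⟨l1, l2⟩ := levelPhase_spec (K := K) T (by omega) hnn hhh (by omega) hpar
    (z .cnt (by decide) (by decide) (by decide) (by decide))
  have F1 : ∀ a, levelPhase.body.writes a = false → levelPhase.run K A0 a = A0 a :=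
    fun a => Phase.run_of_not_writes _
  generalize levelPhase.run K A0 = A1 at l1 l2 F1 ⊢
  obtain ⟨⟨o1, o2⟩, o3⟩ := offsetPhase_spec (K := K) (A := A1) (H := min H n)
    (by rw [F1 _ rfl, hhh]) (by omega)
    (by rw [F1 _ rfl, z .off (by decide) (by decide) (by decide) (by decide)])
  have F2 : ∀ a, offsetPhase.body.writes a = false → offsetPhase.run K A1 a = A1 a :=
    fun a => Phase.run_of_not_writes _
  generalize offsetPhase.run K A1 = A2 at o1 o2 o3 F2 ⊢
  generalize hO : A2 .off 0 = o at o1 o2 o3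
  have hmin : ∀ o', 1 ≤ o' → o' ≤ H → (T.sNodes H o).card ≤ (T.sNodes H o').card := by
    have e : ∀ r, 1 ≤ r → r ≤ H → A1 .cnt r = (T.sNodes H r).card := by
      intro r h1 h2
      rw [l2]
      congr 1
      ext v
      rw [T.mem_sNodes_iff h1 h2, Finset.mem_filter, Finset.mem_Icc]
      refine and_congr_right fun hv => ?_
      rw [levelRes_min (by have := T.depth_lt hv.1 hv.2; omega)]
    intro o' h1 h2
    rw [← e o o1 (by omega), ← e o' h1 h2]
    rcases Nat.lt_or_ge n o' with h3 | h3
    -- Offsets above `n` are not tried. But if there are any, offset `n` is tried and has no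
    -- s-nodes, since all depths are below `n`; so the minimum found is `0`.
    · have h4 := o3 n hn (by omega)
      have h5 : A1 .cnt n = 0 := by
        rw [l2, Finset.card_eq_zero, Finset.filter_eq_empty_iff]
        intro v hv hc
        rw [Finset.mem_Icc] at hv
        have := T.depth_lt hv.1 hv.2
        have := levelRes_le_self (H := min H n) (d := T.depth v)
        omega
      omega
    · exact o3 o' h1 (by omega)
  have hforest := forestPhase_spec (K := K) (A := A2) T o1 (show o ≤ H by omega) (by omega)
    (by rw [F2 _ rfl, F1 _ rfl, hnn]) (by rw [F2 _ rfl, F1 _ rfl]; exact hpar)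
    (by
      intro v h1 h2
      rw [F2 _ rfl, l1 v h1 h2, levelRes_min (by have := T.depth_lt h1 h2; omega)])
    hO
    (by rw [F2 _ rfl, F1 _ rfl]; exact z _ (by decide) (by decide) (by decide) (by decide) _)
    (by rw [F2 _ rfl, F1 _ rfl]; exact z _ (by decide) (by decide) (by decide) (by decide) _)
    (by rw [F2 _ rfl, F1 _ rfl]; exact z _ (by decide) (by decide) (by decide) (by decide) _)
    (by rw [F2 _ rfl, F1 _ rfl]; exact z _ (by decide) (by decide) (by decide) (by decide) _)
    (by rw [F2 _ rfl, F1 _ rfl]; exact z _ (by decide) (by decide) (by decide) (by decide))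
  have F3 : ∀ a, forestPhase.body.writes a = false → forestPhase.run K A2 a = A2 a :=
    fun a => Phase.run_of_not_writes _
  generalize forestPhase.run K A2 = A3 at hforest F3 ⊢
  generalize hN : A3 .tot 0 = N at hforest
  have hN3 := hforest.card_le
  have hW := sizePhase_spec (K := K) (B := b) (A := A3) (by omega)
    (by rw [F3 _ rfl, F2 _ rfl, F1 _ rfl, hbb]) hN hforest.parent_lt
    (by rw [F3 _ rfl, F2 _ rfl, F1 _ rfl]; exact z _ (by decide) (by decide) (by decide) (by decide))
    (by rw [F3 _ rfl, F2 _ rfl, F1 _ rfl]; exact z _ (by decide) (by decide) (by decide) (by decide))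
    (by rw [F3 _ rfl, F2 _ rfl, F1 _ rfl]; exact z _ (by decide) (by decide) (by decide) (by decide))
  have F4 : ∀ a, sizePhase.body.writes a = false → sizePhase.run K A3 a = A3 a :=
    fun a => Phase.run_of_not_writes _
  generalize sizePhase.run K A3 = A4 at hW F4 ⊢
  rw [← F4 .fp rfl, ← F4 .lab rfl, ← F4 .fs rfl] at hforest
  rw [← F4 .fp rfl, ← F4 .lab rfl] at hW
  have hG := groupPhase_spec (K := K) (A := A4) (by omega) hb
    (by rw [F4 _ rfl, F3 _ rfl, F2 _ rfl, F1 _ rfl, hbb]) (by rw [F4 _ rfl, hN]) hforest.parent_lt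
    (fun x => by split_ifs <;> omega) hW
    (by
      rw [F4 _ rfl, F3 _ rfl, F2 _ rfl, F1 _ rfl]
      exact z _ (by decide) (by decide) (by decide) (by decide))
    (by
      rw [F4 _ rfl, F3 _ rfl, F2 _ rfl, F1 _ rfl]
      exact z _ (by decide) (by decide) (by decide) (by decide) _) rfl
  have F5 : ∀ a, groupPhase.body.writes a = false → groupPhase.run K A4 a = A4 a :=
    fun a => Phase.run_of_not_writes _
  generalize groupPhase.run K A4 = A5 at hG F5 ⊢
  obtain ⟨hG, cl, hA⟩ := hG
  generalize hM : A5 .num 0 = M at hG hA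
  have hMN := hG.num_le
  have hcsz := countPhase_spec (K := K) (N := N) (A := A5) (by omega) (by rw [F5 _ rfl, F4 _ rfl, hN])
    (by
      rw [F5 _ rfl, F4 _ rfl, F3 _ rfl, F2 _ rfl, F1 _ rfl]
      exact z _ (by decide) (by decide) (by decide) (by decide))
  have F6 : ∀ a, countPhase.body.writes a = false → countPhase.run K A5 a = A5 a :=
    fun a => Phase.run_of_not_writes _
  generalize countPhase.run K A5 = A6 at hcsz F6 ⊢
  have hH := headerPhase_spec (K := K) (N := N) (M := M) (A := A6) (by omega)
    (by rw [F6 _ rfl, hM])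
    (by
      rw [F6 _ rfl, F5 _ rfl, F4 _ rfl, F3 _ rfl, F2 _ rfl, F1 _ rfl]
      exact z _ (by decide) (by decide) (by decide) (by decide) _)
    (by rw [F6 .memb rfl, F6 .rt rfl]; exact hcsz)
  have F7 : ∀ a, headerPhase.body.writes a = false → headerPhase.run K A6 a = A6 a :=
    fun a => Phase.run_of_not_writes _
  generalize headerPhase.run K A6 = A7 at hH F7 ⊢
  have hSG : SlabGrouping T H o b N M (A4 .fp) (A4 .lab) (A4 .fs) (A4 .sz) (A4 .own) (A4 .hv)
      (A5 .memb) (A5 .cur) (A5 .rt) := ⟨hforest, hW, hG⟩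
  -- The root of `T` lies in some group, so the loop that writes the number `M` is entered.
  have hM1 : 1 ≤ M := by
    have h1 : 1 ∈ T.slabNodes H o 0 := by
      rw [T.mem_slabNodes, T.mem_slab, T.depth_one]
      left; omega
    obtain ⟨c, hc, -⟩ := hSG.cover h1
    omega
  obtain ⟨h1, h2, h3⟩ := hH
  rw [← F7 .memb rfl, ← F7 .rt rfl, ← F7 .lab rfl, ← F7 .fs rfl] at h3
  rw [← F7 .memb rfl, ← F7 .rt rfl] at h2
  have hfill := fillPhase_spec (K := K) (N := N) (M := M) (A := A7) (by omega)
    (by rw [F7 _ rfl, F6 _ rfl, F5 _ rfl, F4 _ rfl, hN]) (h1 hM1)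
    (by rw [F7 _ rfl, F6 _ rfl]; exact fun j _ hj => hG.memb_le j hj) h2 h3
  rw [F7 .memb rfl, F7 .rt rfl, F7 .lab rfl, F7 .fs rfl, F6 .memb rfl, F6 .rt rfl, F6 .lab rfl,
    F6 .fs rfl, F5 .lab rfl, F5 .fs rfl] at hfill
  exact ⟨o, N, M, _, _, _, _, _, _, _, _, _, _, cl, ⟨o1, by omega⟩, hmin, hSG, hA, hfill.1, hfill.2⟩

end WordRAM

namespace WordRAM

/-- Replaces the content of register `r` by its minimum with that of register `0`. -/
def capReg (r : ℕ) : Program := .branch (.bin .lt (.reg 0) (.reg r)) (.assign r (.reg 0)) .skip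

theorem exec_capReg {w : ℕ} (hw : 1 < 2 ^ w) (r : ℕ) (σ : State) : ∃ t, t ≤ 6 ∧ (capReg r).Exec w σ
    { σ with reg := Function.update σ.reg r (min (σ.reg r) (σ.reg 0)) } t := by
  by_cases h : σ.reg 0 < σ.reg r
  · refine ⟨_, ?_, .branch_true ?_ (t := 2) ?_⟩
    · simp [Expr.cost]
    · simp [Expr.eval, BinOp.eval, h, Nat.mod_eq_of_lt hw]
    · rw [min_eq_right h.le]
      exact .assign σ r (.reg 0)
  · refine ⟨_, ?_, .branch_false ?_ (t := 1) ?_⟩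
    · simp [Expr.cost]
    · simp [Expr.eval, BinOp.eval, h]
    · rw [min_eq_left (not_lt.1 h), Function.update_eq_self]
      exact .skip σ

/-- Computes the stride and sets up the scalars. -/
def preludeProgram : Program :=
  .seq (.assign 3 (.bin .add (.bin .mul (.lit 20) (.reg 0)) (.lit 1)))
    (.seq (capReg 1) (.seq (capReg 2)
      (.seq (.store (Arr.addr .nn (.lit 0)) (.reg 0))
        (.seq (.store (Arr.addr .hh (.lit 0)) (.reg 1))
          (.store (Arr.addr .bb (.lit 0)) (.reg 2))))))

theorem initialArrays_eq {n : ℕ} (T : OrdinalTree n) (h b : ℕ) : initialArrays T h b =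
    Arrays.set (Arrays.set (Arrays.set (initialArrays T 0 0) .nn 0 n) .hh 0 h) .bb 0 b := by
  funext a x
  cases a <;> simp [Arrays.set, initialArrays, Function.update_apply]
  all_goals intro hx; simp [hx]

/-- The array `par` has rank `0`, so the parents already are in their place. The scalars are not
stored yet; setting the cell of `nn` to `0` undoes the value `n` in `initialArrays`. -/
theorem rep_input {n w K : ℕ} (T : OrdinalTree n) (hK : K = 20 * n) (hw : 26 * (K + 1) ≤ 2 ^ w)
    (H B : ℕ) {r : ℕ → ℕ} (hr : r 3 = K + 1) :
    Rep w K { T.input H B with reg := r } (Arrays.set (initialArrays T 0 0) .nn 0 0) := by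
  have hn := T.pos
  have e : Arrays.set (initialArrays T 0 0) .nn 0 0 =
      fun a x => if a = .par ∧ x ∈ Finset.Icc 1 n then T.parent x else 0 := by
    funext a x
    cases a <;> simp [Arrays.set, initialArrays, Function.update_apply]
    exact fun h1 h2 => absurd h2 h1
  rw [e]
  refine ⟨by omega, hw, hr, fun a x => ?_, fun a x hx => ?_⟩
  · split_ifs with h
    · have h1 := Finset.mem_Icc.1 h.2
      have := T.parent_lt h1.1 h1.2
      omega
    · exact Nat.zero_le _
  · by_cases ha : a = .par
    · subst ha
      simp [OrdinalTree.input, Arr.rank]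
    · have hr : 1 ≤ a.rank := by
        rw [Nat.one_le_iff_ne_zero]
        exact fun h0 => ha (Arr.rank_injective h0)
      have := Nat.mul_le_mul_right (K + 1) hr
      simp only [OrdinalTree.input, ha, false_and, if_false]
      rw [if_neg]
      rw [Finset.mem_Icc]
      omega

theorem exec_prelude {n w K : ℕ} (T : OrdinalTree n) (hK : K = 20 * n)
    (hw : 26 * (K + 1) ≤ 2 ^ w) (H B : ℕ) :
    ∃ τ t, preludeProgram.Exec w (T.input H B) τ t ∧ t ≤ 60 ∧
      Rep w K τ (initialArrays T (min H n) (min B n)) := by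
  have hn := T.pos
  have hv : (Expr.bin .add (.bin .mul (.lit 20) (.reg 0)) (.lit 1)).eval w (T.input H B) =
      K + 1 := by
    simp only [Expr.eval, BinOp.eval, OrdinalTree.input, if_true]
    rw [Nat.mod_eq_of_lt (a := 20) (by omega), Nat.mod_eq_of_lt (a := 1) (by omega),
      Nat.mod_eq_of_lt (a := 20 * n) (by omega), Nat.mod_eq_of_lt (by omega), hK]
  have x1 := Program.Exec.assign (w := w) (T.input H B) 3
    (.bin .add (.bin .mul (.lit 20) (.reg 0)) (.lit 1))
  rw [hv] at x1
  obtain ⟨t2, c2, x2⟩ := exec_capReg (w := w) (by omega) 1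
    (State.mk (Function.update (T.input H B).reg 3 (K + 1)) (T.input H B).mem)
  obtain ⟨t3, c3, x3⟩ := exec_capReg (w := w) (by omega) 2
    (State.mk (Function.update (Function.update (T.input H B).reg 3 (K + 1)) 1 (min H n))
      (T.input H B).mem)
  have e2 : Function.update (Function.update (T.input H B).reg 3 (K + 1)) 1
      (min (Function.update (T.input H B).reg 3 (K + 1) 1)
        (Function.update (T.input H B).reg 3 (K + 1) 0)) =
      Function.update (Function.update (T.input H B).reg 3 (K + 1)) 1 (min H n) := by
    congr 1
  change Program.Exec w _ _ ⟨_, _⟩ _ at x2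
  simp only [e2] at x2
  generalize hr : Function.update (Function.update (Function.update (T.input H B).reg 3 (K + 1)) 1
        (min H n)) 2 (min (Function.update (Function.update (T.input H B).reg 3 (K + 1)) 1
        (min H n) 2) (Function.update (Function.update (T.input H B).reg 3 (K + 1)) 1
        (min H n) 0)) = r at x3
  have r0 : r 0 = n := by rw [← hr]; rfl
  have r1 : r 1 = min H n := by rw [← hr]; rfl
  have r2 : r 2 = min B n := by rw [← hr]; rfl
  have r3 : r 3 = K + 1 := by rw [← hr]; rfl
  have hR := rep_input T hK hw H B r3
  have hz : ∀ σ' : State, (Expr.lit 0).eval w σ' = 0 := fun σ' => Nat.zero_mod _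
  have x4 := Program.Exec.store (w := w) { T.input H B with reg := r } (Arr.addr .nn (.lit 0)) (.reg 0)
  rw [hR.eval_addr .nn (hz _) (Nat.zero_le _)] at x4
  have hR4 := hR.store .nn (i := 0) (v := n) (Nat.zero_le _) (by omega)
  have x5 := Program.Exec.store (w := w)
    (State.mk r (Function.update (T.input H B).mem (Arr.rank .nn * (K + 1) + 0) n))
    (Arr.addr .hh (.lit 0)) (.reg 1)
  rw [hR4.eval_addr .hh (hz _) (Nat.zero_le _)] at x5
  have hR5 := hR4.store .hh (i := 0) (v := min H n) (Nat.zero_le _) (by omega)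
  have x6 := Program.Exec.store (w := w)
    (State.mk r (Function.update (Function.update (T.input H B).mem
      (Arr.rank .nn * (K + 1) + 0) n) (Arr.rank .hh * (K + 1) + 0) (min H n)))
    (Arr.addr .bb (.lit 0)) (.reg 2)
  rw [hR5.eval_addr .bb (hz _) (Nat.zero_le _)] at x6
  have hR6 := hR5.store .bb (i := 0) (v := min B n) (Nat.zero_le _) (by omega)
  simp only [Expr.eval, r0] at x4
  simp only [Expr.eval, r1] at x5
  simp only [Expr.eval, r2] at x6
  refine ⟨_, _, .seq x1 (.seq x2 (.seq x3 (.seq x4 (.seq x5 x6)))), ?_, ?_⟩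
  · simp only [Expr.cost, Arr.addr]; omega
  · rw [initialArrays_eq]
    convert hR6 using 2
    simp [Arrays.set]

/-- The tree slabbing program. -/
def slabbingProgram : Program :=
  .seq preludeProgram (.seq (compilePhases slabbingPhases) (.assign 0 (.bin .mul (.lit 24) (.reg 3))))

/-- The array `out` has rank `24`, which explains the address left in register `0`. -/
theorem exec_slabbing {n w K : ℕ} (T : OrdinalTree n) (hK : K = 20 * n)
    (hw : 26 * (K + 1) ≤ 2 ^ w) (H B : ℕ) :
    ∃ τ t, slabbingProgram.Exec w (T.input H B) τ t ∧ t ≤ 64 + phasesCost slabbingPhases * K ∧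
      τ.reg 0 = 24 * (K + 1) ∧ ∀ x ≤ K, τ.mem (24 * (K + 1) + x) =
        runPhases K slabbingPhases (initialArrays T (min H n) (min B n)) .out x := by
  obtain ⟨τ, t, h1, h2, h3⟩ := exec_prelude T hK hw H B
  obtain ⟨τ', t', g1, g2, g3⟩ := exec_compilePhases slabbingPhases h3
  refine ⟨_, _, .seq h1 (.seq g1 (.assign τ' 0 _)), ?_, ?_, fun x hx => g3.mem_eq .out x hx⟩
  · simp only [Expr.cost]; omega
  · simp only [Expr.eval, BinOp.eval, g3.stride, Function.update_self]
    rw [Nat.mod_eq_of_lt (a := 24) (by omega), Nat.mod_eq_of_lt (by omega)]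

end WordRAM

theorem SlabGrouping.encodeList_eq {n : ℕ} {T : OrdinalTree n} {H o b N M : ℕ}
    {fp lab fs sz own hv memb cur rt : ℕ → ℕ}
    (h : SlabGrouping T H o b N M fp lab fs sz own hv memb cur rt) :
    SlabSubtree.encodeList ((List.range' 1 M).map (groupSubtree lab fs memb rt N)) =
      M :: (List.range' 1 M).flatMap (groupBlock lab fs memb rt N N) := by
  unfold SlabSubtree.encodeList
  rw [List.length_map, List.length_range', List.flatMap_map]
  congr 1
  rw [List.flatMap_def, List.flatMap_def]
  congr 1
  refine List.map_congr_left fun c hc => ?_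
  rw [List.mem_range'_1] at hc
  have hc1 : 1 ≤ c := hc.1
  have hcM : c ≤ M := by omega
  rw [h.sort_nodes hc1 hcM, h.card_nodes hc1 hcM]
  rfl

theorem mainTheorem2 :
    ∃ (C : ℕ) (P : WordRAM.Program),
      ∀ (n H B w : ℕ) (T : OrdinalTree n), 3 ≤ H → H < B → B < 2 ^ w → C * n ≤ 2 ^ w →
        ∃ (o : ℕ) (D : Finset SlabSubtree) (σ : WordRAM.State) (t : ℕ),
          P.Exec w (T.input H B) σ t ∧ t ≤ C * n ∧ σ.Outputs w D ∧
          T.IsTreeSlabbing H B o D ∧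
          (D.card : ℝ) ≤ C * ((n : ℝ) / H + 1) ∧
          ((D.filter (T.IsFat H B o)).card : ℝ) ≤ C * ((n : ℝ) / B) ∧
          ((T.promotedConnections H o D).card : ℝ) ≤ C * ((n : ℝ) / H) := by
  -- The 26 arrays need `26 * (20 * n + 1) ≤ 546 * n` words. The phases take at most `20 * n` times
  -- their cost, and the 64 further steps are covered by `546 * n`.
  refine ⟨546 + 20 * WordRAM.phasesCost WordRAM.slabbingPhases, WordRAM.slabbingProgram, ?_⟩
  generalize hQ : WordRAM.phasesCost WordRAM.slabbingPhases = Q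
  intro n H B w T hH hHB _ hw
  have hn := T.pos
  have hCn : (546 + 20 * Q) * n = 546 * n + Q * (20 * n) := by ring
  rw [hCn] at hw
  obtain ⟨o, N, M, fp, lab, fs, sz, own, hv, memb, cur, rt, acc, cl, ho, hmin, hG, hA, hM, hout⟩ :=
    WordRAM.runPhases_slabbing (K := 20 * n) (b := min B n) T rfl hH (by omega) (by omega)
  obtain ⟨σ, t, hex, ht, hreg, hmem⟩ := WordRAM.exec_slabbing T rfl
    (show 26 * (20 * n + 1) ≤ 2 ^ w by omega) H B
  have hN := hG.forest.card_le
  have hMN := hG.groups.num_le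
  have hnd : ((List.range' 1 M).map (groupSubtree lab fs memb rt N)).Nodup := by
    refine List.Nodup.map_on ?_ List.nodup_range'
    intro c hc c' hc' he
    rw [List.mem_range'_1] at hc hc'
    exact hG.groupSubtree_inj hc.1 (by omega) hc'.1 (by omega) he
  set D : Finset SlabSubtree :=
    ⟨((List.range' 1 M).map (groupSubtree lab fs memb rt N) : List SlabSubtree),
      Multiset.coe_nodup.2 hnd⟩ with hDdef
  have hD : ∀ μ, μ ∈ D ↔ ∃ c, (1 ≤ c ∧ c ≤ M) ∧ groupSubtree lab fs memb rt N c = μ := by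
    intro μ
    rw [hDdef, Finset.mem_mk, Multiset.mem_coe, List.mem_map]
    refine exists_congr fun c => and_congr_left fun _ => ?_
    rw [List.mem_range'_1]; omega
  obtain ⟨c1, c2, c3⟩ := hG.counts (B := B) hA (by omega) (by omega) (by omega) ho.1 ho.2 hHB.le hmin hD
  have hT := hG.isTreeSlabbing (B := B) hA (by omega) (by omega) (by omega) ho.1 ho.2 hmin hD
  have hHpos : (0 : ℝ) < H := by exact_mod_cast (show 0 < H by omega)
  have hBpos : (0 : ℝ) < B := by exact_mod_cast (show 0 < B by omega)
  refine ⟨o, D, σ, t, hex, ?_, ⟨_, hnd, fun μ => Iff.rfl, ?_, ?_⟩, hT, ?_, ?_, ?_⟩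
  · rw [hCn, ← hQ]; omega
  · rw [hreg, hG.encodeList_eq, List.length_cons, (flatMap_blocks M hout).1]
    have := blockEnd_le memb rt N M
    omega
  · intro j hj
    have hlen : j ≤ 20 * n := by
      rw [hG.encodeList_eq, List.length_cons, (flatMap_blocks M hout).1] at hj
      have := blockEnd_le memb rt N M
      omega
    rw [hreg, hmem j hlen]
    simp only [hG.encodeList_eq]
    rcases j with _ | j
    · rw [hM]; rfl
    · rw [List.getElem_cons_succ]
      refine (congrArg _ (add_comm j 1)).trans ?_
      exact (flatMap_blocks M hout).2 j _ (List.getElem?_eq_getElem _)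
  · have h1 : (H : ℝ) * D.card ≤ 22 * n + H := by exact_mod_cast c1
    have h2 : (D.card : ℝ) ≤ (22 * n + H) / H := by rw [le_div_iff₀ hHpos]; linarith
    refine h2.trans ?_
    have h3 : (22 * (n : ℝ) + H) / H = 22 * (n / H) + 1 := by field_simp
    have h4 : (0 : ℝ) ≤ n / H := by positivity
    have h5 : (0 : ℝ) ≤ Q := Nat.cast_nonneg _
    rw [h3]; push_cast
    nlinarith [mul_nonneg h5 h4]
  · have h1 : (B : ℝ) * (D.filter (T.IsFat H B o)).card ≤ 21 * n := by exact_mod_cast c2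
    have h2 : ((D.filter (T.IsFat H B o)).card : ℝ) ≤ 21 * n / B := by
      rw [le_div_iff₀ hBpos]; linarith
    refine h2.trans ?_
    have h4 : (0 : ℝ) ≤ n / B := by positivity
    have h5 : (0 : ℝ) ≤ Q := Nat.cast_nonneg _
    rw [mul_div_assoc]; push_cast
    nlinarith [mul_nonneg h5 h4]
  · have h1 : (H : ℝ) * (T.promotedConnections H o D).card ≤ 22 * n := by exact_mod_cast c3
    have h2 : ((T.promotedConnections H o D).card : ℝ) ≤ 22 * n / H := by
      rw [le_div_iff₀ hHpos]; linarith
    refine h2.trans ?_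
    have h4 : (0 : ℝ) ≤ n / H := by positivity
    have h5 : (0 : ℝ) ≤ Q := Nat.cast_nonneg _
    rw [mul_div_assoc]; push_cast
    nlinarith [mul_nonneg h5 h4]
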